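/- Let $d\in\mathbb N$, let $r,k>0$, let $A$ be a symmetric real $d\times d$ matrix, let $\hat Q,\hat B,\hat C,\hat D$ be real $d\times d$ matrices with $\hat Q$ symmetric positive definite and $\hat B$ symmetric, and let $H,\Delta\in\mathbb R^d$. For a probability density $m$ on $\mathbb R^d$ with finite second moment put $$\hat V[m](x)=(x-H)^T\hat Q(x-H)+\int\Big((x-H)^T\tfrac{\hat B}{2}(\xi-\Delta)+(\xi-\Delta)^T\tfrac{\hat B}{2}(x-H)\Big)m(\xi)\,d\xi+\int(\xi-\Delta)^T\hat C(\xi-\Delta)\,m(\xi)\,d\xi+\bar\xi^T\hat D\,\bar\xi,$$ where $\bar\xi=\int(\xi-\Delta)\,m(\xi)\,d\xi$. For $\ell>0$ consider the discounted mean field system $$\text{(MF)}\quad\begin{cases}-k\,\Delta v+\frac1{2r}|\nabla v|^2-\nabla v^TAx+\ell v=\hat V[m](x),\\ -k\,\Delta m-\operatorname{div}\big(m\,(\frac{\nabla v}{r}-Ax)\big)=0,\\ \int_{\mathbb R^d}m\,dx=1,\quad m>0,\end{cases}$$ whose solutions are pairs $(v,m)$ of $C^2$ functions on $\mathbb R^d$,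 $m$ having finite second moment. A solution is called Quadratic--Gaussian (QG) if $$v(x)=x^T\tfrac{\Lambda}{2}x+\rho\cdot x+c,\qquad m=\text{density of }\mathcal N(\mu,\Sigma^{-1}),$$ for some symmetric matrices $\Lambda,\Sigma$ with $\Sigma$ positive definite, vectors $\mu,\rho$ and $c\in\mathbb R$. Then there is $\hat\ell>0$ such that the following hold for all $0<\ell<\hat\ell$. (a) (MF) has a unique QG solution if and only if the matrix $\mathcal B^\infty_\ell=\hat Q+\frac r2A^2-\frac{\ell r}2A+\frac12\hat B$ is invertible. (b) If $\hat B$ is positive semidefinite, then (MF) has a QG solution $(v,m)$, and, with $c=v(0)$, it is the only solution of (MF), QG or not, whose first component takes the value $c$ at $0$. (c) For every $N\ge1$ let an $N$-player game be given with dynamics $dX^i_t=(AX^i_t-\alpha^i_t)\,dt+\sigma\,dW^i_t$, discounted costs with control cost $\frac12\alpha^TR\alpha$, and displacement costs $F^i(X)=\sum_{j,l}(X^j-\overline{X_i}^j)^TQ^i_{jl}(X^l-\overline{X_i}^l)$, such that $A$, $\sigma$, $R$, $H$, $\Delta$ do not depend on $N$ and: $\sigma$ is invertible, $\frac12\sigma^T\sigma=k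 I_d$, $R=rI_d$; the $Nd\times Nd$ matrices $Q^i=(Q^i_{jl})_{j,l}$ are symmetric; for all $i$ one has $Q^i_{ii}=Q^N$ symmetric positive definite, $\overline{X_i}^i=H$, and, for all $j\ne i$, $Q^i_{ij}=\frac12B^N$, $Q^i_{jj}=C^N_i$, $\overline{X_i}^j=\Delta$, and $Q^i_{jl}=D^N_i$ for distinct $j,l\neq i$. Assume that, as $N\to\infty$, $Q^N\to\hat Q$, $(N-1)B^N\to\hat B$, and, for every $i$, $(N-1)C^N_i\to\hat C$ and $(N-1)^2D^N_i\to\hat D$, and that (MF) has a unique QG solution. Consider the system, for $i=1,\dots,N$, $$\begin{cases}-k\,\Delta v^i+\frac1{2r}|\nabla v^i|^2-(\nabla v^i)^TAx+\ell v^i=\int_{\mathbb R^{d(N-1)}}F^i(\xi^1,\dots,\xi^{i-1},x,\xi^{i+1},\dots,\xi^N)\prod_{j\ne i}m^j(\xi^j)\,d\xi^j,\\ -k\,\Delta m^i-\operatorname{div}\big(m^i(\frac{\nabla v^i}{r}-Ax)\big)=0,\\ \int_{\mathbb R^d}m^i\,dx=1,\quad m^i>0\end{cases}$$ (solutions being understood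 as for (MF)). Then for all large $N$ this system has a unique solution of the form $v^i_N(x)=x^T\frac{\Lambda}{2}x+\rho\cdot x+c^i$, $m^i_N=$ density of $\mathcal N(\mu,\Sigma^{-1})$, with symmetric $\Lambda,\Sigma$, $\Sigma$ positive definite, $\Lambda,\Sigma,\mu,\rho$ common to all the players, and $c^i\in\mathbb R$. Moreover, as $N\to\infty$ these solutions converge to the QG solution $(v,m)$ of (MF): for every $i$, $v^i_N\to v$ in $C^1_{loc}(\mathbb R^d)$ with second derivatives converging uniformly on $\mathbb R^d$, and $m^i_N\to m$ in $C^n(\mathbb R^d)$ for every $n$. -/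

import Mathlib

open MeasureTheory Filter Topology Matrix

noncomputable section

namespace LQMFG

/-- The state space `ℝᵈ` with its Euclidean norm. -/
abbrev E (d : ℕ) : Type := EuclideanSpace ℝ (Fin d)

/-- Real `d × d` matrices. -/
abbrev Mat (d : ℕ) : Type := Matrix (Fin d) (Fin d) ℝ

/-- The matrix-vector product `M x`, as a vector of the Euclidean space. -/
def app {d : ℕ} (M : Mat d) (x : E d) : E d := WithLp.toLp 2 (M *ᵥ x.ofLp)

/-- The bilinear form `xᵀ M y`. -/
def bil {d : ℕ} (M : Mat d) (x y : E d) : ℝ := inner ℝ x (app M y)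

/-- The divergence of a vector field, the trace of its derivative. -/
def divergence {d : ℕ} (F : E d → E d) (x : E d) : ℝ :=
  ∑ i : Fin d, (fderiv ℝ F x (EuclideanSpace.single i 1)) i

/-- `(v, m)` is a classical solution of the pair of equations
`-k Δv + |∇v|² / (2r) - ∇vᵀ A x + ℓ v = f(x)`,
`-k Δm - div (m (∇v / r - A x)) = 0`, with `∫ m = 1` and `m > 0`.
The second moment of `m` is finite, so that averages of quadratic functions against `m` exist. -/
structure SolvesHJBKFP {d : ℕ} (A : Mat d) (r k ℓ : ℝ) (f : E d → ℝ) (v m : E d → ℝ) :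
    Prop where
  contDiff_v : ContDiff ℝ 2 v
  contDiff_m : ContDiff ℝ 2 m
  hjb : ∀ x, -k * Laplacian.laplacian v x + 1 / (2 * r) * ‖gradient v x‖ ^ 2
      - inner ℝ (gradient v x) (app A x) + ℓ * v x = f x
  kfp : ∀ x, -k * Laplacian.laplacian m x
      - divergence (fun y => m y • ((1 / r) • gradient v y - app A y)) x = 0
  integrable_m : Integrable m
  integral_m : ∫ x, m x = 1
  pos_m : ∀ x, 0 < m x
  second_moment : Integrable (fun x => ‖x‖ ^ 2 * m x)

/-- The quadratic function `xᵀ (Λ/2) x + ρ x + c`. -/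
def quadratic {d : ℕ} (L : Mat d) (ρ : E d) (c : ℝ) (x : E d) : ℝ :=
  bil L x x / 2 + inner ℝ ρ x + c

/-- The density of the Gaussian law with mean `μ` and covariance matrix `S⁻¹`. -/
def gaussianDensity {d : ℕ} (μ : E d) (S : Mat d) (x : E d) : ℝ :=
  Real.sqrt (S.det / (2 * Real.pi) ^ d) * Real.exp (-(bil S (x - μ) (x - μ) / 2))

/-! ### The mean field system -/

/-- The mean field cost `V̂[m]`, where the measure is given by its density `m`. -/
def meanFieldCost {d : ℕ} (Q B C D : Mat d) (H Δ₀ : E d) (m : E d → ℝ) (x : E d) : ℝ :=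
  bil Q (x - H) (x - H)
    + (∫ ξ, (bil ((1 / 2 : ℝ) • B) (x - H) (ξ - Δ₀)
        + bil ((1 / 2 : ℝ) • B) (ξ - Δ₀) (x - H)) * m ξ)
    + (∫ ξ, bil C (ξ - Δ₀) (ξ - Δ₀) * m ξ)
    + bil D (∫ ξ, m ξ • (ξ - Δ₀)) (∫ ξ, m ξ • (ξ - Δ₀))

/-- `(v, m)` solves the discounted mean field system. -/
def IsMFSolution {d : ℕ} (A : Mat d) (r k ℓ : ℝ) (Q B C D : Mat d) (H Δ₀ : E d)
    (v m : E d → ℝ) : Prop :=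
  SolvesHJBKFP A r k ℓ (meanFieldCost Q B C D H Δ₀ m) v m

/-- The Quadratic-Gaussian form: `v` is quadratic and `m` is a Gaussian density. -/
def IsQG {d : ℕ} (v m : E d → ℝ) : Prop :=
  ∃ (L S : Mat d) (μ ρ : E d) (c : ℝ), L.IsSymm ∧ S.PosDef ∧
    v = quadratic L ρ c ∧ m = gaussianDensity μ S

/-- The matrix `Q + r A² / 2 - ℓ r A / 2 + B / 2`. -/
def limitMatrix {d : ℕ} (A : Mat d) (r ℓ : ℝ) (Q B : Mat d) : Mat d :=
  Q + (r / 2) • (A * A) - (ℓ * r / 2) • A + (1 / 2 : ℝ) • B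

/-! ### Games with `N` players -/

/-- The data of an `N`-player linear-quadratic game with dynamics
`dXⁱ = (A Xⁱ - αⁱ) dt + σ dWⁱ`, control cost `αᵀ R α / 2` and displacement costs
`Fⁱ(X) = ∑ⱼₖ (Xʲ - refⁱʲ)ᵀ Qⁱⱼₖ (Xᵏ - refⁱᵏ)`. Here `Q i j k` is the `(j, k)` block of the
cost matrix of player `i`. -/
structure LQGame (d N : ℕ) where
  A : Mat d
  σ : Mat d
  R : Mat d
  Q : Fin N → Fin N → Fin N → Mat d
  ref : Fin N → Fin N → E d

namespace LQGame

variable {d N : ℕ}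

/-- `σ` is invertible, `R` is symmetric positive definite, and the `Nd × Nd` cost matrices are
symmetric. -/
structure H1 (G : LQGame d N) : Prop where
  σ_inv : IsUnit G.σ
  R_posDef : G.R.PosDef
  Q_symm : ∀ i j k, (G.Q i j k)ᵀ = G.Q i k j

/-- Nearly identical players. -/
structure H2 (G : LQGame d N) (Q B : Mat d) (C D : Fin N → Mat d) (H Δ₀ : E d) : Prop where
  Q_posDef : Q.PosDef
  Q_own : ∀ i, G.Q i i i = Q
  ref_own : ∀ i, G.ref i i = H
  Q_cross : ∀ i j, j ≠ i → G.Q i i j = (1 / 2 : ℝ) • B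
  Q_diag : ∀ i j, j ≠ i → G.Q i j j = C i
  ref_other : ∀ i j, j ≠ i → G.ref i j = Δ₀
  Q_other : ∀ i j k, j ≠ i → k ≠ i → j ≠ k → G.Q i j k = D i

/-- `A` is symmetric, `R = r I` and `σᵀ σ / 2 = k I`. -/
structure H3 (G : LQGame d N) (r k : ℝ) : Prop where
  A_symm : G.A.IsSymm
  r_pos : 0 < r
  k_pos : 0 < k
  R_eq : G.R = r • (1 : Mat d)
  ν_eq : (1 / 2 : ℝ) • (G.σᵀ * G.σ) = k • (1 : Mat d)

/-- The displacement cost of player `i`. -/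
def cost (G : LQGame d N) (i : Fin N) (X : Fin N → E d) : ℝ :=
  ∑ j, ∑ k, bil (G.Q i j k) (X j - G.ref i j) (X k - G.ref i k)

/-- The profile in which player `i` is at `x` and the others are at `ξ`. -/
def profile (i : Fin N) (x : E d) (ξ : {j : Fin N // j ≠ i} → E d) (j : Fin N) : E d :=
  if h : j = i then x else ξ ⟨j, h⟩

/-- The displacement cost of player `i` at `x`, averaged over the laws (with densities `m j`) of
the other players. -/
def averagedCost (G : LQGame d N) (m : Fin N → E d → ℝ) (i : Fin N) (x : E d) : ℝ :=
  ∫ ξ : {j : Fin N // j ≠ i} → E d, G.cost i (profile i x ξ) * ∏ j : {j : Fin N // j ≠ i}, m j (ξ j)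

/-- `(vⁱ, mⁱ)` solves the system of `2N` Hamilton-Jacobi-Bellman and Kolmogorov-Fokker-Planck
equations of the discounted game. -/
def IsSolution (G : LQGame d N) (r k ℓ : ℝ) (v m : Fin N → E d → ℝ) : Prop :=
  ∀ i, SolvesHJBKFP G.A r k ℓ (G.averagedCost m i) (v i) (m i)

end LQGame

/-- The Quadratic-Gaussian form for `N` players: the coefficients are common to all the players,
except for the additive constants `cⁱ`. -/
def IsQGProfile {d N : ℕ} (v m : Fin N → E d → ℝ) : Prop :=
  ∃ (L S : Mat d) (μ ρ : E d) (c : Fin N → ℝ), L.IsSymm ∧ S.PosDef ∧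
    ∀ i, v i = quadratic L ρ (c i) ∧ m i = gaussianDensity μ S

/-! ### Modes of convergence -/

/-- Convergence in `C¹_loc` together with uniform convergence of the second derivatives. -/
def ConvergesValue {d : ℕ} (w : ℕ → E d → ℝ) (v : E d → ℝ) : Prop :=
  (∀ j ≤ 1, TendstoLocallyUniformly (fun N => iteratedFDeriv ℝ j (w N)) (iteratedFDeriv ℝ j v)
    atTop) ∧
  TendstoUniformly (fun N => iteratedFDeriv ℝ 2 (w N)) (iteratedFDeriv ℝ 2 v) atTop

/-- Convergence in `Cⁿ(ℝᵈ)` for every `n`: uniform convergence of all derivatives. -/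
def ConvergesDensity {d : ℕ} (p : ℕ → E d → ℝ) (m : E d → ℝ) : Prop :=
  ∀ n j : ℕ, j ≤ n →
    TendstoUniformly (fun N => iteratedFDeriv ℝ j (p N)) (iteratedFDeriv ℝ j m) atTop

end LQMFG

end

/-!
Facing a Gaussian population, an agent pays a quadratic cost that depends on the population only
through its mean `μ` and an additive constant. Hence the value function is quadratic, and completing
the square shows that its optimal drift is `S (x - a)`, where
`S * S + ℓ • S = A * A - ℓ • A + (2 / r) • Q`. The right-hand side is positive definite for small
`ℓ`, and then has exactly one positive definite root `S`.

Such a quadratic value function `v₀` has no competitor. If `(v, m)` is any solution for the same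
cost, then `W = (v - v₀) / r` solves a Hamilton–Jacobi equation with drift `S (x - a)`. A
logarithmic barrier on large balls yields `W ≤ 0`, so that the Cole–Hopf transform `exp (W / 2k)` is
bounded. Since `m` is stationary for the drift `S (x - a) + ∇ W`, testing its equation against
`exp (W / 2k)` gives `∫ m exp (W / 2k) W = 0`, which forces `W = 0`. Now `m` is stationary for the
drift `S (x - a)`, and a Caccioppoli inequality for the logarithm of its ratio to the Gaussian with
mean `a` and precision matrix `S / k` shows that `m` is this Gaussian.

As `a` must be the mean `μ` of `m`, the whole system reduces to the linear equation
`(r • (A * A - ℓ • A + (2 / r) • Q) + B) μ = 2 Q H + B Δ₀`, whose matrix is twice the limit matrix.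
The game with `N` players leads to the same equation with coefficients that converge to those of the
mean field system, and `S`, `μ`, the value functions and the densities depend continuously on them.
-/

noncomputable section

namespace LQMFG

open scoped Gradient Laplacian

/-! ### Linear maps and bilinear forms given by matrices -/

section Matrices

variable {d : ℕ}

lemma app_eq_toEuclideanCLM (M : Mat d) (x : E d) :
    app M x = Matrix.toEuclideanCLM (n := Fin d) (𝕜 := ℝ) M x := rfl

lemma app_add_right (M : Mat d) (x y : E d) : app M (x + y) = app M x + app M y := by
  simp only [app_eq_toEuclideanCLM, map_add]

lemma app_sub_right (M : Mat d) (x y : E d) : app M (x - y) = app M x - app M y := by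
  simp only [app_eq_toEuclideanCLM, map_sub]

lemma app_neg_right (M : Mat d) (x : E d) : app M (-x) = -app M x := by
  simp only [app_eq_toEuclideanCLM, map_neg]

lemma app_smul_right (M : Mat d) (t : ℝ) (x : E d) : app M (t • x) = t • app M x := by
  simp only [app_eq_toEuclideanCLM, map_smul]

lemma app_add_left (M N : Mat d) (x : E d) : app (M + N) x = app M x + app N x := by
  simp only [app_eq_toEuclideanCLM, map_add, _root_.add_apply]

lemma app_sub_left (M N : Mat d) (x : E d) : app (M - N) x = app M x - app N x := by
  simp only [app_eq_toEuclideanCLM, map_sub, _root_.sub_apply]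

lemma app_smul_left (t : ℝ) (M : Mat d) (x : E d) : app (t • M) x = t • app M x := by
  simp only [app_eq_toEuclideanCLM, map_smul, _root_.smul_apply]

lemma app_mul (M N : Mat d) (x : E d) : app (M * N) x = app M (app N x) := by
  simp only [app, Matrix.mulVec_mulVec]

lemma app_one (x : E d) : app (1 : Mat d) x = x := by
  simp only [app, Matrix.one_mulVec]

lemma app_apply (M : Mat d) (x : E d) (i : Fin d) : app M x i = ∑ j, M i j * x j := rfl

lemma bil_eq_dotProduct (M : Mat d) (x y : E d) : bil M x y = x.ofLp ⬝ᵥ M *ᵥ y.ofLp :=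
  Matrix.inner_toEuclideanCLM M x y

lemma inner_app_transpose (M : Mat d) (x y : E d) :
    inner ℝ (app Mᵀ x) y = inner ℝ x (app M y) := by
  rw [real_inner_comm]
  change bil Mᵀ y x = bil M x y
  rw [bil_eq_dotProduct, bil_eq_dotProduct, Matrix.mulVec_transpose, dotProduct_comm,
    ← Matrix.dotProduct_mulVec]

lemma inner_app_of_isSymm {M : Mat d} (hM : M.IsSymm) (x y : E d) :
    inner ℝ (app M x) y = inner ℝ x (app M y) := by
  rw [← inner_app_transpose, hM.eq]

lemma bil_pos {M : Mat d} (hM : M.PosDef) {x : E d} (hx : x ≠ 0) : 0 < bil M x x := by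
  rw [bil_eq_dotProduct]
  exact hM.dotProduct_mulVec_pos (by simpa using hx)

lemma bil_nonneg {M : Mat d} (hM : M.PosSemidef) (x : E d) : 0 ≤ bil M x x := by
  rw [bil_eq_dotProduct]
  exact hM.dotProduct_mulVec_nonneg x.ofLp

lemma isSymm_of_posDef {M : Mat d} (hM : M.PosDef) : M.IsSymm :=
  Matrix.isHermitian_iff_isSymm.1 hM.isHermitian

lemma posDef_of_bil_pos {M : Mat d} (hM : M.IsSymm) (h : ∀ x : E d, x ≠ 0 → 0 < bil M x x) :
    M.PosDef := by
  refine Matrix.PosDef.of_dotProduct_mulVec_pos (by simpa [Matrix.IsHermitian] using hM.eq) ?_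
  intro x hx
  have hpos := h (WithLp.toLp 2 x) (by simpa using hx)
  rwa [bil_eq_dotProduct] at hpos

lemma exists_bound_bil (M : Mat d) :
    ∃ C : ℝ, 0 ≤ C ∧ ∀ x y : E d, |bil M x y| ≤ C * (‖x‖ * ‖y‖) := by
  refine ⟨‖Matrix.toEuclideanCLM (n := Fin d) (𝕜 := ℝ) M‖, norm_nonneg _, fun x y => ?_⟩
  calc |bil M x y| ≤ ‖x‖ * ‖app M y‖ := abs_real_inner_le_norm x (app M y)
    _ ≤ ‖x‖ * (‖Matrix.toEuclideanCLM (n := Fin d) (𝕜 := ℝ) M‖ * ‖y‖) := by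
        gcongr
        exact (Matrix.toEuclideanCLM (n := Fin d) (𝕜 := ℝ) M).le_opNorm y
    _ = _ := by ring

lemma contDiff_app (M : Mat d) {n : WithTop ℕ∞} : ContDiff ℝ n (app M) :=
  (Matrix.toEuclideanCLM (n := Fin d) (𝕜 := ℝ) M).contDiff

lemma hasFDerivAt_app (M : Mat d) (x : E d) :
    HasFDerivAt (app M) (Matrix.toEuclideanCLM (n := Fin d) (𝕜 := ℝ) M) x :=
  (Matrix.toEuclideanCLM (n := Fin d) (𝕜 := ℝ) M).hasFDerivAt

lemma continuous_app (M : Mat d) : Continuous (app M) := (contDiff_app M (n := 0)).continuous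

end Matrices

/-! ### Gradients -/

section Gradients

variable {V : Type*} [NormedAddCommGroup V] [InnerProductSpace ℝ V] [CompleteSpace V]
  {f g : V → ℝ} {a b x : V}

lemma hasGradientAt_add (hf : HasGradientAt f a x) (hg : HasGradientAt g b x) :
    HasGradientAt (fun y => f y + g y) (a + b) x := by
  rw [hasGradientAt_iff_hasFDerivAt] at *
  exact (hf.add hg).congr_fderiv (map_add _ a b).symm

lemma hasGradientAt_sub (hf : HasGradientAt f a x) (hg : HasGradientAt g b x) :
    HasGradientAt (fun y => f y - g y) (a - b) x := by
  rw [hasGradientAt_iff_hasFDerivAt] at *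
  exact (hf.sub hg).congr_fderiv (map_sub _ a b).symm

lemma hasGradientAt_mul (hf : HasGradientAt f a x) (hg : HasGradientAt g b x) :
    HasGradientAt (fun y => f y * g y) (f x • b + g x • a) x := by
  rw [hasGradientAt_iff_hasFDerivAt] at *
  exact (hf.mul hg).congr_fderiv (by simp only [map_add, map_smul])

lemma hasGradientAt_const_mul (c : ℝ) (hf : HasGradientAt f a x) :
    HasGradientAt (fun y => c * f y) (c • a) x := by
  rw [hasGradientAt_iff_hasFDerivAt] at *
  exact (hf.const_mul c).congr_fderiv (by simp only [map_smul])

lemma hasGradientAt_comp {φ : ℝ → ℝ} {φ' : ℝ} (hφ : HasDerivAt φ φ' (f x))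
    (hf : HasGradientAt f a x) : HasGradientAt (fun y => φ (f y)) (φ' • a) x := by
  rw [hasGradientAt_iff_hasFDerivAt] at *
  exact (hφ.comp_hasFDerivAt x hf).congr_fderiv (by simp only [map_smul])

lemma hasGradientAt_inner (ρ x : V) : HasGradientAt (fun y => inner ℝ ρ y) ρ x := by
  rw [hasGradientAt_iff_hasFDerivAt]
  exact (innerSL ℝ ρ).hasFDerivAt

lemma hasGradientAt_norm_sub_sq (a x : V) :
    HasGradientAt (fun y => ‖y - a‖ ^ 2) ((2 : ℝ) • (x - a)) x := by
  rw [hasGradientAt_iff_hasFDerivAt]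
  refine ((hasFDerivAt_id x).sub_const a).norm_sq.congr_fderiv ?_
  ext y
  simp

lemma hasGradientAt_comp_smul_sub (c : ℝ) (hf : HasGradientAt f b (c • (x - a))) :
    HasGradientAt (fun y => f (c • (y - a))) (c • b) x := by
  rw [hasGradientAt_iff_hasFDerivAt] at *
  refine (hf.comp x (((hasFDerivAt_id x).sub_const a).const_smul c)).congr_fderiv ?_
  ext y
  simp

lemma hasGradientAt_of_contDiff {n : WithTop ℕ∞} (hf : ContDiff ℝ n f) (hn : n ≠ 0) (x : V) :
    HasGradientAt f (∇ f x) x :=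
  (hf.differentiable hn x).hasGradientAt

lemma contDiff_gradient {m n : WithTop ℕ∞} (hf : ContDiff ℝ n f) (hmn : m + 1 ≤ n) :
    ContDiff ℝ m (∇ f) :=
  (InnerProductSpace.toDual ℝ V).symm.contDiff.comp (hf.fderiv_right hmn)

lemma hasCompactSupport_gradient (hf : HasCompactSupport f) : HasCompactSupport (∇ f) :=
  (hf.fderiv ℝ).comp_left (map_zero (InnerProductSpace.toDual ℝ V).symm)

lemma hasGradientAt_bil {d : ℕ} {M : Mat d} (hM : M.IsSymm) (a x : E d) :
    HasGradientAt (fun y => bil M (y - a) (y - a)) ((2 : ℝ) • app M (x - a)) x := by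
  rw [hasGradientAt_iff_hasFDerivAt]
  have hsub : HasFDerivAt (fun y : E d => y - a) (ContinuousLinearMap.id ℝ (E d)) x :=
    (hasFDerivAt_id x).sub_const a
  refine (hsub.inner ℝ ((hasFDerivAt_app M (x - a)).comp x hsub)).congr_fderiv ?_
  ext z
  simp only [ContinuousLinearMap.comp_id, ContinuousLinearMap.coe_comp, Function.comp_apply,
    fderivInnerCLM_apply, ContinuousLinearMap.prod_apply, InnerProductSpace.toDual_apply_apply,
    ContinuousLinearMap.coe_id', id_eq, inner_smul_left, conj_trivial]
  rw [← app_eq_toEuclideanCLM, ← inner_app_of_isSymm hM, real_inner_comm (app M (x - a)) z]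
  ring

end Gradients

/-! ### Divergences and Laplacians -/

section Divergence

variable {d : ℕ} {f g : E d → ℝ} {F G : E d → E d} {a x : E d}

lemma divergence_smul (hf : HasGradientAt f a x) (hF : DifferentiableAt ℝ F x) :
    divergence (fun y => f y • F y) x = inner ℝ a (F x) + f x * divergence F x := by
  have hfF : fderiv ℝ (fun y => f y • F y) x = _ :=
    ((hasGradientAt_iff_hasFDerivAt.1 hf).smul hF.hasFDerivAt).fderiv
  unfold divergence
  rw [hfF]
  simp [Finset.sum_add_distrib, Finset.mul_sum, PiLp.inner_apply, mul_comm, add_comm]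

lemma divergence_add (hF : DifferentiableAt ℝ F x) (hG : DifferentiableAt ℝ G x) :
    divergence (fun y => F y + G y) x = divergence F x + divergence G x := by
  unfold divergence
  rw [fderiv_fun_add hF hG]
  simp [Finset.sum_add_distrib]

lemma divergence_sub (hF : DifferentiableAt ℝ F x) (hG : DifferentiableAt ℝ G x) :
    divergence (fun y => F y - G y) x = divergence F x - divergence G x := by
  unfold divergence
  rw [fderiv_fun_sub hF hG]
  simp [Finset.sum_sub_distrib]

lemma divergence_const_smul (c : ℝ) (hF : DifferentiableAt ℝ F x) :
    divergence (fun y => c • F y) x = c * divergence F x := by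
  unfold divergence
  rw [fderiv_fun_const_smul hF]
  simp [Finset.mul_sum]

lemma divergence_comp_smul_sub (c : ℝ) {a : E d} (hF : DifferentiableAt ℝ F (c • (x - a))) :
    divergence (fun y => F (c • (y - a))) x = c * divergence F (c • (x - a)) := by
  have hcomp : fderiv ℝ (fun y => F (c • (y - a))) x
      = (fderiv ℝ F (c • (x - a))).comp (c • ContinuousLinearMap.id ℝ (E d)) :=
    (hF.hasFDerivAt.comp x (((hasFDerivAt_id x).sub_const a).const_smul c)).fderiv
  simp only [divergence, Finset.mul_sum, hcomp]
  exact Finset.sum_congr rfl fun i _ => by simp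

lemma divergence_app_sub (M : Mat d) (a x : E d) :
    divergence (fun y => app M (y - a)) x = M.trace := by
  have hM : HasFDerivAt (fun y => app M (y - a)) (Matrix.toEuclideanCLM (𝕜 := ℝ) M) x :=
    (Matrix.toEuclideanCLM (n := Fin d) (𝕜 := ℝ) M).hasFDerivAt.comp x
      ((hasFDerivAt_id x).sub_const a)
  unfold divergence
  rw [hM.fderiv, Matrix.trace]
  exact Finset.sum_congr rfl fun i _ => by simp [← app_eq_toEuclideanCLM, app_apply]

lemma divergence_sub_const (a x : E d) : divergence (fun y => y - a) x = d := by
  simpa [app_one] using divergence_app_sub (1 : Mat d) a x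

lemma divergence_eq_sum_fderiv_coord (hF : DifferentiableAt ℝ F x) :
    divergence F x = ∑ i, fderiv ℝ (fun y => F y i) x (EuclideanSpace.single i 1) := by
  refine Finset.sum_congr rfl fun i _ => ?_
  have hFi : HasFDerivAt (fun y => F y i)
      ((EuclideanSpace.proj (𝕜 := ℝ) i).comp (fderiv ℝ F x)) x :=
    (EuclideanSpace.proj (𝕜 := ℝ) i).hasFDerivAt.comp x hF.hasFDerivAt
  rw [hFi.fderiv]
  rfl

lemma integral_fderiv_eq_zero {V : Type*} [NormedAddCommGroup V] [NormedSpace ℝ V]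
    [FiniteDimensional ℝ V] [MeasurableSpace V] [BorelSpace V] {μ : Measure V}
    [μ.IsAddHaarMeasure] {h : V → ℝ} (hh : ContDiff ℝ 1 h) (hc : HasCompactSupport h) (v : V) :
    ∫ x, fderiv ℝ h x v ∂μ = 0 := by
  have hint : Integrable (fun x => fderiv ℝ h x v) μ :=
    ((hh.continuous_fderiv one_ne_zero).clm_apply
      continuous_const).integrable_of_hasCompactSupport (hc.fderiv_apply ℝ v)
  simpa using integral_mul_fderiv_eq_neg_fderiv_mul_of_integrable (μ := μ)
    (f := fun _ : V => (1 : ℝ)) (g := h) (v := v) (by simp) (by simpa using hint)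
    (by simpa using hh.continuous.integrable_of_hasCompactSupport hc)
    (fun x _ => differentiableAt_const _) (fun x _ => hh.differentiable one_ne_zero x)

lemma integral_divergence_eq_zero (hF : ContDiff ℝ 1 F) (hc : HasCompactSupport F) :
    ∫ x, divergence F x = 0 := by
  have hFi : ∀ i, ContDiff ℝ 1 fun x => F x i := fun i =>
    (EuclideanSpace.proj (𝕜 := ℝ) i).contDiff.comp hF
  have hci : ∀ i, HasCompactSupport fun x => F x i := fun i =>
    hc.comp_left (g := fun y : E d => y i) (by simp)
  simp only [fun x => divergence_eq_sum_fderiv_coord (hF.differentiable one_ne_zero x)]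
  rw [integral_finsetSum _ fun i _ =>
    (((hFi i).continuous_fderiv one_ne_zero).clm_apply
      continuous_const).integrable_of_hasCompactSupport ((hci i).fderiv_apply ℝ _)]
  exact Finset.sum_eq_zero fun i _ => integral_fderiv_eq_zero (hFi i) (hci i) _

lemma laplacian_eq_divergence_of_eventually (hg : ∀ᶠ y in 𝓝 x, HasGradientAt f (F y) y)
    (hF : DifferentiableAt ℝ F x) : Δ f x = divergence F x := by
  rw [InnerProductSpace.laplacian_eq_iteratedFDeriv_orthonormalBasis f
    (EuclideanSpace.basisFun (Fin d) ℝ), divergence]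
  have hfderiv : fderiv ℝ f =ᶠ[𝓝 x] fun y => innerSL ℝ (F y) := by
    filter_upwards [hg] with y hy using (hasGradientAt_iff_hasFDerivAt.1 hy).fderiv
  have hsecond : fderiv ℝ (fderiv ℝ f) x = (innerSL ℝ).comp (fderiv ℝ F x) := by
    rw [hfderiv.fderiv_eq]
    exact ((innerSL ℝ).hasFDerivAt.comp x hF.hasFDerivAt).fderiv
  refine Finset.sum_congr rfl fun i _ => ?_
  rw [iteratedFDeriv_two_apply, hsecond]
  simp [EuclideanSpace.inner_single_right]

lemma laplacian_eq_divergence (hg : ∀ y, HasGradientAt f (F y) y)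
    (hF : DifferentiableAt ℝ F x) : Δ f x = divergence F x :=
  laplacian_eq_divergence_of_eventually (Eventually.of_forall hg) hF

lemma laplacian_eq_divergence_gradient (hf : ContDiff ℝ 2 f) (x : E d) :
    Δ f x = divergence (∇ f) x :=
  laplacian_eq_divergence (hasGradientAt_of_contDiff hf two_ne_zero)
    ((contDiff_gradient hf one_add_one_eq_two.le).differentiable one_ne_zero x)

lemma continuous_laplacian (hf : ContDiff ℝ 2 f) : Continuous (Δ f) := by
  have hgrad : Continuous (fderiv ℝ (∇ f)) :=
    (contDiff_gradient hf one_add_one_eq_two.le).continuous_fderiv one_ne_zero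
  rw [funext fun x => laplacian_eq_divergence_gradient hf x]
  exact continuous_finsetSum _ fun i _ =>
    (EuclideanSpace.proj (𝕜 := ℝ) i).continuous.comp (hgrad.clm_apply continuous_const)

lemma hasCompactSupport_laplacian (hf : ContDiff ℝ 2 f) (hc : HasCompactSupport f) :
    HasCompactSupport (Δ f) := by
  rw [funext fun x => laplacian_eq_divergence_gradient hf x]
  exact ((hasCompactSupport_gradient hc).fderiv ℝ).comp_left
    (g := fun L : E d →L[ℝ] E d => ∑ i, (L (EuclideanSpace.single i 1)) i) (by simp)

lemma laplacian_comp_smul_sub (hf : ContDiff ℝ 2 f) (c : ℝ) (a x : E d) :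
    Δ (fun y => f (c • (y - a))) x = c ^ 2 * Δ f (c • (x - a)) := by
  have hgrad : Differentiable ℝ (∇ f) :=
    (contDiff_gradient hf one_add_one_eq_two.le).differentiable one_ne_zero
  have hscaled : DifferentiableAt ℝ (fun y => ∇ f (c • (y - a))) x := by fun_prop
  rw [laplacian_eq_divergence (fun y =>
      hasGradientAt_comp_smul_sub c (hasGradientAt_of_contDiff hf two_ne_zero _))
      (hscaled.fun_const_smul c),
    divergence_const_smul c hscaled, divergence_comp_smul_sub c (hgrad _),
    laplacian_eq_divergence_gradient hf, sq, mul_assoc]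

lemma laplacian_comp (hf : ContDiff ℝ 2 f) {φ φ' : ℝ → ℝ} {φ'' : ℝ}
    (hφ : ∀ t, HasDerivAt φ (φ' t) t) (hφ' : HasDerivAt φ' φ'' (f x)) :
    Δ (fun y => φ (f y)) x = φ'' * ‖∇ f x‖ ^ 2 + φ' (f x) * Δ f x := by
  have hgrad := hasGradientAt_of_contDiff hf two_ne_zero
  have hgradd : DifferentiableAt ℝ (∇ f) x :=
    (contDiff_gradient hf one_add_one_eq_two.le).differentiable one_ne_zero x
  have hφ'f := hasGradientAt_comp hφ' (hgrad x)
  rw [laplacian_eq_divergence (fun y => hasGradientAt_comp (hφ _) (hgrad y))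
    (hφ'f.differentiableAt.smul hgradd), divergence_smul hφ'f hgradd,
    laplacian_eq_divergence_gradient hf, inner_smul_left, real_inner_self_eq_norm_sq, conj_trivial]

lemma laplacian_mul (hf : ContDiff ℝ 2 f) (hg : ContDiff ℝ 2 g) (x : E d) :
    Δ (fun y => f y * g y) x = f x * Δ g x + 2 * inner ℝ (∇ f x) (∇ g x) + g x * Δ f x := by
  have hgradf := hasGradientAt_of_contDiff hf two_ne_zero
  have hgradg := hasGradientAt_of_contDiff hg two_ne_zero
  have hf2 : DifferentiableAt ℝ (∇ f) x :=
    (contDiff_gradient hf one_add_one_eq_two.le).differentiable one_ne_zero x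
  have hg2 : DifferentiableAt ℝ (∇ g) x :=
    (contDiff_gradient hg one_add_one_eq_two.le).differentiable one_ne_zero x
  have hfg := (hgradf x).differentiableAt.fun_smul hg2
  have hgf := (hgradg x).differentiableAt.fun_smul hf2
  rw [laplacian_eq_divergence (fun y => hasGradientAt_mul (hgradf y) (hgradg y)) (hfg.fun_add hgf),
    divergence_add hfg hgf, divergence_smul (hgradf x) hg2, divergence_smul (hgradg x) hf2,
    laplacian_eq_divergence_gradient hf, laplacian_eq_divergence_gradient hg,
    real_inner_comm (∇ f x) (∇ g x)]
  ring

end Divergence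

/-! ### Second derivatives at a local maximum -/

section LocalMax

lemma deriv_deriv_nonpos_of_isLocalMax {f : ℝ → ℝ} {x : ℝ} (h : IsLocalMax f x)
    (hc : ContinuousAt f x) : deriv (deriv f) x ≤ 0 := by
  by_contra! hpos
  have hmin := isLocalMin_of_deriv_deriv_pos hpos h.deriv_eq_zero hc
  have hconst : f =ᶠ[𝓝 x] fun _ => f x := by
    filter_upwards [h, hmin] with y h1 h2 using le_antisymm h1 h2
  rw [hconst.deriv.deriv_eq] at hpos
  simp at hpos

lemma fderiv_fderiv_nonpos_of_isLocalMax {V : Type*} [NormedAddCommGroup V] [NormedSpace ℝ V]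
    {f : V → ℝ} {x : V} (h : IsLocalMax f x) (hf : ContDiffAt ℝ 2 f x) (e : V) :
    fderiv ℝ (fderiv ℝ f) x e e ≤ 0 := by
  have hline : ∀ t : ℝ, HasDerivAt (fun s : ℝ => x + s • e) e t := fun t => by
    simpa using ((hasDerivAt_id t).smul_const e).const_add x
  have hline0 : Tendsto (fun s : ℝ => x + s • e) (𝓝 0) (𝓝 x) := by
    simpa using (hline 0).continuousAt.tendsto
  have hderiv : deriv (fun s : ℝ => f (x + s • e)) =ᶠ[𝓝 0] fun s => fderiv ℝ f (x + s • e) e := by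
    filter_upwards [hline0.eventually (hf.eventually (by simp))] with s hs
    exact ((hs.differentiableAt two_ne_zero).hasFDerivAt.comp_hasDerivAt s (hline s)).deriv
  have hfd2 : DifferentiableAt ℝ (fderiv ℝ f) x :=
    (hf.fderiv_right (m := 1) one_add_one_eq_two.le).differentiableAt one_ne_zero
  have hderiv2 : HasDerivAt (fun s : ℝ => fderiv ℝ f (x + s • e) e)
      (fderiv ℝ (fderiv ℝ f) x e e) 0 := by
    have hfd : HasFDerivAt (fderiv ℝ f) (fderiv ℝ (fderiv ℝ f) x) (x + (0 : ℝ) • e) := by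
      rw [zero_smul, add_zero]
      exact hfd2.hasFDerivAt
    have hcomp : HasDerivAt (fun s : ℝ => fderiv ℝ f (x + s • e))
        (fderiv ℝ (fderiv ℝ f) x e) 0 := hfd.comp_hasDerivAt 0 (hline 0)
    exact ((ContinuousLinearMap.apply ℝ ℝ e).hasFDerivAt.comp_hasDerivAt 0 hcomp :)
  have hmax : IsLocalMax (fun s : ℝ => f (x + s • e)) 0 := by
    simpa [IsLocalMax, IsMaxFilter] using hline0.eventually h
  have hcont : ContinuousAt (fun s : ℝ => f (x + s • e)) 0 := by
    have hfx : ContinuousAt f (x + (0 : ℝ) • e) := by simpa using hf.continuousAt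
    exact ContinuousAt.comp (f := fun s : ℝ => x + s • e) hfx (hline 0).continuousAt
  rw [← hderiv2.deriv, ← hderiv.deriv_eq]
  exact deriv_deriv_nonpos_of_isLocalMax hmax hcont

lemma laplacian_nonpos_of_isLocalMax {V : Type*} [NormedAddCommGroup V] [InnerProductSpace ℝ V]
    [FiniteDimensional ℝ V] {f : V → ℝ} {x : V} (h : IsLocalMax f x) (hf : ContDiffAt ℝ 2 f x) :
    Δ f x ≤ 0 := by
  rw [InnerProductSpace.laplacian_eq_iteratedFDeriv_stdOrthonormalBasis]
  refine Finset.sum_nonpos fun i _ => ?_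
  rw [iteratedFDeriv_two_apply]
  exact fderiv_fderiv_nonpos_of_isLocalMax h hf _

end LocalMax

/-! ### One-sided bound for the difference of two value functions -/

section MaximumPrinciple

variable {d : ℕ} {a x z : E d} {R k ℓ : ℝ} {S : Mat d} {W : E d → ℝ}

/-- The barrier `4 k log (R² - |x - a|²)`, which tends to `-∞` at the sphere of radius `R` around
`a`. Its coefficient makes the quadratic gradient term of the equation absorb its Laplacian. -/
def logBarrier (k R : ℝ) (a x : E d) : ℝ := 4 * k * Real.log (R ^ 2 - ‖x - a‖ ^ 2)

lemma sq_sub_norm_sq_pos (hx : ‖x - a‖ < R) : 0 < R ^ 2 - ‖x - a‖ ^ 2 := by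
  nlinarith [norm_nonneg (x - a)]

lemma eventually_norm_sub_lt (hx : ‖x - a‖ < R) : ∀ᶠ y in 𝓝 x, ‖y - a‖ < R := by
  have hcont : Continuous fun y : E d => ‖y - a‖ := by fun_prop
  exact hcont.continuousAt.eventually_lt_const hx

lemma hasGradientAt_sq_sub_norm_sq (a x : E d) (R : ℝ) :
    HasGradientAt (fun y => R ^ 2 - ‖y - a‖ ^ 2) ((-2 : ℝ) • (x - a)) x := by
  simpa using hasGradientAt_sub (hasGradientAt_const x (R ^ 2)) (hasGradientAt_norm_sub_sq a x)

lemma hasGradientAt_logBarrier (k : ℝ) (hx : ‖x - a‖ < R) :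
    HasGradientAt (logBarrier k R a) ((-8 * k * (R ^ 2 - ‖x - a‖ ^ 2)⁻¹) • (x - a)) x := by
  have h := hasGradientAt_const_mul (4 * k) (hasGradientAt_comp
    (f := fun y => R ^ 2 - ‖y - a‖ ^ 2) (Real.hasDerivAt_log (sq_sub_norm_sq_pos hx).ne')
    (hasGradientAt_sq_sub_norm_sq a x R))
  convert h using 1
  · rfl
  · rw [smul_smul, smul_smul]
    congr 1
    ring

lemma contDiffAt_logBarrier (k : ℝ) (hx : ‖x - a‖ < R) :
    ContDiffAt ℝ 2 (logBarrier k R a) x := by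
  refine contDiffAt_const.mul (ContDiffAt.log ?_ (sq_sub_norm_sq_pos hx).ne')
  exact (contDiff_const.sub ((contDiff_id.sub contDiff_const).norm_sq ℝ)).contDiffAt

lemma laplacian_logBarrier (k : ℝ) (hx : ‖x - a‖ < R) :
    Δ (logBarrier k R a) x = -16 * k * ‖x - a‖ ^ 2 * ((R ^ 2 - ‖x - a‖ ^ 2)⁻¹) ^ 2
      - 8 * k * d * (R ^ 2 - ‖x - a‖ ^ 2)⁻¹ := by
  have hinv := hasGradientAt_const_mul (-8 * k) (hasGradientAt_comp
    (f := fun y => R ^ 2 - ‖y - a‖ ^ 2) (hasDerivAt_inv (sq_sub_norm_sq_pos hx).ne')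
    (hasGradientAt_sq_sub_norm_sq a x R))
  have hid : DifferentiableAt ℝ (fun y : E d => y - a) x := by fun_prop
  rw [laplacian_eq_divergence_of_eventually
      ((eventually_norm_sub_lt hx).mono fun y hy => hasGradientAt_logBarrier k hy)
      (hinv.differentiableAt.smul hid),
    divergence_smul hinv hid, divergence_sub_const]
  simp only [inner_smul_left, real_inner_self_eq_norm_sq, conj_trivial]
  rw [inv_pow]
  ring

lemma exists_forall_add_logBarrier_le (hk : 0 < k) (hR : 0 < R) (a : E d) (hW : Continuous W) :
    ∃ z, ‖z - a‖ < R ∧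
      ∀ y, ‖y - a‖ < R → W y + logBarrier k R a y ≤ W z + logBarrier k R a z := by
  -- The exponential of `(W + barrier) / 4k` is continuous up to the sphere, where it vanishes.
  set f : E d → ℝ := fun y => Real.exp (W y / (4 * k)) * (R ^ 2 - ‖y - a‖ ^ 2)
  have hk4 : 0 < 4 * k := by positivity
  obtain ⟨z, -, hmax⟩ := (isCompact_closedBall a R).exists_isMaxOn (f := f)
    ⟨a, Metric.mem_closedBall_self hR.le⟩ (by fun_prop)
  have hfz : 0 < f z := by
    refine lt_of_lt_of_le ?_ (hmax (Metric.mem_closedBall_self hR.le))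
    exact mul_pos (Real.exp_pos _) (sq_sub_norm_sq_pos (by simpa using hR))
  have hz : ‖z - a‖ < R := by
    have h := pos_of_mul_pos_right hfz (Real.exp_pos _).le
    nlinarith [norm_nonneg (z - a)]
  have hlog : ∀ y, ‖y - a‖ < R → W y + logBarrier k R a y = 4 * k * Real.log (f y) := by
    intro y hy
    rw [Real.log_mul (Real.exp_ne_zero _) (sq_sub_norm_sq_pos hy).ne', Real.log_exp, mul_add,
      mul_div_cancel₀ _ hk4.ne', logBarrier]
  refine ⟨z, hz, fun y hy => ?_⟩
  rw [hlog y hy, hlog z hz]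
  have hfy : 0 < f y := mul_pos (Real.exp_pos _) (sq_sub_norm_sq_pos hy)
  have hmem : y ∈ Metric.closedBall a R := by
    rw [Metric.mem_closedBall, dist_eq_norm]
    exact hy.le
  exact mul_le_mul_of_nonneg_left (Real.log_le_log hfy (hmax hmem)) hk4.le

lemma gradient_eq_of_isLocalMax_add_logBarrier (hW : DifferentiableAt ℝ W z) (hz : ‖z - a‖ < R)
    (hloc : IsLocalMax (fun y => W y + logBarrier k R a y) z) :
    ∇ W z = (8 * k * (R ^ 2 - ‖z - a‖ ^ 2)⁻¹) • (z - a) := by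
  have hsum := hasGradientAt_add hW.hasGradientAt (hasGradientAt_logBarrier k hz)
  have hzero : ∇ (fun y => W y + logBarrier k R a y) z = 0 := by
    rw [gradient, hloc.fderiv_eq_zero, map_zero]
  rw [hsum.gradient] at hzero
  rw [eq_neg_of_add_eq_zero_left hzero, ← neg_smul]
  congr 1
  ring

lemma barrier_defect_le {n s t : ℝ} (hn : 0 ≤ n) (ht : 0 ≤ t) (hts : t < s) :
    n * (s - t)⁻¹ - 2 * t * ((s - t)⁻¹) ^ 2 ≤ n * (1 + n / 2) * s⁻¹ := by
  have hs : 0 < s := ht.trans_lt hts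
  have hst : 0 < s - t := sub_pos.2 hts
  have hfac : n * (s - t)⁻¹ - 2 * t * ((s - t)⁻¹) ^ 2
      = (n * (s - t) - 2 * t) * ((s - t)⁻¹) ^ 2 := by
    field_simp
  rcases le_total (n * (s - t)) (2 * t) with hle | hle
  · rw [hfac]
    exact (mul_nonpos_of_nonpos_of_nonneg (sub_nonpos.2 hle) (sq_nonneg _)).trans (by positivity)
  · have hinv : (s - t)⁻¹ ≤ (1 + n / 2) * s⁻¹ := by
      rw [← div_eq_mul_inv, le_div_iff₀ hs, inv_mul_le_iff₀ hst]
      linarith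
    calc n * (s - t)⁻¹ - 2 * t * ((s - t)⁻¹) ^ 2 ≤ n * (s - t)⁻¹ :=
          sub_le_self _ (by positivity)
      _ ≤ n * ((1 + n / 2) * s⁻¹) := mul_le_mul_of_nonneg_left hinv hn
      _ = n * (1 + n / 2) * s⁻¹ := (mul_assoc _ _ _).symm

lemma le_of_isLocalMax_add_logBarrier (hk : 0 < k) (hℓ : 0 < ℓ) (hS : S.PosSemidef)
    (hW : ContDiff ℝ 2 W) (hz : ‖z - a‖ < R)
    (hloc : IsLocalMax (fun y => W y + logBarrier k R a y) z)
    (h : -k * Δ W z + 1 / 2 * ‖∇ W z‖ ^ 2 + inner ℝ (∇ W z) (app S (z - a)) + ℓ * W z ≤ 0) :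
    W z ≤ 8 * k ^ 2 / ℓ * (d * (1 + d / 2) * (R ^ 2)⁻¹) := by
  have hlap : Δ W z + Δ (logBarrier k R a) z ≤ 0 := by
    rw [← hW.contDiffAt.laplacian_add (contDiffAt_logBarrier k hz)]
    exact laplacian_nonpos_of_isLocalMax hloc (hW.contDiffAt.add (contDiffAt_logBarrier k hz))
  have hdefect := barrier_defect_le (n := d) (Nat.cast_nonneg d) (sq_nonneg ‖z - a‖)
    (sub_pos.1 (sq_sub_norm_sq_pos hz))
  have hdrift : 0 ≤ 8 * k * (R ^ 2 - ‖z - a‖ ^ 2)⁻¹ * inner ℝ (z - a) (app S (z - a)) :=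
    mul_nonneg (mul_nonneg (by positivity) (inv_nonneg.2 (sq_sub_norm_sq_pos hz).le))
      (bil_nonneg hS _)
  rw [gradient_eq_of_isLocalMax_add_logBarrier (hW.differentiable two_ne_zero z) hz hloc,
    norm_smul, mul_pow, Real.norm_eq_abs, sq_abs, real_inner_smul_left] at h
  rw [laplacian_logBarrier k hz] at hlap
  rw [div_mul_eq_mul_div, le_div_iff₀ hℓ]
  linarith [mul_le_mul_of_nonneg_left hlap hk.le,
    mul_le_mul_of_nonneg_left hdefect (show 0 ≤ 8 * k ^ 2 by positivity)]

lemma le_of_hjb_subsolution (hk : 0 < k) (hℓ : 0 < ℓ) (hS : S.PosSemidef) (hW : ContDiff ℝ 2 W)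
    (h : ∀ x, -k * Δ W x + 1 / 2 * ‖∇ W x‖ ^ 2 + inner ℝ (∇ W x) (app S (x - a)) + ℓ * W x ≤ 0)
    (hx : ‖x - a‖ < R) :
    W x ≤ 8 * k ^ 2 / ℓ * (d * (1 + d / 2) * (R ^ 2)⁻¹)
      - 4 * k * Real.log (1 - ‖x - a‖ ^ 2 * (R ^ 2)⁻¹) := by
  have hR : 0 < R := (norm_nonneg _).trans_lt hx
  obtain ⟨z, hz, hmax⟩ := exists_forall_add_logBarrier_le hk hR a hW.continuous
  have hWz := le_of_isLocalMax_add_logBarrier hk hℓ hS hW hz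
    ((eventually_norm_sub_lt hz).mono fun y hy => hmax y hy) (h z)
  have hbarrier : logBarrier k R a z ≤ 4 * k * Real.log (R ^ 2) := by
    refine mul_le_mul_of_nonneg_left ?_ (by positivity)
    exact Real.log_le_log (sq_sub_norm_sq_pos hz) (sub_le_self _ (sq_nonneg _))
  have hlog : Real.log (1 - ‖x - a‖ ^ 2 * (R ^ 2)⁻¹)
      = Real.log (R ^ 2 - ‖x - a‖ ^ 2) - Real.log (R ^ 2) := by
    rw [← Real.log_div (sq_sub_norm_sq_pos hx).ne' (by positivity)]
    congr 1
    field_simp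
  have hxz := hmax x hx
  rw [logBarrier] at hxz
  rw [hlog]
  linarith

theorem nonpos_of_hjb_subsolution (hk : 0 < k) (hℓ : 0 < ℓ) (hS : S.PosSemidef)
    (hW : ContDiff ℝ 2 W)
    (h : ∀ x, -k * Δ W x + 1 / 2 * ‖∇ W x‖ ^ 2 + inner ℝ (∇ W x) (app S (x - a)) + ℓ * W x ≤ 0)
    (x : E d) : W x ≤ 0 := by
  have hinv : Tendsto (fun R : ℝ => (R ^ 2)⁻¹) atTop (𝓝 0) :=
    tendsto_inv_atTop_zero.comp (tendsto_pow_atTop two_ne_zero)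
  have hlim : Tendsto (fun R : ℝ => 8 * k ^ 2 / ℓ * (d * (1 + d / 2) * (R ^ 2)⁻¹)
      - 4 * k * Real.log (1 - ‖x - a‖ ^ 2 * (R ^ 2)⁻¹)) atTop
      (𝓝 (8 * k ^ 2 / ℓ * (d * (1 + d / 2) * 0) - 4 * k * Real.log (1 - ‖x - a‖ ^ 2 * 0))) :=
    ((hinv.const_mul _).const_mul _).sub
      ((tendsto_const_nhds.sub (hinv.const_mul _)).log (by simp) |>.const_mul _)
  simp only [mul_zero, sub_zero, Real.log_one] at hlim
  refine ge_of_tendsto hlim ?_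
  filter_upwards [eventually_gt_atTop ‖x - a‖] with R hR
  exact le_of_hjb_subsolution hk hℓ hS hW h hR

end MaximumPrinciple

/-! ### Cutoff functions and the generator of a diffusion -/

section Cutoff

lemma hasCompactSupport_of_forall_eq_zero {X Y Z : Type*} [TopologicalSpace X] [Zero Y] [Zero Z]
    {f : X → Y} {g : X → Z} (hf : HasCompactSupport f) (h : ∀ x, f x = 0 → g x = 0) :
    HasCompactSupport g :=
  hf.mono fun x => mt (h x)

variable {d : ℕ}

/-- A smooth bump function, equal to `1` on the unit ball and to `0` off the ball of radius `2`. -/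
def unitCutoff : E d → ℝ := (default : ContDiffBump (0 : E d))

/-- Smooth compactly supported functions equal to `1` on the ball of radius `n + 1` around `a`.
They are rescalings of a single bump function, so that their derivatives, and the products of
their gradients with a linear drift vanishing at `a`, are bounded uniformly in `n`. -/
def cutoff (a : E d) (n : ℕ) (x : E d) : ℝ := unitCutoff ((n + 1 : ℝ)⁻¹ • (x - a))

lemma contDiff_unitCutoff : ContDiff ℝ 2 (unitCutoff (d := d)) := ContDiffBump.contDiff _

lemma hasCompactSupport_unitCutoff : HasCompactSupport (unitCutoff (d := d)) :=
  ContDiffBump.hasCompactSupport _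

/-- The generator `k Δψ - b · ∇ψ` of the diffusion `dX = -b dt + √(2k) dW`. -/
def generator (k : ℝ) (b : E d → E d) (ψ : E d → ℝ) (x : E d) : ℝ :=
  k * Δ ψ x - inner ℝ (b x) (∇ ψ x)

variable (a : E d) (n : ℕ) (x : E d)

lemma contDiff_cutoff : ContDiff ℝ 2 (cutoff a n) :=
  contDiff_unitCutoff.comp ((contDiff_id.sub contDiff_const).const_smul _)

lemma continuous_gradient_cutoff : Continuous (∇ (cutoff a n)) :=
  (contDiff_gradient (contDiff_cutoff a n) one_add_one_eq_two.le).continuous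

lemma cutoff_nonneg : 0 ≤ cutoff a n x :=
  ContDiffBump.nonneg _

variable {a n x}

lemma cutoff_eq_one (h : ‖x - a‖ ≤ n + 1) : cutoff a n x = 1 := by
  refine ContDiffBump.one_of_mem_closedBall _ ?_
  have hn : (0 : ℝ) < n + 1 := by positivity
  rw [mem_closedBall_zero_iff, norm_smul, norm_inv, Real.norm_of_nonneg hn.le]
  exact (inv_mul_le_iff₀ hn).2 (by simpa [default] using h)

lemma cutoff_eq_zero (h : 2 * (n + 1) ≤ ‖x - a‖) : cutoff a n x = 0 := by
  refine ContDiffBump.zero_of_le_dist _ ?_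
  have hn : (0 : ℝ) < n + 1 := by positivity
  rw [dist_zero_right, norm_smul, norm_inv, Real.norm_of_nonneg hn.le]
  exact (le_inv_mul_iff₀ hn).2 (by simpa [default, mul_comm] using h)

variable (a n x)

lemma hasCompactSupport_cutoff : HasCompactSupport (cutoff a n) := by
  refine HasCompactSupport.intro (isCompact_closedBall a (2 * (n + 1))) fun x hx => ?_
  rw [Metric.mem_closedBall, dist_eq_norm, not_le] at hx
  exact cutoff_eq_zero hx.le

lemma eventually_forall_cutoff_le : ∀ᶠ m in atTop, ∀ x, cutoff a n x ≤ cutoff a m x := by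
  filter_upwards [eventually_ge_atTop (2 * n + 1)] with m hm x
  rcases le_total ‖x - a‖ (m + 1) with hx | hx
  · rw [cutoff_eq_one hx]
    exact ContDiffBump.le_one _
  · have hm' : (2 * n + 1 : ℝ) ≤ m := by exact_mod_cast hm
    rw [cutoff_eq_zero (by linarith)]
    exact cutoff_nonneg a m x

lemma eventually_cutoff_eventuallyEq_one : ∀ᶠ n in atTop, cutoff a n =ᶠ[𝓝 x] fun _ => 1 := by
  filter_upwards [eventually_ge_atTop ⌈‖x - a‖⌉₊] with n hn
  have hlt : ‖x - a‖ < n + 1 := (Nat.ceil_le.1 hn).trans_lt (lt_add_one _)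
  filter_upwards [eventually_norm_sub_lt hlt] with y hy using cutoff_eq_one hy.le

lemma eventually_gradient_cutoff_eq_zero : ∀ᶠ n in atTop, ∇ (cutoff a n) x = 0 := by
  filter_upwards [eventually_cutoff_eventuallyEq_one a x] with n hn
  rw [hn.gradient_eq, gradient_fun_const]

lemma eventually_generator_cutoff_eq_zero (k : ℝ) (b : E d → E d) :
    ∀ᶠ n in atTop, generator k b (cutoff a n) x = 0 := by
  filter_upwards [eventually_cutoff_eventuallyEq_one a x] with n hn
  have hΔ : Δ (cutoff a n) x = 0 := by
    rw [(InnerProductSpace.laplacian_congr_nhds hn).eq_of_nhds]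
    exact congrFun InnerProductSpace.laplacian_const x
  rw [generator, hΔ, hn.gradient_eq, gradient_fun_const, inner_zero_right, mul_zero, sub_zero]

lemma gradient_cutoff :
    ∇ (cutoff a n) x = (n + 1 : ℝ)⁻¹ • ∇ unitCutoff ((n + 1 : ℝ)⁻¹ • (x - a)) :=
  (hasGradientAt_comp_smul_sub _
    (hasGradientAt_of_contDiff contDiff_unitCutoff two_ne_zero _)).gradient

lemma laplacian_cutoff :
    Δ (cutoff a n) x = ((n + 1 : ℝ)⁻¹) ^ 2 * Δ unitCutoff ((n + 1 : ℝ)⁻¹ • (x - a)) :=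
  laplacian_comp_smul_sub contDiff_unitCutoff _ a x

lemma exists_norm_gradient_cutoff_le : ∃ C, ∀ n x, ‖∇ (cutoff a n) x‖ ≤ C := by
  obtain ⟨C, hC⟩ := (hasCompactSupport_gradient
    (hasCompactSupport_unitCutoff (d := d))).exists_bound_of_continuous
    (contDiff_gradient contDiff_unitCutoff one_add_one_eq_two.le).continuous
  refine ⟨C, fun n x => ?_⟩
  have hn : ‖(n + 1 : ℝ)⁻¹‖ ≤ 1 := by
    rw [norm_inv, Real.norm_of_nonneg (by positivity)]
    exact inv_le_one_of_one_le₀ (by simp)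
  rw [gradient_cutoff, norm_smul]
  exact (mul_le_of_le_one_left (norm_nonneg _) hn).trans (hC _)

lemma exists_abs_generator_cutoff_le (S : Mat d) (k : ℝ) :
    ∃ C, ∀ n x, |generator k (fun y => app S (y - a)) (cutoff a n) x| ≤ C := by
  obtain ⟨C₁, hC₁⟩ := (hasCompactSupport_laplacian (d := d) contDiff_unitCutoff
    hasCompactSupport_unitCutoff).exists_bound_of_continuous
    (continuous_laplacian contDiff_unitCutoff)
  have hdrift : HasCompactSupport fun y : E d => inner ℝ (app S y) (∇ unitCutoff y) :=
    hasCompactSupport_of_forall_eq_zero (hasCompactSupport_gradient hasCompactSupport_unitCutoff)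
      fun y hy => by rw [hy, inner_zero_right]
  obtain ⟨C₂, hC₂⟩ := hdrift.exists_bound_of_continuous ((continuous_app S).inner
    (contDiff_gradient contDiff_unitCutoff one_add_one_eq_two.le).continuous)
  refine ⟨|k| * C₁ + C₂, fun n x => (abs_sub _ _).trans (add_le_add ?_ ?_)⟩
  · have hn : |(n + 1 : ℝ)⁻¹| ^ 2 ≤ 1 := by
      rw [abs_inv, abs_of_nonneg (by positivity)]
      exact pow_le_one₀ (by positivity) (inv_le_one_of_one_le₀ (by simp))
    rw [laplacian_cutoff, abs_mul, abs_mul, abs_pow]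
    exact mul_le_mul_of_nonneg_left
      ((mul_le_of_le_one_left (abs_nonneg _) hn).trans (hC₁ _)) (abs_nonneg k)
  · rw [gradient_cutoff, real_inner_smul_right, ← real_inner_smul_left, ← app_smul_right]
    exact hC₂ _

lemma eq_zero_of_tendsto_integral_cutoff {g : E d → ℝ} (hg : Continuous g)
    (h0 : ∀ x, 0 ≤ g x) {p : ℕ} (hp : p ≠ 0)
    (h : Tendsto (fun n => ∫ x, cutoff a n x ^ p * g x) atTop (𝓝 0)) : g x = 0 := by
  by_contra hx
  have hcont : ∀ n, Continuous fun x => cutoff a n x ^ p * g x := fun n =>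
    ((contDiff_cutoff a n).continuous.pow p).mul hg
  have hsupp : ∀ n, HasCompactSupport fun x => cutoff a n x ^ p * g x := fun n =>
    hasCompactSupport_of_forall_eq_zero (hasCompactSupport_cutoff a n) fun y hy => by
      rw [hy, zero_pow hp, zero_mul]
  obtain ⟨n₀, hn₀⟩ := (eventually_cutoff_eventuallyEq_one a x).exists
  have hpos : 0 < ∫ x, cutoff a n₀ x ^ p * g x := by
    refine (hcont n₀).integral_pos_of_hasCompactSupport_nonneg_nonzero (hsupp n₀)
      (fun y => mul_nonneg (pow_nonneg (cutoff_nonneg _ _ _) _) (h0 y)) (x := x) ?_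
    rwa [hn₀.eq_of_nhds, one_pow, one_mul]
  have hle : ∀ᶠ n in atTop, ∫ x, cutoff a n₀ x ^ p * g x ≤ ∫ x, cutoff a n x ^ p * g x := by
    filter_upwards [eventually_forall_cutoff_le a n₀] with n hn
    refine integral_mono ((hcont n₀).integrable_of_hasCompactSupport (hsupp n₀))
      ((hcont n).integrable_of_hasCompactSupport (hsupp n)) fun y => ?_
    exact mul_le_mul_of_nonneg_right
      (pow_le_pow_left₀ (cutoff_nonneg _ _ _) (hn y) p) (h0 y)
  exact hpos.not_ge (ge_of_tendsto h hle)

end Cutoff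

/-! ### Rigidity of stationary solutions -/

section Stationary

variable {d : ℕ} {k : ℝ} {m φ ψ : E d → ℝ} {b : E d → E d}

lemma continuous_generator (hψ : ContDiff ℝ 2 ψ) (hb : Continuous b) :
    Continuous (generator k b ψ) :=
  (continuous_const.mul (continuous_laplacian hψ)).sub
    (hb.inner (contDiff_gradient hψ one_add_one_eq_two.le).continuous)

lemma hasCompactSupport_generator (hψ : ContDiff ℝ 2 ψ) (hc : HasCompactSupport ψ) :
    HasCompactSupport (generator k b ψ) := by
  have hdrift : HasCompactSupport fun y => inner ℝ (b y) (∇ ψ y) :=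
    hasCompactSupport_of_forall_eq_zero (hasCompactSupport_gradient hc) fun y hy => by
      rw [hy, inner_zero_right]
  have hdiffusion : HasCompactSupport fun y => k * Δ ψ y :=
    (hasCompactSupport_laplacian hψ hc).mul_left
  exact hdiffusion.sub hdrift

lemma divergence_flux_eq_zero (hm : ContDiff ℝ 2 m) (hb : ContDiff ℝ 1 b)
    (kfp : ∀ x, -k * Δ m x - divergence (fun y => m y • b y) x = 0) (x : E d) :
    divergence (fun y => k • ∇ m y + m y • b y) x = 0 := by
  have hgm : DifferentiableAt ℝ (∇ m) x :=
    (contDiff_gradient hm one_add_one_eq_two.le).differentiable one_ne_zero x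
  have hmb : DifferentiableAt ℝ (fun y => m y • b y) x :=
    (hm.differentiable two_ne_zero x).smul (hb.differentiable one_ne_zero x)
  rw [divergence_add (hgm.fun_const_smul k) hmb, divergence_const_smul k hgm,
    ← laplacian_eq_divergence_gradient hm]
  linarith [kfp x]

lemma integral_mul_generator_eq_zero (hm : ContDiff ℝ 2 m) (hb : ContDiff ℝ 1 b)
    (kfp : ∀ x, -k * Δ m x - divergence (fun y => m y • b y) x = 0)
    (hψ : ContDiff ℝ 2 ψ) (hc : HasCompactSupport ψ) : ∫ x, m x * generator k b ψ x = 0 := by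
  set flux : E d → E d := fun y => k • ∇ m y + m y • b y
  have hgψ : ContDiff ℝ 1 (fun y => k • ∇ ψ y) :=
    (contDiff_gradient hψ one_add_one_eq_two.le).const_smul k
  have hm1 : ContDiff ℝ 1 m := hm.of_le one_le_two
  have hflux : ContDiff ℝ 1 flux :=
    ((contDiff_gradient hm one_add_one_eq_two.le).const_smul k).add (hm1.smul hb)
  have hF : ContDiff ℝ 1 (fun y => m y • (k • ∇ ψ y)) := hm1.smul hgψ
  have hG : ContDiff ℝ 1 (fun y => ψ y • flux y) := (hψ.of_le one_le_two).smul hflux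
  have hFc : HasCompactSupport fun y => m y • (k • ∇ ψ y) :=
    hasCompactSupport_of_forall_eq_zero (hasCompactSupport_gradient hc) fun y hy => by
      rw [hy, smul_zero, smul_zero]
  have hGc : HasCompactSupport fun y => ψ y • flux y := hc.smul_right
  refine (integral_congr_ae (Eventually.of_forall fun x => ?_)).trans
    (integral_divergence_eq_zero (hF.sub hG) (hFc.sub hGc))
  refine Eq.trans ?_ (divergence_sub (hF.differentiable one_ne_zero x)
    (hG.differentiable one_ne_zero x)).symm
  rw [divergence_smul (hasGradientAt_of_contDiff hψ two_ne_zero x)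
      (hflux.differentiable one_ne_zero x),
    divergence_smul (hasGradientAt_of_contDiff hm two_ne_zero x)
      (hgψ.differentiable one_ne_zero x),
    divergence_const_smul k
      ((contDiff_gradient hψ one_add_one_eq_two.le).differentiable one_ne_zero x),
    ← laplacian_eq_divergence_gradient hψ, divergence_flux_eq_zero hm hb kfp]
  simp only [generator, flux, inner_add_right, inner_smul_right]
  rw [real_inner_comm (∇ ψ x) (∇ m x), real_inner_comm (∇ ψ x) (b x)]
  ring

end Stationary

section ValueDifference

variable {d : ℕ} {k ℓ : ℝ} {W m φ : E d → ℝ} {b : E d → E d} {x : E d}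

/-- The Cole–Hopf transform of `W`, used as a test function that absorbs the quadratic gradient term
of the Hamilton–Jacobi equation. -/
def coleHopf (k : ℝ) (W : E d → ℝ) (x : E d) : ℝ := Real.exp (W x / (2 * k))

lemma coleHopf_pos (k : ℝ) (W : E d → ℝ) (x : E d) : 0 < coleHopf k W x := Real.exp_pos _

lemma coleHopf_le_one (hk : 0 < k) (hx : W x ≤ 0) : coleHopf k W x ≤ 1 :=
  Real.exp_le_one_iff.2 (div_nonpos_of_nonpos_of_nonneg hx (by positivity))

lemma contDiff_coleHopf {n : WithTop ℕ∞} (k : ℝ) (hW : ContDiff ℝ n W) :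
    ContDiff ℝ n (coleHopf k W) :=
  (hW.div_const _).exp

lemma hasDerivAt_exp_div (c t : ℝ) :
    HasDerivAt (fun t : ℝ => Real.exp (t / c)) (Real.exp (t / c) * c⁻¹) t := by
  simpa using ((hasDerivAt_id t).div_const c).exp

lemma hasGradientAt_coleHopf (k : ℝ) (hW : ContDiff ℝ 2 W) (x : E d) :
    HasGradientAt (coleHopf k W) ((coleHopf k W x * (2 * k)⁻¹) • ∇ W x) x :=
  hasGradientAt_comp (φ := fun t => Real.exp (t / (2 * k))) (hasDerivAt_exp_div _ _)
    (hasGradientAt_of_contDiff hW two_ne_zero x)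

lemma laplacian_coleHopf (k : ℝ) (hW : ContDiff ℝ 2 W) (x : E d) :
    Δ (coleHopf k W) x = coleHopf k W x * (2 * k)⁻¹ * (2 * k)⁻¹ * ‖∇ W x‖ ^ 2
      + coleHopf k W x * (2 * k)⁻¹ * Δ W x :=
  laplacian_comp (φ := fun t => Real.exp (t / (2 * k)))
    (φ' := fun t => Real.exp (t / (2 * k)) * (2 * k)⁻¹) hW (hasDerivAt_exp_div (2 * k))
    ((hasDerivAt_exp_div _ _).mul_const _)

-- The choice of the exponent makes the first order terms `∇φ · ∇W` cancel.
lemma generator_mul_coleHopf (hk : k ≠ 0) (hW : ContDiff ℝ 2 W) (hφ : ContDiff ℝ 2 φ)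
    (h : -k * Δ W x + 1 / 2 * ‖∇ W x‖ ^ 2 + inner ℝ (∇ W x) (b x) + ℓ * W x = 0) :
    generator k (fun y => b y + ∇ W y) (fun y => φ y * coleHopf k W y) x
      = coleHopf k W x * generator k b φ x
        - ℓ / (2 * k) * (φ x * (coleHopf k W x * -W x)) := by
  have hΔW : k * Δ W x = 1 / 2 * ‖∇ W x‖ ^ 2 + inner ℝ (b x) (∇ W x) + ℓ * W x := by
    rw [real_inner_comm (∇ W x) (b x)]
    linarith
  have hgrad := hasGradientAt_mul (hasGradientAt_of_contDiff hφ two_ne_zero x)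
    (hasGradientAt_coleHopf k hW x)
  rw [generator, generator, laplacian_mul hφ (contDiff_coleHopf k hW), hgrad.gradient,
    (hasGradientAt_coleHopf k hW x).gradient, laplacian_coleHopf k hW]
  simp only [inner_add_left, inner_add_right, inner_smul_right, real_inner_self_eq_norm_sq]
  rw [real_inner_comm (∇ W x) (∇ φ x)]
  field_simp
  linear_combination (2 * φ x * coleHopf k W x) * hΔW

lemma integral_mul_coleHopf_mul_generator (hk : k ≠ 0) (hb : ContDiff ℝ 1 b)
    (hW : ContDiff ℝ 2 W) (hm : ContDiff ℝ 2 m)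
    (h : ∀ x, -k * Δ W x + 1 / 2 * ‖∇ W x‖ ^ 2 + inner ℝ (∇ W x) (b x) + ℓ * W x = 0)
    (kfp : ∀ x, -k * Δ m x - divergence (fun y => m y • (b y + ∇ W y)) x = 0)
    (hφ : ContDiff ℝ 2 φ) (hc : HasCompactSupport φ) :
    ∫ x, m x * coleHopf k W x * generator k b φ x
      = ℓ / (2 * k) * ∫ x, φ x * (m x * coleHopf k W x * -W x) := by
  have hu : Continuous (coleHopf k W) := (contDiff_coleHopf k hW).continuous
  have hgen : Integrable fun x => m x * coleHopf k W x * generator k b φ x :=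
    ((hm.continuous.mul hu).mul (continuous_generator hφ hb.continuous)
      ).integrable_of_hasCompactSupport (hasCompactSupport_generator hφ hc).mul_left
  have hval : Integrable fun x => φ x * (m x * coleHopf k W x * -W x) :=
    (hφ.continuous.mul ((hm.continuous.mul hu).mul hW.continuous.neg)
      ).integrable_of_hasCompactSupport hc.mul_right
  have hstat := integral_mul_generator_eq_zero hm
    (hb.add (contDiff_gradient hW one_add_one_eq_two.le)) kfp
    (hφ.mul (contDiff_coleHopf k hW)) hc.mul_right
  rw [← integral_const_mul, ← sub_eq_zero, ← integral_sub hgen (hval.const_mul _), ← hstat]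
  refine integral_congr_ae (Eventually.of_forall fun x => ?_)
  simp only [generator_mul_coleHopf hk hW hφ (h x)]
  ring

lemma tendsto_integral_mul_generator_cutoff {w : E d → ℝ} (hw : Integrable w) (k : ℝ) (S : Mat d)
    (a : E d) : Tendsto (fun n => ∫ x, w x * generator k (fun y => app S (y - a)) (cutoff a n) x)
      atTop (𝓝 0) := by
  obtain ⟨C, hC⟩ := exists_abs_generator_cutoff_le a S k
  have hdrift : Continuous fun y => app S (y - a) :=
    (continuous_app S).comp (continuous_id.sub continuous_const)
  rw [← integral_zero (E d) ℝ (μ := volume)]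
  refine tendsto_integral_of_dominated_convergence (fun y => ‖w y‖ * C) (fun n => ?_)
    (hw.norm.mul_const C) (fun n => Eventually.of_forall fun y => ?_)
    (Eventually.of_forall fun y => ?_)
  · exact hw.aestronglyMeasurable.mul
      (continuous_generator (contDiff_cutoff a n) hdrift).aestronglyMeasurable
  · rw [norm_mul]
    exact mul_le_mul_of_nonneg_left (hC n y) (norm_nonneg _)
  · refine tendsto_const_nhds.congr' ?_
    filter_upwards [eventually_generator_cutoff_eq_zero a y k fun y => app S (y - a)] with n hn
    rw [hn, mul_zero]

theorem eq_zero_of_hjb_of_kfp (hk : 0 < k) (hℓ : 0 < ℓ) {S : Mat d} (hS : S.PosSemidef)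
    {a : E d} (hW : ContDiff ℝ 2 W) (hm : ContDiff ℝ 2 m)
    (h : ∀ x, -k * Δ W x + 1 / 2 * ‖∇ W x‖ ^ 2 + inner ℝ (∇ W x) (app S (x - a)) + ℓ * W x = 0)
    (kfp : ∀ x, -k * Δ m x - divergence (fun y => m y • (app S (y - a) + ∇ W y)) x = 0)
    (hmi : Integrable m) (hm0 : ∀ x, 0 < m x) (x : E d) : W x = 0 := by
  have hWle : ∀ y, W y ≤ 0 := nonpos_of_hjb_subsolution hk hℓ hS hW fun y => (h y).le
  have hb : ContDiff ℝ 1 fun y : E d => app S (y - a) :=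
    (contDiff_app S).comp (contDiff_id.sub contDiff_const)
  have hu : Continuous (coleHopf k W) := (contDiff_coleHopf k hW).continuous
  have hmu : Integrable fun y => m y * coleHopf k W y :=
    hmi.mul_bdd (c := 1) hu.aestronglyMeasurable (Eventually.of_forall fun y => by
      rw [Real.norm_of_nonneg (coleHopf_pos k W y).le]
      exact coleHopf_le_one hk (hWle y))
  have hlim : Tendsto (fun n => ∫ y, cutoff a n y ^ 1 * (m y * coleHopf k W y * -W y)) atTop
      (𝓝 0) := by
    have hgen := (tendsto_integral_mul_generator_cutoff hmu k S a).const_mul (ℓ / (2 * k))⁻¹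
    rw [mul_zero] at hgen
    refine hgen.congr fun n => ?_
    rw [integral_mul_coleHopf_mul_generator hk.ne' hb hW hm h kfp (contDiff_cutoff a n)
      (hasCompactSupport_cutoff a n), inv_mul_cancel_left₀ (by positivity)]
    simp only [pow_one]
  have hzero : m x * coleHopf k W x * -W x = 0 :=
    eq_zero_of_tendsto_integral_cutoff a x ((hm.continuous.mul hu).mul hW.continuous.neg)
      (fun y => mul_nonneg (mul_pos (hm0 y) (coleHopf_pos k W y)).le (neg_nonneg.2 (hWle y)))
      one_ne_zero hlim
  exact neg_eq_zero.1
    ((mul_eq_zero.1 hzero).resolve_left (mul_pos (hm0 x) (coleHopf_pos k W x)).ne')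

end ValueDifference

section Liouville

variable {d : ℕ} {m G φ U : E d → ℝ}

lemma integral_caccioppoli_eq_zero (hm : ContDiff ℝ 1 m) (hG : ContDiff ℝ 2 G)
    (hdiv : ∀ x, divergence (fun y => m y • ∇ G y) x = 0) (hφ : ContDiff ℝ 2 φ)
    (hc : HasCompactSupport φ) :
    ∫ x, m x * Real.exp (-G x) * (2 * φ x * inner ℝ (∇ φ x) (∇ G x) - φ x ^ 2 * ‖∇ G x‖ ^ 2)
      = 0 := by
  have hflux : ContDiff ℝ 1 fun y => m y • ∇ G y :=
    hm.smul (contDiff_gradient hG one_add_one_eq_two.le)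
  have hψ : ContDiff ℝ 1 fun y => φ y * φ y * Real.exp (-G y) :=
    ((hφ.mul hφ).mul hG.neg.exp).of_le one_le_two
  have hψc : HasCompactSupport fun y => (φ y * φ y * Real.exp (-G y)) • (m y • ∇ G y) :=
    hasCompactSupport_of_forall_eq_zero hc fun y hy => by simp only [hy, zero_mul, zero_smul]
  refine (integral_congr_ae (Eventually.of_forall fun x => ?_)).trans
    (integral_divergence_eq_zero (hψ.smul hflux) hψc)
  have hφx := hasGradientAt_of_contDiff hφ two_ne_zero x
  have hexp : HasGradientAt (fun y => Real.exp (-G y)) ((-Real.exp (-G x)) • ∇ G x) x := by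
    refine hasGradientAt_comp (φ := fun t => Real.exp (-t)) ?_
      (hasGradientAt_of_contDiff hG two_ne_zero x)
    simpa using (hasDerivAt_id (G x)).neg.exp
  refine Eq.trans ?_ (divergence_smul (hasGradientAt_mul (hasGradientAt_mul hφx hφx) hexp)
    (hflux.differentiable one_ne_zero x)).symm
  simp only [hdiv, inner_add_left, inner_smul_left, inner_smul_right, conj_trivial,
    real_inner_self_eq_norm_sq]
  ring

lemma integral_sq_mul_norm_gradient_sq_le (hm : ContDiff ℝ 1 m) (hm0 : ∀ x, 0 ≤ m x)
    (hG : ContDiff ℝ 2 G) (hdiv : ∀ x, divergence (fun y => m y • ∇ G y) x = 0)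
    (hφ : ContDiff ℝ 2 φ) (hc : HasCompactSupport φ) :
    ∫ x, φ x ^ 2 * (m x * Real.exp (-G x) * ‖∇ G x‖ ^ 2)
      ≤ 4 * ∫ x, m x * Real.exp (-G x) * ‖∇ φ x‖ ^ 2 := by
  have hφ0 := hφ.continuous
  have hgφ : Continuous (∇ φ) := (contDiff_gradient hφ one_add_one_eq_two.le).continuous
  have hgG : Continuous (∇ G) := (contDiff_gradient hG one_add_one_eq_two.le).continuous
  have he : Continuous fun x => m x * Real.exp (-G x) := hm.continuous.mul hG.continuous.neg.rexp
  have hleft : Integrable fun x => φ x ^ 2 * (m x * Real.exp (-G x) * ‖∇ G x‖ ^ 2) :=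
    ((hφ0.pow 2).mul (he.mul (hgG.norm.pow 2))).integrable_of_hasCompactSupport
      (hasCompactSupport_of_forall_eq_zero hc fun x hx => by simp [hx])
  have hright : Integrable fun x => m x * Real.exp (-G x) * ‖∇ φ x‖ ^ 2 :=
    (he.mul (hgφ.norm.pow 2)).integrable_of_hasCompactSupport
      (hasCompactSupport_of_forall_eq_zero (hasCompactSupport_gradient hc) fun x hx => by simp [hx])
  have hmix : Integrable fun x => m x * Real.exp (-G x)
      * (2 * φ x * inner ℝ (∇ φ x) (∇ G x) - φ x ^ 2 * ‖∇ G x‖ ^ 2) :=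
    (he.mul (((continuous_const.mul hφ0).mul (hgφ.inner hgG)).sub
      ((hφ0.pow 2).mul (hgG.norm.pow 2)))).integrable_of_hasCompactSupport
      (hasCompactSupport_of_forall_eq_zero hc fun x hx => by simp [hx])
  calc ∫ x, φ x ^ 2 * (m x * Real.exp (-G x) * ‖∇ G x‖ ^ 2)
      ≤ ∫ x, (4 * (m x * Real.exp (-G x) * ‖∇ φ x‖ ^ 2) - 2 * (m x * Real.exp (-G x)
        * (2 * φ x * inner ℝ (∇ φ x) (∇ G x) - φ x ^ 2 * ‖∇ G x‖ ^ 2))) := by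
        refine integral_mono hleft ((hright.const_mul 4).sub (hmix.const_mul 2)) fun x => ?_
        -- Expand `0 ≤ ‖2 ∇φ - φ ∇G‖²`.
        have hyoung := norm_sub_sq_real ((2 : ℝ) • ∇ φ x) (φ x • ∇ G x)
        rw [norm_smul, norm_smul, mul_pow, mul_pow, Real.norm_eq_abs, Real.norm_eq_abs, sq_abs,
          sq_abs, real_inner_smul_left, real_inner_smul_right] at hyoung
        have hpos := mul_nonneg (mul_nonneg (hm0 x) (Real.exp_pos (-G x)).le)
          (hyoung ▸ sq_nonneg ‖(2 : ℝ) • ∇ φ x - φ x • ∇ G x‖)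
        simp only
        linarith
    _ = 4 * ∫ x, m x * Real.exp (-G x) * ‖∇ φ x‖ ^ 2 := by
        rw [integral_sub (hright.const_mul 4) (hmix.const_mul 2), integral_const_mul,
          integral_const_mul, integral_caccioppoli_eq_zero hm hG hdiv hφ hc, mul_zero, sub_zero]

lemma tendsto_integral_mul_norm_gradient_cutoff_sq {w : E d → ℝ} (hw : Integrable w) (a : E d) :
    Tendsto (fun n => ∫ x, w x * ‖∇ (cutoff a n) x‖ ^ 2) atTop (𝓝 0) := by
  obtain ⟨C, hC⟩ := exists_norm_gradient_cutoff_le a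
  rw [← integral_zero (E d) ℝ (μ := volume)]
  refine tendsto_integral_of_dominated_convergence (fun y => ‖w y‖ * C ^ 2) (fun n => ?_)
    (hw.norm.mul_const _) (fun n => Eventually.of_forall fun y => ?_)
    (Eventually.of_forall fun y => ?_)
  · exact hw.aestronglyMeasurable.mul
      ((continuous_gradient_cutoff a n).norm.pow 2).aestronglyMeasurable
  · rw [norm_mul, norm_pow, norm_norm]
    exact mul_le_mul_of_nonneg_left (pow_le_pow_left₀ (norm_nonneg _) (hC n y) 2) (norm_nonneg _)
  · refine tendsto_const_nhds.congr' ?_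
    filter_upwards [eventually_gradient_cutoff_eq_zero a y] with n hn
    rw [hn, norm_zero, zero_pow two_ne_zero, mul_zero]

lemma gradient_eq_zero_of_divergence_smul_gradient_eq_zero (hm : ContDiff ℝ 1 m)
    (hm0 : ∀ x, 0 < m x) (hG : ContDiff ℝ 2 G)
    (hdiv : ∀ x, divergence (fun y => m y • ∇ G y) x = 0)
    (hint : Integrable fun x => m x * Real.exp (-G x)) (x : E d) : ∇ G x = 0 := by
  have hgG : Continuous (∇ G) := (contDiff_gradient hG one_add_one_eq_two.le).continuous
  have hnonneg : ∀ y, 0 ≤ m y * Real.exp (-G y) * ‖∇ G y‖ ^ 2 := fun y =>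
    mul_nonneg (mul_pos (hm0 y) (Real.exp_pos _)).le (sq_nonneg _)
  have hbound := (tendsto_integral_mul_norm_gradient_cutoff_sq hint 0).const_mul 4
  rw [mul_zero] at hbound
  have hlim := squeeze_zero
    (fun n => integral_nonneg fun x => mul_nonneg (sq_nonneg (cutoff 0 n x)) (hnonneg x))
    (fun n => integral_sq_mul_norm_gradient_sq_le hm (fun y => (hm0 y).le) hG hdiv
      (contDiff_cutoff 0 n) (hasCompactSupport_cutoff 0 n)) hbound
  have hzero := eq_zero_of_tendsto_integral_cutoff 0 x
    ((hm.continuous.mul hG.continuous.neg.rexp).mul (hgG.norm.pow 2)) hnonneg two_ne_zero hlim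
  simpa using (mul_eq_zero.1 hzero).resolve_left (mul_pos (hm0 x) (Real.exp_pos _)).ne'

theorem exists_eq_const_mul_exp_neg (hm : ContDiff ℝ 2 m) (hm0 : ∀ x, 0 < m x)
    (hU : ContDiff ℝ 2 U) (hdiv : ∀ x, divergence (fun y => ∇ m y + m y • ∇ U y) x = 0)
    (hint : Integrable fun x => Real.exp (-U x)) : ∃ c, ∀ x, m x = c * Real.exp (-U x) := by
  set G : E d → ℝ := fun x => Real.log (m x) + U x
  have hG : ContDiff ℝ 2 G := (hm.log fun x => (hm0 x).ne').add hU
  have hflux : ∀ x, m x • ∇ G x = ∇ m x + m x • ∇ U x := fun x => by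
    have hlog := hasGradientAt_comp (Real.hasDerivAt_log (hm0 x).ne')
      (hasGradientAt_of_contDiff hm two_ne_zero x)
    rw [(hasGradientAt_add hlog (hasGradientAt_of_contDiff hU two_ne_zero x)).gradient, smul_add,
      smul_inv_smul₀ (hm0 x).ne']
  have hexp : ∀ x, m x * Real.exp (-G x) = Real.exp (-U x) := fun x => by
    rw [neg_add, Real.exp_add, Real.exp_neg, Real.exp_log (hm0 x),
      mul_inv_cancel_left₀ (hm0 x).ne']
  have hgrad := gradient_eq_zero_of_divergence_smul_gradient_eq_zero (hm.of_le one_le_two) hm0 hG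
    (by simpa only [hflux] using hdiv) (by simpa only [hexp] using hint)
  have hconst : ∀ x, G x = G 0 := fun x =>
    is_const_of_fderiv_eq_zero (hG.differentiable two_ne_zero) (fun y => by
      rw [← toDual_gradient, hgrad y, map_zero]) x 0
  refine ⟨Real.exp (G 0), fun x => ?_⟩
  rw [← hexp x, hconst x, mul_left_comm, ← Real.exp_add, add_neg_cancel, Real.exp_zero, mul_one]

lemma exists_eq_const_mul_exp_of_kfp {k : ℝ} (hk : k ≠ 0) {S : Mat d} (hS : S.IsSymm) {a : E d}
    (hm : ContDiff ℝ 2 m) (hm0 : ∀ x, 0 < m x)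
    (kfp : ∀ x, -k * Δ m x - divergence (fun y => m y • app S (y - a)) x = 0)
    (hint : Integrable fun x => Real.exp (-(bil (k⁻¹ • S) (x - a) (x - a) / 2))) :
    ∃ c, ∀ x, m x = c * Real.exp (-(bil (k⁻¹ • S) (x - a) (x - a) / 2)) := by
  have hsub : ContDiff ℝ 2 fun x : E d => x - a := contDiff_id.sub contDiff_const
  have hU : ContDiff ℝ 2 fun x : E d => bil (k⁻¹ • S) (x - a) (x - a) / 2 :=
    (hsub.inner ℝ ((contDiff_app _).comp hsub)).div_const 2
  have hgU : ∀ x, ∇ (fun x : E d => bil (k⁻¹ • S) (x - a) (x - a) / 2) x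
      = k⁻¹ • app S (x - a) := fun x => by
    have hhalf := hasGradientAt_const_mul (1 / 2) (hasGradientAt_bil (hS.smul k⁻¹) a x)
    rw [smul_smul, one_div_mul_cancel two_ne_zero, one_smul, app_smul_left] at hhalf
    rw [← hhalf.gradient]
    congr 1
    ext y
    ring
  refine exists_eq_const_mul_exp_neg hm hm0 hU (fun x => ?_) hint
  have hb : ContDiff ℝ 1 fun y : E d => app S (y - a) :=
    (contDiff_app S).comp (hsub.of_le one_le_two)
  have hflux : (fun y => ∇ m y + m y • ∇ (fun x : E d => bil (k⁻¹ • S) (x - a) (x - a) / 2) y)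
      = fun y => k⁻¹ • (k • ∇ m y + m y • app S (y - a)) := by
    funext y
    rw [hgU, smul_add, inv_smul_smul₀ hk, smul_comm k⁻¹]
  have hd : DifferentiableAt ℝ (fun y => k • ∇ m y + m y • app S (y - a)) x :=
    ((((contDiff_gradient hm one_add_one_eq_two.le).const_smul k).add
      ((hm.of_le one_le_two).smul hb)).differentiable one_ne_zero x)
  rw [hflux, divergence_const_smul _ hd, divergence_flux_eq_zero hm hb kfp, mul_zero]

end Liouville

/-! ### The matrix equation `S² + ℓS = P` -/

section MatrixEquation

variable {d : ℕ} {S S' P P' : Mat d} {ℓ : ℝ}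

lemma posDef_cfc {f : ℝ → ℝ} (hP : P.IsHermitian) (hf : ∀ t ∈ spectrum ℝ P, 0 < f t) :
    (cfc f P).PosDef := by
  rw [hP.cfc_eq, Matrix.IsHermitian.cfc, Unitary.conjStarAlgAut_apply,
    Unitary.isUnit_coe.posDef_star_right_conjugate_iff]
  exact Matrix.PosDef.diagonal fun i => hf _ (hP.eigenvalues_mem_spectrum_real i)

lemma exists_posDef_mul_self_add_smul_eq (hP : P.PosDef) (ℓ : ℝ) :
    ∃ S : Mat d, S.PosDef ∧ S * S + ℓ • S = P := by
  let root (p : ℝ) : ℝ := (-ℓ + √(ℓ ^ 2 + 4 * p)) / 2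
  have hspec (p) (hp : p ∈ spectrum ℝ P) : 0 < p :=
    (hP.isHermitian.posDef_iff_eigenvalues_pos.1 hP) _ |>.trans_eq <|
      ((hP.isHermitian.spectrum_real_eq_range_eigenvalues ▸ hp).choose_spec)
  have root_pos (p) (hp : p ∈ spectrum ℝ P) : 0 < root p := by
    have : ℓ < √(ℓ ^ 2 + 4 * p) := Real.lt_sqrt_of_sq_lt (by linarith [hspec p hp])
    simp only [root]
    linarith
  have root_eq (p) (hp : p ∈ spectrum ℝ P) : root p * root p + ℓ * root p = p := by
    have := Real.sq_sqrt (show 0 ≤ ℓ ^ 2 + 4 * p by have := hspec p hp; positivity)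
    simp only [root]
    linear_combination (1 / 4 : ℝ) * this
  have hsa : IsSelfAdjoint P := hP.isHermitian
  have hcont : ContinuousOn root (spectrum ℝ P) := by fun_prop
  refine ⟨cfc root P, posDef_cfc hP.isHermitian root_pos, ?_⟩
  rw [← cfc_mul root root P, ← cfc_const_mul ℓ root P, ← cfc_add (a := P) .., cfc_congr root_eq,
    cfc_id' ℝ P]

lemma sum_sq_eq_trace_mul_self {Z : Mat d} (hZ : Z.IsSymm) :
    ∑ i, ∑ j, Z i j ^ 2 = (Z * Z).trace := by
  simp only [Matrix.trace, Matrix.diag, Matrix.mul_apply, sq]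
  exact Finset.sum_congr rfl fun i _ => Finset.sum_congr rfl fun j _ => by rw [hZ.apply i j]

lemma trace_mul_self_nonneg {Z : Mat d} (hZ : Z.IsSymm) : 0 ≤ (Z * Z).trace := by
  rw [← sum_sq_eq_trace_mul_self hZ]
  positivity

lemma trace_sub_smul_mul_self (W Z : Mat d) (c : ℝ) :
    ((W - c • Z) * (W - c • Z)).trace =
      (W * W).trace - 2 * c * (W * Z).trace + c ^ 2 * (Z * Z).trace := by
  simp only [Matrix.sub_mul, Matrix.mul_sub, Matrix.smul_mul, Matrix.mul_smul, Matrix.trace_sub,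
    Matrix.trace_smul, smul_eq_mul, Matrix.trace_mul_comm Z W]
  ring

lemma trace_mul_mul_self_nonneg {Z : Mat d} (hZ : Z.IsSymm) (hS : S.PosSemidef) :
    0 ≤ (S * (Z * Z)).trace := by
  have := (hS.mul_mul_conjTranspose_same Z).trace_nonneg
  rwa [conjTranspose_eq_transpose_of_trivial, hZ.eq, Matrix.mul_assoc, Matrix.trace_mul_comm,
    Matrix.mul_assoc] at this

/-- The difference `W` of the right-hand sides is `S'Z + ZS + ℓZ`, so monotonicity follows from
`tr (S'ZZ) ≥ 0` and `tr (SZZ) ≥ 0`. -/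
lemma mul_trace_sub_le_trace_sub_mul_sub (hS : S.PosDef) (hS' : S'.PosDef)
    (h : S * S + ℓ • S = P) (h' : S' * S' + ℓ • S' = P') :
    ℓ * ((S' - S) * (S' - S)).trace ≤ ((P' - P) * (S' - S)).trace := by
  set Z := S' - S with hZ
  have hZs : Z.IsSymm := (isSymm_of_posDef hS').sub (isSymm_of_posDef hS)
  have hW : (P' - P) * Z = S' * (Z * Z) + Z * (S * Z) + ℓ • (Z * Z) := by
    rw [← h, ← h', hZ]
    simp only [smul_sub, Matrix.sub_mul, Matrix.mul_sub, Matrix.add_mul, Matrix.smul_mul]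
    noncomm_ring
  have htr := congrArg Matrix.trace hW
  rw [Matrix.trace_add, Matrix.trace_add, Matrix.trace_mul_comm Z, Matrix.mul_assoc,
    Matrix.trace_smul, smul_eq_mul] at htr
  linarith [trace_mul_mul_self_nonneg hZs hS.posSemidef,
    trace_mul_mul_self_nonneg hZs hS'.posSemidef]

lemma sq_mul_sum_sq_sub_le (hℓ : 0 ≤ ℓ) (hS : S.PosDef) (hS' : S'.PosDef)
    (h : S * S + ℓ • S = P) (h' : S' * S' + ℓ • S' = P') :
    ℓ ^ 2 * ∑ i, ∑ j, (S' i j - S i j) ^ 2 ≤ ∑ i, ∑ j, (P' i j - P i j) ^ 2 := by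
  have symm_of {T R : Mat d} (hT : T.PosDef) (hR : T * T + ℓ • T = R) : R.IsSymm := by
    have := (isSymm_of_posDef hT).eq
    rw [← hR, Matrix.IsSymm, transpose_add, transpose_mul, transpose_smul, this]
  have hZ : (S' - S).IsSymm := (isSymm_of_posDef hS').sub (isSymm_of_posDef hS)
  have hW : (P' - P).IsSymm := (symm_of hS' h').sub (symm_of hS h)
  have hmono := mul_le_mul_of_nonneg_left (mul_trace_sub_le_trace_sub_mul_sub hS hS' h h') hℓ
  have hsq := trace_mul_self_nonneg (hW.sub (hZ.smul ℓ))
  rw [trace_sub_smul_mul_self] at hsq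
  have hSZ := sum_sq_eq_trace_mul_self hZ
  have hPW := sum_sq_eq_trace_mul_self hW
  simp only [Matrix.sub_apply] at hSZ hPW
  rw [hSZ, hPW]
  linarith

lemma exists_pos_forall_mul_norm_sq_le_bil (hS : S.PosDef) :
    ∃ ε : ℝ, 0 < ε ∧ ∀ x : E d, ε * ‖x‖ ^ 2 ≤ bil S x x := by
  obtain ⟨T, hT, hTS⟩ := exists_posDef_mul_self_add_smul_eq hS 0
  rw [zero_smul, add_zero] at hTS
  have hbil (x : E d) : bil S x x = ‖app T x‖ ^ 2 := by
    rw [bil, ← hTS, app_mul, ← inner_app_of_isSymm (isSymm_of_posDef hT),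
      real_inner_self_eq_norm_sq]
  have hker : (Matrix.toEuclideanCLM (𝕜 := ℝ) T).toLinearMap.ker = ⊥ := by
    refine LinearMap.ker_eq_bot'.2 fun x hx => by_contra fun hx0 => ?_
    have := bil_pos hS hx0
    rw [hbil, app_eq_toEuclideanCLM] at this
    simp_all
  obtain ⟨K, hK, hanti⟩ := LinearMap.exists_antilipschitzWith _ hker
  refine ⟨((K : ℝ) ^ 2)⁻¹, by positivity, fun x => ?_⟩
  have hx : ‖x‖ ≤ K * ‖app T x‖ := by
    simpa [app_eq_toEuclideanCLM] using hanti.le_mul_dist x 0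
  rw [hbil, inv_mul_le_iff₀ (by positivity), ← mul_pow]
  gcongr

end MatrixEquation

/-! ### Gaussian densities -/

section GaussianDensity

variable {d : ℕ} {S S' : Mat d} {μ μ' : E d}

lemma contDiff_bil_sub (S : Mat d) (μ : E d) {n : WithTop ℕ∞} :
    ContDiff ℝ n fun x : E d => bil S (x - μ) (x - μ) :=
  (contDiff_id.sub contDiff_const).inner ℝ
    ((contDiff_app _).comp (contDiff_id.sub contDiff_const))

lemma contDiff_gaussianDensity (μ : E d) (S : Mat d) {n : WithTop ℕ∞} :
    ContDiff ℝ n (gaussianDensity μ S) :=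
  contDiff_const.mul (((contDiff_bil_sub S μ).div_const 2).neg.exp)

lemma continuous_gaussianDensity (μ : E d) (S : Mat d) : Continuous (gaussianDensity μ S) :=
  (contDiff_gaussianDensity μ S (n := 0)).continuous

lemma gaussianDensity_pos (μ : E d) (hS : S.PosDef) (x : E d) : 0 < gaussianDensity μ S x := by
  have := hS.det_pos
  unfold gaussianDensity
  positivity

lemma gaussianDensity_eq_sub (μ : E d) (S : Mat d) (x : E d) :
    gaussianDensity μ S x = gaussianDensity 0 S (x - μ) := by
  simp only [gaussianDensity, sub_zero]

lemma gaussianDensity_zero_neg (S : Mat d) (x : E d) :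
    gaussianDensity 0 S (-x) = gaussianDensity 0 S x := by
  simp only [gaussianDensity, bil, sub_zero, app_neg_right, inner_neg_neg]

lemma integral_comp_app {F : Type*} [NormedAddCommGroup F] [NormedSpace ℝ F] {T : Mat d}
    (hT : T.det ≠ 0) (f : E d → F) : ∫ x, f (app T x) = |T.det|⁻¹ • ∫ x, f x := by
  have hdet : LinearMap.det (Matrix.toEuclideanLin T) = T.det := by
    rw [Matrix.toEuclideanLin_eq_toLin_orthonormal, LinearMap.det_toLin]
  let e := (LinearMap.equivOfDetNeZero (Matrix.toEuclideanLin T)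
    (hdet.symm ▸ hT)).toContinuousLinearEquiv.toHomeomorph
  have hmap := Measure.map_linearMap_addHaar_eq_smul_addHaar (volume : Measure (E d))
    (hdet.symm ▸ hT)
  calc ∫ x, f (app T x) = ∫ x, f x ∂Measure.map (Matrix.toEuclideanLin T) volume :=
        (e.measurableEmbedding.integral_map f).symm
    _ = |T.det|⁻¹ • ∫ x, f x := by
        rw [hmap, integral_smul_measure, hdet, ENNReal.toReal_ofReal (by positivity), abs_inv]

lemma integrable_exp_neg_mul_norm_sq {b : ℝ} (hb : 0 < b) :
    Integrable fun x : E d => Real.exp (-b * ‖x‖ ^ 2) := by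
  refine Integrable.of_integral_ne_zero ?_
  rw [GaussianFourier.integral_rexp_neg_mul_sq_norm hb]
  positivity

lemma mul_exp_neg_mul_le {b : ℝ} (hb : 0 < b) (t : ℝ) :
    t * Real.exp (-b * t) ≤ 2 / b * Real.exp (-(b / 2) * t) := by
  have hsplit : Real.exp (-(b / 2) * t) = Real.exp (b / 2 * t) * Real.exp (-b * t) := by
    rw [← Real.exp_add]
    ring_nf
  have ht : t ≤ 2 / b * Real.exp (b / 2 * t) := by
    have := Real.add_one_le_exp (b / 2 * t)
    rw [div_mul_eq_mul_div, le_div_iff₀ hb]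
    linarith
  rw [hsplit, ← mul_assoc]
  gcongr

lemma integrable_norm_sq_mul_exp {b : ℝ} (hb : 0 < b) :
    Integrable fun x : E d => ‖x‖ ^ 2 * Real.exp (-b * ‖x‖ ^ 2) := by
  refine ((integrable_exp_neg_mul_norm_sq (d := d) (half_pos hb)).const_mul (2 / b)).mono'
    (by fun_prop) (Eventually.of_forall fun x => ?_)
  rw [Real.norm_eq_abs, abs_of_nonneg (by positivity)]
  exact mul_exp_neg_mul_le hb _

lemma integral_exp_neg_norm_sq_div_two :
    ∫ x : E d, Real.exp (-(‖x‖ ^ 2 / 2)) = √((2 * Real.pi) ^ d) := by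
  have hexp (x : E d) : Real.exp (-(‖x‖ ^ 2 / 2)) = Real.exp (-(1 / 2) * ‖x‖ ^ 2) := by ring_nf
  simp only [hexp]
  rw [GaussianFourier.integral_rexp_neg_mul_sq_norm one_half_pos, finrank_euclideanSpace,
    Fintype.card_fin, Real.sqrt_eq_rpow, ← Real.rpow_natCast, ← Real.rpow_mul (by positivity)]
  ring_nf

/-- If `S = T²` with `T` symmetric, then `xᵀSx = |Tx|²`: substitute `y = T x`. -/
lemma integral_exp_neg_bil (hS : S.PosDef) (μ : E d) :
    ∫ x : E d, Real.exp (-(bil S (x - μ) (x - μ) / 2)) = √((2 * Real.pi) ^ d / S.det) := by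
  obtain ⟨T, hT, hTS⟩ := exists_posDef_mul_self_add_smul_eq hS 0
  rw [zero_smul, add_zero] at hTS
  have hdet := hT.det_pos
  have hbil (x : E d) : bil S x x = ‖app T x‖ ^ 2 := by
    rw [bil, ← hTS, app_mul, ← inner_app_of_isSymm (isSymm_of_posDef hT),
      real_inner_self_eq_norm_sq]
  rw [integral_sub_right_eq_self (fun x : E d => Real.exp (-(bil S x x / 2))) μ]
  simp only [hbil]
  rw [integral_comp_app hdet.ne' fun y : E d => Real.exp (-(‖y‖ ^ 2 / 2)),
    integral_exp_neg_norm_sq_div_two, abs_of_pos hdet, ← hTS, Matrix.det_mul,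
    Real.sqrt_div (by positivity), Real.sqrt_mul_self hdet.le, smul_eq_mul, inv_mul_eq_div]

lemma integrable_exp_neg_bil (hS : S.PosDef) (μ : E d) :
    Integrable fun x : E d => Real.exp (-(bil S (x - μ) (x - μ) / 2)) := by
  refine Integrable.of_integral_ne_zero ?_
  rw [integral_exp_neg_bil hS]
  have := hS.det_pos
  positivity

lemma integral_gaussianDensity (hS : S.PosDef) (μ : E d) : ∫ x, gaussianDensity μ S x = 1 := by
  have := hS.det_pos
  unfold gaussianDensity
  rw [integral_const_mul, integral_exp_neg_bil hS, ← Real.sqrt_mul (by positivity),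
    Real.sqrt_eq_one]
  field_simp

lemma integrable_gaussianDensity (hS : S.PosDef) (μ : E d) : Integrable (gaussianDensity μ S) :=
  (integrable_exp_neg_bil hS μ).const_mul _

lemma exp_neg_bil_le {ε K : ℝ} (hε : 0 ≤ ε) (hS : ∀ x : E d, ε * ‖x‖ ^ 2 ≤ bil S x x)
    (hμ : ‖μ‖ ≤ K) (x : E d) :
    Real.exp (-(bil S (x - μ) (x - μ) / 2)) ≤
      Real.exp (ε / 2 * K ^ 2) * Real.exp (-(ε / 4) * ‖x‖ ^ 2) := by
  rw [← Real.exp_add, Real.exp_le_exp]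
  have hx : ‖x‖ ^ 2 ≤ 2 * ‖x - μ‖ ^ 2 + 2 * K ^ 2 := by
    have htri : ‖x‖ ≤ ‖x - μ‖ + K := (norm_le_norm_sub_add x μ).trans (by gcongr)
    have hsq : ‖x‖ ^ 2 ≤ (‖x - μ‖ + K) ^ 2 := by gcongr
    linarith [sq_nonneg (‖x - μ‖ - K)]
  linarith [hS (x - μ), mul_le_mul_of_nonneg_left hx hε]

lemma integrable_norm_sq_mul_gaussianDensity (hS : S.PosDef) (μ : E d) :
    Integrable fun x => ‖x‖ ^ 2 * gaussianDensity μ S x := by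
  obtain ⟨ε, hε, hcoercive⟩ := exists_pos_forall_mul_norm_sq_le_bil hS
  refine ((integrable_norm_sq_mul_exp (d := d) (b := ε / 4) (by positivity)).const_mul
    (√(S.det / (2 * Real.pi) ^ d) * Real.exp (ε / 2 * ‖μ‖ ^ 2))).mono'
    ((continuous_norm.pow 2).mul (continuous_gaussianDensity μ S)).aestronglyMeasurable
    (Eventually.of_forall fun x => ?_)
  have hpos := (gaussianDensity_pos μ hS x).le
  rw [Real.norm_eq_abs, abs_of_nonneg (by positivity)]
  have hbound := exp_neg_bil_le hε.le hcoercive (le_refl ‖μ‖) x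
  unfold gaussianDensity
  calc ‖x‖ ^ 2 * (√(S.det / (2 * Real.pi) ^ d) * Real.exp (-(bil S (x - μ) (x - μ) / 2)))
      ≤ ‖x‖ ^ 2 * (√(S.det / (2 * Real.pi) ^ d) *
        (Real.exp (ε / 2 * ‖μ‖ ^ 2) * Real.exp (-(ε / 4) * ‖x‖ ^ 2))) := by gcongr
    _ = _ := by ring

end GaussianDensity

/-! ### Moments of densities -/

section Moments

section NormedSpace

variable {V F : Type*} [NormedAddCommGroup V] [MeasurableSpace V] [NormedAddCommGroup F]
  [NormedSpace ℝ F] {ν : Measure V} {m : V → ℝ}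

lemma integrable_smul_of_norm_le_one_add_norm_sq (hm : Integrable m ν)
    (hm2 : Integrable (fun x => ‖x‖ ^ 2 * m x) ν) {f : V → F} (hf : AEStronglyMeasurable f ν)
    {C : ℝ} (hfC : ∀ x, ‖f x‖ ≤ C * (1 + ‖x‖ ^ 2)) : Integrable (fun x => m x • f x) ν := by
  refine ((hm.norm.add hm2.norm).const_mul C).mono' (hm.aestronglyMeasurable.smul hf)
    (Eventually.of_forall fun x => ?_)
  simp only [norm_smul, Pi.add_apply, norm_mul, norm_pow, norm_norm]
  linarith [mul_le_mul_of_nonneg_left (hfC x) (norm_nonneg (m x))]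

lemma integrable_smul_sub [NormedSpace ℝ V] [OpensMeasurableSpace V]
    [SecondCountableTopologyEither V V] (hm : Integrable m ν)
    (hm2 : Integrable (fun x => ‖x‖ ^ 2 * m x) ν) (z : V) :
    Integrable (fun x => m x • (x - z)) ν := by
  refine integrable_smul_of_norm_le_one_add_norm_sq hm hm2 (C := 1 + ‖z‖)
    (continuous_id.sub continuous_const).aestronglyMeasurable fun x => (norm_sub_le x z).trans ?_
  nlinarith [sq_nonneg (‖x‖ - 1), norm_nonneg z, mul_nonneg (norm_nonneg z) (sq_nonneg ‖x‖)]

lemma integral_smul_sub [NormedSpace ℝ V] [CompleteSpace V] [OpensMeasurableSpace V]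
    [SecondCountableTopologyEither V V] (hm : Integrable m ν) (hm1 : ∫ x, m x ∂ν = 1)
    (hm2 : Integrable (fun x => ‖x‖ ^ 2 * m x) ν) (z : V) :
    ∫ x, m x • (x - z) ∂ν = (∫ x, m x • x ∂ν) - z := by
  have hid : Integrable (fun x => m x • x) ν := by simpa using integrable_smul_sub hm hm2 0
  simp only [smul_sub]
  rw [integral_sub hid (hm.smul_const z), integral_smul_const, hm1, one_smul]

end NormedSpace

section InnerProductSpace

variable {V : Type*} [NormedAddCommGroup V] [InnerProductSpace ℝ V]
  [MeasurableSpace V] [OpensMeasurableSpace V] [SecondCountableTopologyEither V V]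
  {ν : Measure V} {m : V → ℝ}

lemma integrable_inner_sub_mul (hm : Integrable m ν)
    (hm2 : Integrable (fun x => ‖x‖ ^ 2 * m x) ν) (w z : V) :
    Integrable (fun x => inner ℝ w (x - z) * m x) ν := by
  simpa only [inner_smul_right, mul_comm] using
    (integrable_smul_sub hm hm2 z).const_inner (𝕜 := ℝ) w

lemma integral_inner_sub_mul [CompleteSpace V] (hm : Integrable m ν) (hm1 : ∫ x, m x ∂ν = 1)
    (hm2 : Integrable (fun x => ‖x‖ ^ 2 * m x) ν) (w z : V) :
    ∫ x, inner ℝ w (x - z) * m x ∂ν = inner ℝ w ((∫ x, m x • x ∂ν) - z) := by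
  rw [← integral_smul_sub hm hm1 hm2, ← integral_inner (integrable_smul_sub hm hm2 z)]
  simp only [inner_smul_right, mul_comm]

end InnerProductSpace

variable {d : ℕ} {m : E d → ℝ} {S S' : Mat d} {μ μ' : E d}

lemma integrable_bil_sub_mul (hm : Integrable m) (hm2 : Integrable fun x => ‖x‖ ^ 2 * m x)
    (C : Mat d) (z : E d) : Integrable fun x => bil C (x - z) (x - z) * m x := by
  obtain ⟨K, hK, hbil⟩ := exists_bound_bil C
  have hbound (x : E d) : ‖bil C (x - z) (x - z)‖ ≤ K * (2 + 2 * ‖z‖ ^ 2) * (1 + ‖x‖ ^ 2) := by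
    have hsub : ‖x - z‖ * ‖x - z‖ ≤ (2 + 2 * ‖z‖ ^ 2) * (1 + ‖x‖ ^ 2) :=
      (mul_self_le_mul_self (norm_nonneg _) (norm_sub_le x z)).trans <| by
        nlinarith [sq_nonneg (‖x‖ - ‖z‖), mul_nonneg (sq_nonneg ‖x‖) (sq_nonneg ‖z‖)]
    rw [mul_assoc]
    exact (hbil _ _).trans (mul_le_mul_of_nonneg_left hsub hK)
  simpa only [smul_eq_mul, mul_comm] using integrable_smul_of_norm_le_one_add_norm_sq hm hm2
    (contDiff_bil_sub C z (n := 0)).continuous.aestronglyMeasurable hbound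

lemma integral_smul_gaussianDensity (hS : S.PosDef) (μ : E d) :
    ∫ x, gaussianDensity μ S x • x = μ := by
  have hcentred : ∫ x : E d, gaussianDensity 0 S x • x = 0 := by
    have : IsAddTorsionFree (E d) := .of_isTorsionFree ℝ (E d)
    refine self_eq_neg.1 ?_
    rw [← integral_neg, ← integral_neg_eq_self (fun x : E d => gaussianDensity 0 S x • x)]
    simp only [gaussianDensity_zero_neg, smul_neg]
  have hsub := integral_smul_sub (integrable_gaussianDensity hS μ) (integral_gaussianDensity hS μ)
    (integrable_norm_sq_mul_gaussianDensity hS μ) μ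
  simp only [gaussianDensity_eq_sub μ] at hsub ⊢
  rw [integral_sub_right_eq_self (fun x : E d => gaussianDensity 0 S x • x) μ, hcentred] at hsub
  exact (sub_eq_zero.1 hsub.symm)

lemma eq_of_gaussianDensity_eq (hS : S.PosDef) (hS' : S'.PosDef)
    (h : gaussianDensity μ S = gaussianDensity μ' S') : μ = μ' := by
  rw [← integral_smul_gaussianDensity hS μ, h, integral_smul_gaussianDensity hS']

/-- The mean of the cross term only sees the mean of `m`, so that `V̂[m]` depends on `m` through
its mean, up to an additive constant. -/
lemma meanFieldCost_eq {Q B : Mat d} (hB : B.IsSymm) (C D : Mat d) (H Δ₀ : E d)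
    (hm : Integrable m) (hm1 : ∫ x, m x = 1) (hm2 : Integrable fun x => ‖x‖ ^ 2 * m x) :
    meanFieldCost Q B C D H Δ₀ m = fun x => bil Q (x - H) (x - H)
      + inner ℝ (app B ((∫ ξ, m ξ • ξ) - Δ₀)) (x - H)
      + ((∫ ξ, bil C (ξ - Δ₀) (ξ - Δ₀) * m ξ)
        + bil D ((∫ ξ, m ξ • ξ) - Δ₀) ((∫ ξ, m ξ • ξ) - Δ₀)) := by
  funext x
  have hcross (ξ : E d) : bil ((1 / 2 : ℝ) • B) (x - H) (ξ - Δ₀)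
      + bil ((1 / 2 : ℝ) • B) (ξ - Δ₀) (x - H) = inner ℝ (app B (x - H)) (ξ - Δ₀) := by
    simp only [bil, app_smul_left, inner_smul_right]
    rw [← inner_app_of_isSymm hB (x - H) (ξ - Δ₀), real_inner_comm (app B (x - H)) (ξ - Δ₀)]
    ring
  simp only [meanFieldCost, hcross]
  rw [integral_smul_sub hm hm1 hm2, integral_inner_sub_mul hm hm1 hm2, inner_app_of_isSymm hB,
    real_inner_comm (x - H)]
  ring

end Moments

/-! ### The equations with a quadratic cost -/

section QuadraticGaussian

variable {d : ℕ}

lemma contDiff_quadratic (L : Mat d) (ρ : E d) (c : ℝ) {n : WithTop ℕ∞} :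
    ContDiff ℝ n (quadratic L ρ c) := by
  have hbil := contDiff_bil_sub L (0 : E d) (n := n)
  simp only [sub_zero] at hbil
  exact ((hbil.div_const 2).add (contDiff_const.inner ℝ contDiff_id)).add contDiff_const

lemma hasGradientAt_quadratic {L : Mat d} (hL : L.IsSymm) (ρ : E d) (c : ℝ) (x : E d) :
    HasGradientAt (quadratic L ρ c) (app L x + ρ) x := by
  have h := hasGradientAt_add (hasGradientAt_add
    (hasGradientAt_const_mul (1 / 2) (hasGradientAt_bil hL 0 x)) (hasGradientAt_inner ρ x))
    (hasGradientAt_const x c)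
  have heq : (fun y => 1 / 2 * bil L (y - 0) (y - 0) + inner ℝ ρ y + c) = quadratic L ρ c := by
    funext y
    rw [quadratic, sub_zero, one_div_mul_eq_div]
  rw [heq, sub_zero, smul_smul, add_zero, one_div_mul_cancel two_ne_zero, one_smul] at h
  exact h

lemma laplacian_quadratic {L : Mat d} (hL : L.IsSymm) (ρ : E d) (c : ℝ) (x : E d) :
    Δ (quadratic L ρ c) x = L.trace := by
  have hd : DifferentiableAt ℝ (app L) x :=
    (contDiff_app L (n := 1)).differentiable one_ne_zero x
  have hlinear := divergence_app_sub L 0 x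
  simp only [sub_zero] at hlinear
  rw [laplacian_eq_divergence (hasGradientAt_quadratic hL ρ c) (hd.add_const ρ), ← hlinear]
  simp only [divergence, fderiv_add_const]

lemma hasGradientAt_gaussianDensity {S : Mat d} (hS : S.IsSymm) (μ x : E d) :
    HasGradientAt (gaussianDensity μ S) (-(gaussianDensity μ S x • app S (x - μ))) x := by
  have hexp : HasDerivAt (fun t : ℝ => Real.exp (-(t / 2)))
      (-(1 / 2) * Real.exp (-(bil S (x - μ) (x - μ) / 2))) (bil S (x - μ) (x - μ)) := by
    have h := hasDerivAt_exp_div (-2) (bil S (x - μ) (x - μ))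
    simpa only [div_neg, inv_neg, one_div, mul_comm] using h
  have h := hasGradientAt_const_mul (√(S.det / (2 * Real.pi) ^ d))
    (hasGradientAt_comp (φ := fun t => Real.exp (-(t / 2)))
      (f := fun y => bil S (y - μ) (y - μ)) hexp (hasGradientAt_bil hS μ x))
  change HasGradientAt (gaussianDensity μ S) _ x at h
  convert h using 1
  rw [smul_smul, smul_smul, ← neg_smul]
  congr 1
  rw [gaussianDensity]
  ring

lemma kfp_gaussianDensity {k : ℝ} (hk : k ≠ 0) {S : Mat d} (hS : S.IsSymm) (a x : E d) :
    -k * Δ (gaussianDensity a (k⁻¹ • S)) x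
      - divergence (fun y => gaussianDensity a (k⁻¹ • S) y • app S (y - a)) x = 0 := by
  have hflux :
      DifferentiableAt ℝ (fun y => gaussianDensity a (k⁻¹ • S) y • app S (y - a)) x :=
    ((contDiff_gaussianDensity a _ (n := 1)).smul
      ((contDiff_app S).comp (contDiff_id.sub contDiff_const))).differentiable one_ne_zero x
  have hgrad : (fun y => -(gaussianDensity a (k⁻¹ • S) y • app (k⁻¹ • S) (y - a))) =
      fun y => (-k⁻¹) • (gaussianDensity a (k⁻¹ • S) y • app S (y - a)) := by
    funext y
    rw [app_smul_left, smul_comm, neg_smul]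
  rw [laplacian_eq_divergence (hasGradientAt_gaussianDensity (hS.smul _) a)
    (by rw [hgrad]; exact hflux.fun_const_smul _), hgrad, divergence_const_smul _ hflux,
    ← mul_assoc, neg_mul_neg, mul_inv_cancel₀ hk, one_mul, sub_self]

lemma eq_gaussianDensity_of_kfp {k : ℝ} (hk : 0 < k) {S : Mat d} (hS : S.PosDef) {a : E d}
    {m : E d → ℝ} (hm : ContDiff ℝ 2 m) (hm0 : ∀ x, 0 < m x)
    (kfp : ∀ x, -k * Δ m x - divergence (fun y => m y • app S (y - a)) x = 0)
    (hm1 : ∫ x, m x = 1) : m = gaussianDensity a (k⁻¹ • S) := by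
  have hkS : (k⁻¹ • S).PosDef := hS.smul (inv_pos.2 hk)
  obtain ⟨c, hc⟩ := exists_eq_const_mul_exp_of_kfp hk.ne' (isSymm_of_posDef hS) hm hm0 kfp
    (integrable_exp_neg_bil hkS a)
  have hgauss := integral_gaussianDensity hkS a
  simp only [gaussianDensity] at hgauss
  simp only [hc] at hm1
  rw [integral_const_mul] at hm1 hgauss
  have hcc := mul_right_cancel₀ (right_ne_zero_of_mul (hm1.trans_ne one_ne_zero))
    (hm1.trans hgauss.symm)
  funext x
  rw [hc x, hcc, gaussianDensity]

end QuadraticGaussian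

section QuadraticCost

variable {d : ℕ} {A Q S : Mat d} {r k ℓ κ : ℝ} {a w H : E d}

/-- The left-hand side of the Hamilton–Jacobi–Bellman equation. -/
def hjbOperator (A : Mat d) (r k ℓ : ℝ) (v : E d → ℝ) (x : E d) : ℝ :=
  -k * Δ v x + 1 / (2 * r) * ‖∇ v x‖ ^ 2 - inner ℝ (∇ v x) (app A x) + ℓ * v x

/-- The quadratic cost `(x - H)ᵀ Q (x - H) + w (x - H) + κ`, which is the shape of all the costs
averaged over the other players. -/
def quadCost (Q : Mat d) (w H : E d) (κ : ℝ) (x : E d) : ℝ :=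
  bil Q (x - H) (x - H) + inner ℝ w (x - H) + κ

/-- The right-hand side of the discounted Riccati equation `S² + ℓ S = A² - ℓ A + (2 / r) Q`
satisfied by the slope `S` of the optimal drift `x ↦ S (x - a)`. -/
def riccatiMatrix (A : Mat d) (r ℓ : ℝ) (Q : Mat d) : Mat d :=
  A * A - ℓ • A + (2 / r) • Q

/-- The additive constant of the quadratic value function. -/
def valueConst (A : Mat d) (r k ℓ : ℝ) (Q S : Mat d) (a w H : E d) (κ : ℝ) : ℝ :=
  (κ + bil Q H H - inner ℝ w H + k * r * (S + A).trace - r / 2 * ‖app S a‖ ^ 2) / ℓ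

/-- The quadratic value function whose gradient is `r (S (x - a) + A x)`, so that the optimal
drift is `S (x - a)`. -/
def qgValue (A : Mat d) (r k ℓ : ℝ) (Q S : Mat d) (a w H : E d) (κ : ℝ) : E d → ℝ :=
  quadratic (r • (S + A)) (-(r • app S a)) (valueConst A r k ℓ Q S a w H κ)

lemma gradient_quadratic_smul_add (hA : A.IsSymm) (hS : S.IsSymm) (c : ℝ) (x : E d) :
    ∇ (quadratic (r • (S + A)) (-(r • app S a)) c) x = r • (app S (x - a) + app A x) := by
  rw [(hasGradientAt_quadratic ((hS.add hA).smul r) _ c x).gradient, app_smul_left, app_add_left,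
    app_sub_right, ← smul_neg, ← smul_add]
  congr 1
  abel

/-- Completing the square: `‖r (p + q)‖² / (2r) - r ⟪p + q, q⟫ = (r / 2) (‖p‖² - ‖q‖²)`. -/
lemma hjbOperator_quadratic (hr : r ≠ 0) (hA : A.IsSymm) (hS : S.IsSymm) (c : ℝ) (x : E d) :
    hjbOperator A r k ℓ (quadratic (r • (S + A)) (-(r • app S a)) c) x =
      -(k * r * (S + A).trace) + r / 2 * (‖app S (x - a)‖ ^ 2 - ‖app A x‖ ^ 2)
        + ℓ * quadratic (r • (S + A)) (-(r • app S a)) c x := by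
  have hsq : 1 / (2 * r) * r ^ 2 = r / 2 := by
    rw [one_div_mul_eq_div, sq, mul_div_mul_right _ _ hr]
  rw [hjbOperator, laplacian_quadratic ((hS.add hA).smul r), gradient_quadratic_smul_add hA hS,
    norm_smul, mul_pow, Real.norm_eq_abs, sq_abs, ← mul_assoc, hsq, norm_add_sq_real,
    inner_smul_left, inner_add_left, real_inner_self_eq_norm_sq, Matrix.trace_smul, smul_eq_mul,
    conj_trivial]
  ring

lemma mul_norm_sq_sub_add_bil (hr : r ≠ 0) (hA : A.IsSymm) (hS : S.IsSymm)
    (hP : S * S + ℓ • S = riccatiMatrix A r ℓ Q) (x : E d) :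
    r / 2 * (‖app S x‖ ^ 2 - ‖app A x‖ ^ 2) + ℓ * (r / 2 * (bil S x x + bil A x x)) =
      bil Q x x := by
  have hx : ‖app S x‖ ^ 2 + ℓ * bil S x x =
      ‖app A x‖ ^ 2 - ℓ * bil A x x + 2 / r * bil Q x x := by
    have h := congrArg (fun M => bil M x x) hP
    simp only [riccatiMatrix, bil, app_add_left, app_sub_left, app_smul_left, app_mul,
      inner_add_right, inner_sub_right, inner_smul_right] at h
    rwa [← inner_app_of_isSymm hS x, ← inner_app_of_isSymm hA x, real_inner_self_eq_norm_sq,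
      real_inner_self_eq_norm_sq] at h
  field_simp at hx
  linear_combination hx / 2

lemma mul_inner_app_add (hS : S.IsSymm) (hP : S * S + ℓ • S = riccatiMatrix A r ℓ Q)
    (ha : r • app (riccatiMatrix A r ℓ Q) a = (2 : ℝ) • app Q H - w) (x : E d) :
    r * (inner ℝ (app S x) (app S a) + ℓ * inner ℝ (app S a) x) =
      2 * inner ℝ (app Q H) x - inner ℝ w x := by
  have h := congrArg (inner ℝ · x) ha
  simp only [← hP, app_add_left, app_smul_left, app_mul, inner_add_left, inner_sub_left,
    inner_smul_left, conj_trivial] at h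
  rwa [inner_app_of_isSymm hS (app S a) x, real_inner_comm (app S x)] at h

lemma hjbOperator_qgValue (hr : r ≠ 0) (hℓ : ℓ ≠ 0) (hA : A.IsSymm) (hQ : Q.IsSymm)
    (hS : S.IsSymm) (hP : S * S + ℓ • S = riccatiMatrix A r ℓ Q)
    (ha : r • app (riccatiMatrix A r ℓ Q) a = (2 : ℝ) • app Q H - w) (x : E d) :
    hjbOperator A r k ℓ (qgValue A r k ℓ Q S a w H κ) x = quadCost Q w H κ x := by
  have hconst : ℓ * valueConst A r k ℓ Q S a w H κ =
      κ + bil Q H H - inner ℝ w H + k * r * (S + A).trace - r / 2 * ‖app S a‖ ^ 2 :=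
    mul_div_cancel₀ _ hℓ
  have hcost : quadCost Q w H κ x = bil Q x x - 2 * inner ℝ (app Q H) x + bil Q H H
      + inner ℝ w x - inner ℝ w H + κ := by
    simp only [quadCost, bil, app_sub_right, inner_sub_left, inner_sub_right]
    rw [← inner_app_of_isSymm hQ H x, real_inner_comm (app Q H) x]
    ring
  have hvalue : qgValue A r k ℓ Q S a w H κ x = r / 2 * (bil S x x + bil A x x)
      - r * inner ℝ (app S a) x + valueConst A r k ℓ Q S a w H κ := by
    simp only [qgValue, quadratic, bil, app_smul_left, app_add_left, inner_add_right,
      inner_smul_right, inner_neg_left, inner_smul_left, conj_trivial]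
    ring
  rw [qgValue, hjbOperator_quadratic hr hA hS, ← qgValue, hvalue, app_sub_right,
    norm_sub_sq_real, hcost]
  linear_combination mul_norm_sq_sub_add_bil hr hA hS hP x - mul_inner_app_add hS hP ha x + hconst

lemma gradient_const_mul_sub {v v₀ : E d → ℝ} (hv : ContDiff ℝ 1 v) (hv₀ : ContDiff ℝ 1 v₀)
    (c : ℝ) (x : E d) : ∇ (fun y => c * (v y - v₀ y)) x = c • (∇ v x - ∇ v₀ x) :=
  (hasGradientAt_const_mul c (hasGradientAt_sub (hasGradientAt_of_contDiff hv one_ne_zero x)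
    (hasGradientAt_of_contDiff hv₀ one_ne_zero x))).gradient

lemma laplacian_const_mul_sub {v v₀ : E d → ℝ} (hv : ContDiff ℝ 2 v) (hv₀ : ContDiff ℝ 2 v₀)
    (c : ℝ) (x : E d) : Δ (fun y => c * (v y - v₀ y)) x = c * (Δ v x - Δ v₀ x) := by
  change Δ (c • (v - v₀)) x = _
  have hsub : ContDiff ℝ 2 (v - v₀) := hv.sub hv₀
  rw [InnerProductSpace.laplacian_smul c hsub.contDiffAt,
    hv.contDiffAt.laplacian_sub hv₀.contDiffAt, smul_eq_mul]

lemma hjbOperator_sub (hr : r ≠ 0) {v v₀ : E d → ℝ} (hv : ContDiff ℝ 2 v)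
    (hv₀ : ContDiff ℝ 2 v₀) (x : E d) :
    hjbOperator A r k ℓ v x - hjbOperator A r k ℓ v₀ x =
      r * (-k * Δ (fun y => r⁻¹ * (v y - v₀ y)) x
        + 1 / 2 * ‖∇ (fun y => r⁻¹ * (v y - v₀ y)) x‖ ^ 2
        + inner ℝ (∇ (fun y => r⁻¹ * (v y - v₀ y)) x) ((1 / r) • ∇ v₀ x - app A x)
        + ℓ * (r⁻¹ * (v x - v₀ x))) := by
  rw [gradient_const_mul_sub (hv.of_le one_le_two) (hv₀.of_le one_le_two),
    laplacian_const_mul_sub hv hv₀, norm_smul, mul_pow, Real.norm_eq_abs, sq_abs,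
    inner_smul_left, inner_sub_right, inner_smul_right, norm_sub_sq_real, hjbOperator, hjbOperator]
  simp only [inner_sub_left, real_inner_self_eq_norm_sq, conj_trivial]
  field_simp
  ring

lemma drift_qgValue (hr : r ≠ 0) (hA : A.IsSymm) (hS : S.IsSymm) (x : E d) :
    (1 / r) • ∇ (qgValue A r k ℓ Q S a w H κ) x - app A x = app S (x - a) := by
  rw [qgValue, gradient_quadratic_smul_add hA hS, smul_smul, one_div_mul_cancel hr, one_smul,
    add_sub_cancel_right]

theorem solvesHJBKFP_qgValue (hr : r ≠ 0) (hk : 0 < k) (hℓ : ℓ ≠ 0) (hA : A.IsSymm)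
    (hQ : Q.IsSymm) (hS : S.PosDef) (hP : S * S + ℓ • S = riccatiMatrix A r ℓ Q)
    (ha : r • app (riccatiMatrix A r ℓ Q) a = (2 : ℝ) • app Q H - w) :
    SolvesHJBKFP A r k ℓ (quadCost Q w H κ) (qgValue A r k ℓ Q S a w H κ)
      (gaussianDensity a (k⁻¹ • S)) where
  contDiff_v := contDiff_quadratic _ _ _
  contDiff_m := contDiff_gaussianDensity a _
  hjb := hjbOperator_qgValue hr hℓ hA hQ (isSymm_of_posDef hS) hP ha
  kfp x := by
    simp only [drift_qgValue hr hA (isSymm_of_posDef hS)]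
    exact kfp_gaussianDensity hk.ne' (isSymm_of_posDef hS) a x
  integrable_m := integrable_gaussianDensity (hS.smul (inv_pos.2 hk)) a
  integral_m := integral_gaussianDensity (hS.smul (inv_pos.2 hk)) a
  pos_m := gaussianDensity_pos a (hS.smul (inv_pos.2 hk))
  second_moment := integrable_norm_sq_mul_gaussianDensity (hS.smul (inv_pos.2 hk)) a

lemma eq_qgValue_of_solvesHJBKFP (hr : r ≠ 0) (hk : 0 < k) (hℓ : 0 < ℓ) (hA : A.IsSymm)
    (hQ : Q.IsSymm) (hS : S.PosSemidef) (hP : S * S + ℓ • S = riccatiMatrix A r ℓ Q)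
    (ha : r • app (riccatiMatrix A r ℓ Q) a = (2 : ℝ) • app Q H - w) {v m : E d → ℝ}
    (h : SolvesHJBKFP A r k ℓ (quadCost Q w H κ) v m) :
    v = qgValue A r k ℓ Q S a w H κ := by
  have hSs : S.IsSymm := Matrix.isHermitian_iff_isSymm.1 hS.isHermitian
  set v₀ := qgValue A r k ℓ Q S a w H κ with hv₀_def
  have hv₀ : ContDiff ℝ 2 v₀ := contDiff_quadratic _ _ _
  have hdrift₀ (x : E d) : (1 / r) • ∇ v₀ x - app A x = app S (x - a) :=
    drift_qgValue hr hA hSs x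
  have hdrift (x : E d) : (1 / r) • ∇ v x - app A x =
      app S (x - a) + ∇ (fun y => r⁻¹ * (v y - v₀ y)) x := by
    rw [← hdrift₀ x, gradient_const_mul_sub (h.contDiff_v.of_le one_le_two)
      (hv₀.of_le one_le_two), smul_sub, one_div]
    abel
  have hzero := eq_zero_of_hjb_of_kfp hk hℓ hS (a := a)
    (contDiff_const.mul (h.contDiff_v.sub hv₀)) h.contDiff_m
    (fun x => by
      have hsub := hjbOperator_sub (A := A) (k := k) (ℓ := ℓ) hr h.contDiff_v hv₀ x
      have hv : hjbOperator A r k ℓ v x = quadCost Q w H κ x := h.hjb x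
      rw [hv, hv₀_def, hjbOperator_qgValue hr hℓ.ne' hA hQ hSs hP ha, ← hv₀_def, sub_self,
        hdrift₀] at hsub
      exact (mul_eq_zero.1 hsub.symm).resolve_left hr)
    (fun x => by simpa only [hdrift] using h.kfp x) h.integrable_m h.pos_m
  funext x
  exact sub_eq_zero.1 ((mul_eq_zero.1 (hzero x)).resolve_left (inv_ne_zero hr))

theorem solvesHJBKFP_quadCost_iff (hr : r ≠ 0) (hk : 0 < k) (hℓ : 0 < ℓ) (hA : A.IsSymm)
    (hQ : Q.IsSymm) (hS : S.PosDef) (hP : S * S + ℓ • S = riccatiMatrix A r ℓ Q)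
    (ha : r • app (riccatiMatrix A r ℓ Q) a = (2 : ℝ) • app Q H - w) {v m : E d → ℝ} :
    SolvesHJBKFP A r k ℓ (quadCost Q w H κ) v m ↔
      v = qgValue A r k ℓ Q S a w H κ ∧ m = gaussianDensity a (k⁻¹ • S) := by
  constructor
  · intro h
    obtain rfl := eq_qgValue_of_solvesHJBKFP hr hk hℓ hA hQ hS.posSemidef hP ha h
    refine ⟨rfl, eq_gaussianDensity_of_kfp hk hS h.contDiff_m h.pos_m (fun x => ?_) h.integral_m⟩
    simpa only [drift_qgValue hr hA (isSymm_of_posDef hS)] using h.kfp x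
  · rintro ⟨rfl, rfl⟩
    exact solvesHJBKFP_qgValue hr hk hℓ.ne' hA hQ hS hP ha

end QuadraticCost

/-! ### The mean field system -/

section LinearSystems

variable {d : ℕ} {A M P Q B : Mat d} {r : ℝ}

lemma exists_app_eq (hM : IsUnit M) (y : E d) : ∃ x, app M x = y :=
  ⟨app M⁻¹ y, by
    rw [← app_mul, Matrix.mul_nonsing_inv _ ((Matrix.isUnit_iff_isUnit_det M).1 hM), app_one]⟩

lemma app_injective (hM : IsUnit M) : Function.Injective (app M) :=
  Function.LeftInverse.injective (g := app M⁻¹) fun x => by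
    rw [← app_mul, Matrix.nonsing_inv_mul _ ((Matrix.isUnit_iff_isUnit_det M).1 hM), app_one]

lemma exists_app_eq_zero (hM : ¬IsUnit M) : ∃ z : E d, z ≠ 0 ∧ app M z = 0 := by
  rw [Matrix.isUnit_iff_isUnit_det, isUnit_iff_ne_zero, not_not] at hM
  obtain ⟨z, hz, hz0⟩ := Matrix.exists_mulVec_eq_zero_iff.2 hM
  exact ⟨WithLp.toLp 2 z, by simpa using hz, by simp [app, hz0]⟩

lemma app_smul_add_eq_iff {μ y z : E d} :
    app (r • P + B) μ = y + app B z ↔ r • app P μ = y - app B (μ - z) := by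
  rw [app_add_left, app_smul_left, app_sub_right, sub_sub_eq_add_sub, eq_sub_iff_add_eq]

lemma isSymm_riccatiMatrix (hA : A.IsSymm) (hQ : Q.IsSymm) (r ℓ : ℝ) :
    (riccatiMatrix A r ℓ Q).IsSymm := by
  rw [Matrix.IsSymm, riccatiMatrix, transpose_add, transpose_sub, transpose_mul, transpose_smul,
    transpose_smul, hA.eq, hQ.eq]

lemma bil_riccatiMatrix (hA : A.IsSymm) (Q : Mat d) (r ℓ : ℝ) (x : E d) :
    bil (riccatiMatrix A r ℓ Q) x x = ‖app A x‖ ^ 2 - ℓ * bil A x x + 2 / r * bil Q x x := by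
  simp only [bil, riccatiMatrix, app_add_left, app_sub_left, app_smul_left, app_mul,
    inner_add_right, inner_sub_right, inner_smul_right]
  rw [← inner_app_of_isSymm hA x (app A x), real_inner_self_eq_norm_sq]

lemma exists_riccatiMatrix_posDef (hA : A.IsSymm) (hQ : Q.PosDef) (hr : 0 < r) :
    ∃ ℓ₀ : ℝ, 0 < ℓ₀ ∧ ∀ ℓ, 0 < ℓ → ℓ < ℓ₀ → (riccatiMatrix A r ℓ Q).PosDef := by
  obtain ⟨ε, hε, hQε⟩ := exists_pos_forall_mul_norm_sq_le_bil hQ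
  obtain ⟨C, hC, hAC⟩ := exists_bound_bil A
  refine ⟨2 / r * ε / (C + 1), by positivity, fun ℓ hℓ hlt => ?_⟩
  refine posDef_of_bil_pos (isSymm_riccatiMatrix hA (isSymm_of_posDef hQ) r ℓ) fun x hx => ?_
  have hx2 : 0 < ‖x‖ ^ 2 := by positivity
  have hbilA : ℓ * bil A x x < 2 / r * ε * ‖x‖ ^ 2 := calc
    ℓ * bil A x x ≤ ℓ * (C * ‖x‖ ^ 2) := by
      rw [sq]
      exact mul_le_mul_of_nonneg_left ((le_abs_self _).trans (hAC x x)) hℓ.le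
    _ < ℓ * (C + 1) * ‖x‖ ^ 2 := by nlinarith [mul_pos hℓ hx2]
    _ < 2 / r * ε * ‖x‖ ^ 2 :=
      mul_lt_mul_of_pos_right ((lt_div_iff₀ (by positivity)).1 hlt) hx2
  have hbilQ : 2 / r * ε * ‖x‖ ^ 2 ≤ 2 / r * bil Q x x := by
    rw [mul_assoc]
    exact mul_le_mul_of_nonneg_left (hQε x) (by positivity)
  rw [bil_riccatiMatrix hA]
  linarith [sq_nonneg ‖app A x‖]

lemma two_smul_limitMatrix (A : Mat d) (hr : r ≠ 0) (ℓ : ℝ) (Q B : Mat d) :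
    (2 : ℝ) • limitMatrix A r ℓ Q B = r • riccatiMatrix A r ℓ Q + B := by
  ext i j
  simp only [limitMatrix, riccatiMatrix, Matrix.add_apply, Matrix.sub_apply, Matrix.smul_apply,
    smul_eq_mul]
  field_simp
  ring

lemma isUnit_limitMatrix_iff (A : Mat d) (hr : r ≠ 0) (ℓ : ℝ) (Q B : Mat d) :
    IsUnit (limitMatrix A r ℓ Q B) ↔ IsUnit (r • riccatiMatrix A r ℓ Q + B) := by
  rw [← two_smul_limitMatrix A hr, ← Units.smul_mk0 two_ne_zero, isUnit_smul_iff]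

end LinearSystems

section MeanField

variable {d : ℕ} {A Q B C D S : Mat d} {r k ℓ : ℝ} {H Δ₀ : E d} {v m : E d → ℝ}

lemma isQG_qgValue (hA : A.IsSymm) (hS : S.PosDef) (hk : 0 < k) (ℓ : ℝ) (w H : E d) (κ : ℝ)
    (μ : E d) : IsQG (qgValue A r k ℓ Q S μ w H κ) (gaussianDensity μ (k⁻¹ • S)) :=
  ⟨_, _, _, _, _, ((isSymm_of_posDef hS).add hA).smul r, hS.smul (inv_pos.2 hk), rfl, rfl⟩

/-- The part of the mean field cost of a Gaussian density that does not depend on the state. -/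
def mfConst (C D : Mat d) (Δ₀ : E d) (S : Mat d) (μ : E d) : ℝ :=
  (∫ ξ, bil C (ξ - Δ₀) (ξ - Δ₀) * gaussianDensity μ S ξ) + bil D (μ - Δ₀) (μ - Δ₀)

/-- The quadratic value function of an agent who faces the mean field cost of the Gaussian
population with mean `μ` and precision matrix `k⁻¹ • S`, when `S` solves the Riccati equation. -/
def mfValue (A : Mat d) (r k ℓ : ℝ) (Q B C D S : Mat d) (H Δ₀ μ : E d) : E d → ℝ :=
  qgValue A r k ℓ Q S μ (app B (μ - Δ₀)) H (mfConst C D Δ₀ (k⁻¹ • S) μ)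

lemma meanFieldCost_gaussianDensity (hB : B.IsSymm) (C D : Mat d) (H Δ₀ : E d) (hS : S.PosDef)
    (μ : E d) : meanFieldCost Q B C D H Δ₀ (gaussianDensity μ S) =
      quadCost Q (app B (μ - Δ₀)) H (mfConst C D Δ₀ S μ) := by
  rw [meanFieldCost_eq hB C D H Δ₀ (integrable_gaussianDensity hS μ)
    (integral_gaussianDensity hS μ) (integrable_norm_sq_mul_gaussianDensity hS μ),
    integral_smul_gaussianDensity hS]
  rfl

/-- Both the drift and the law of a solution are centred at the point `a` determined by its mean;
matching `a` with the mean yields the linear system for `μ`. -/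
theorem isMFSolution_iff (hr : r ≠ 0) (hk : 0 < k) (hℓ : 0 < ℓ) (hA : A.IsSymm) (hQ : Q.IsSymm)
    (hB : B.IsSymm) (hPd : (riccatiMatrix A r ℓ Q).PosDef) (hS : S.PosDef)
    (hP : S * S + ℓ • S = riccatiMatrix A r ℓ Q) :
    IsMFSolution A r k ℓ Q B C D H Δ₀ v m ↔
      ∃ μ, app (r • riccatiMatrix A r ℓ Q + B) μ = (2 : ℝ) • app Q H + app B Δ₀ ∧
        v = mfValue A r k ℓ Q B C D S H Δ₀ μ ∧ m = gaussianDensity μ (k⁻¹ • S) := by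
  have hkS : (k⁻¹ • S).PosDef := hS.smul (inv_pos.2 hk)
  simp only [app_smul_add_eq_iff, IsMFSolution]
  constructor
  · intro h
    have hmean : ∃ μ, r • app (riccatiMatrix A r ℓ Q) μ =
        (2 : ℝ) • app Q H - app B (μ - Δ₀) ∧ m = gaussianDensity μ (k⁻¹ • S) := by
      have hquad := h
      rw [meanFieldCost_eq hB C D H Δ₀ h.integrable_m h.integral_m h.second_moment] at hquad
      obtain ⟨a, ha⟩ := exists_app_eq hPd.isUnit
        (r⁻¹ • ((2 : ℝ) • app Q H - app B ((∫ ξ, m ξ • ξ) - Δ₀)))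
      rw [eq_inv_smul_iff₀ hr] at ha
      obtain ⟨-, hm⟩ := (solvesHJBKFP_quadCost_iff hr hk hℓ hA hQ hS hP ha).1 hquad
      rw [hm, integral_smul_gaussianDensity hkS] at ha
      exact ⟨a, ha, hm⟩
    obtain ⟨μ, hμ, rfl⟩ := hmean
    rw [meanFieldCost_gaussianDensity hB C D H Δ₀ hkS] at h
    exact ⟨μ, hμ, (solvesHJBKFP_quadCost_iff hr hk hℓ hA hQ hS hP hμ).1 h⟩
  · rintro ⟨μ, hμ, hvm⟩
    rw [hvm.2, meanFieldCost_gaussianDensity hB C D H Δ₀ hkS, ← hvm.2]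
    exact (solvesHJBKFP_quadCost_iff hr hk hℓ hA hQ hS hP hμ).2 hvm

theorem exists_qg_unique_of_isUnit (hr : r ≠ 0) (hk : 0 < k) (hℓ : 0 < ℓ) (hA : A.IsSymm)
    (hQ : Q.IsSymm) (hB : B.IsSymm) (hPd : (riccatiMatrix A r ℓ Q).PosDef)
    (hM : IsUnit (limitMatrix A r ℓ Q B)) (C D : Mat d) (H Δ₀ : E d) :
    ∃ v m : E d → ℝ, IsMFSolution A r k ℓ Q B C D H Δ₀ v m ∧ IsQG v m ∧
      ∀ v' m' : E d → ℝ, IsMFSolution A r k ℓ Q B C D H Δ₀ v' m' → v' = v ∧ m' = m := by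
  obtain ⟨S, hS, hP⟩ := exists_posDef_mul_self_add_smul_eq hPd ℓ
  have hiff {v m : E d → ℝ} := isMFSolution_iff (C := C) (D := D) (H := H) (Δ₀ := Δ₀) (v := v)
    (m := m) hr hk hℓ hA hQ hB hPd hS hP
  rw [isUnit_limitMatrix_iff A hr] at hM
  obtain ⟨μ, hμ⟩ := exists_app_eq hM ((2 : ℝ) • app Q H + app B Δ₀)
  refine ⟨_, _, hiff.2 ⟨μ, hμ, rfl, rfl⟩, isQG_qgValue hA hS hk ℓ _ H _ μ, fun v' m' h => ?_⟩
  obtain ⟨μ', hμ', hv, hm⟩ := hiff.1 h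
  obtain rfl := app_injective hM (hμ'.trans hμ.symm)
  exact ⟨hv, hm⟩

/-- If the matrix is singular, the mean can be translated along its kernel. -/
theorem isUnit_limitMatrix_of_existsUnique (hr : r ≠ 0) (hk : 0 < k) (hℓ : 0 < ℓ)
    (hA : A.IsSymm) (hQ : Q.IsSymm) (hB : B.IsSymm) (hPd : (riccatiMatrix A r ℓ Q).PosDef)
    (h : ∃! p : (E d → ℝ) × (E d → ℝ),
      IsMFSolution A r k ℓ Q B C D H Δ₀ p.1 p.2 ∧ IsQG p.1 p.2) :
    IsUnit (limitMatrix A r ℓ Q B) := by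
  obtain ⟨S, hS, hP⟩ := exists_posDef_mul_self_add_smul_eq hPd ℓ
  have hkS : (k⁻¹ • S).PosDef := hS.smul (inv_pos.2 hk)
  have hiff {v m : E d → ℝ} := isMFSolution_iff (C := C) (D := D) (H := H) (Δ₀ := Δ₀) (v := v)
    (m := m) hr hk hℓ hA hQ hB hPd hS hP
  rw [isUnit_limitMatrix_iff A hr]
  by_contra hM
  obtain ⟨z, hz, hz0⟩ := exists_app_eq_zero hM
  obtain ⟨p, ⟨hp, -⟩, huniq⟩ := h
  obtain ⟨μ, hμ, -, hm⟩ := hiff.1 hp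
  have hμz : app (r • riccatiMatrix A r ℓ Q + B) (μ + z) =
      (2 : ℝ) • app Q H + app B Δ₀ := by rw [app_add_right, hz0, add_zero, hμ]
  have heq := huniq (_, _) ⟨hiff.2 ⟨μ + z, hμz, rfl, rfl⟩, isQG_qgValue hA hS hk ℓ _ H _ (μ + z)⟩
  have hmean := eq_of_gaussianDensity_eq hkS hkS ((congrArg Prod.snd heq).trans hm)
  exact hz (add_eq_left.1 hmean)

theorem existsUnique_qg_iff (hr : r ≠ 0) (hk : 0 < k) (hℓ : 0 < ℓ) (hA : A.IsSymm)
    (hQ : Q.IsSymm) (hB : B.IsSymm) (hPd : (riccatiMatrix A r ℓ Q).PosDef) :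
    (∃! p : (E d → ℝ) × (E d → ℝ),
      IsMFSolution A r k ℓ Q B C D H Δ₀ p.1 p.2 ∧ IsQG p.1 p.2) ↔
      IsUnit (limitMatrix A r ℓ Q B) := by
  refine ⟨isUnit_limitMatrix_of_existsUnique hr hk hℓ hA hQ hB hPd, fun hM => ?_⟩
  obtain ⟨v, m, hvm, hqg, huniq⟩ :=
    exists_qg_unique_of_isUnit hr hk hℓ hA hQ hB hPd hM C D H Δ₀
  exact ⟨(v, m), ⟨hvm, hqg⟩, fun p hp => Prod.ext_iff.2 (huniq p.1 p.2 hp.1)⟩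

lemma isUnit_limitMatrix_of_posSemidef (hr : 0 < r) (hPd : (riccatiMatrix A r ℓ Q).PosDef)
    (hB : B.PosSemidef) : IsUnit (limitMatrix A r ℓ Q B) :=
  (isUnit_limitMatrix_iff A hr.ne' ℓ Q B).2 ((hPd.smul hr).add_posSemidef hB).isUnit

end MeanField

/-! ### Averages over independent players -/

section IndependentFactors

variable {X ι : Type*} [Fintype ι]

lemma mul_prod_eq_prod_ite_mul [DecidableEq ι] (p f : X → ℝ) (j : ι) (ξ : ι → X) :
    f (ξ j) * ∏ l, p (ξ l) = ∏ l, (if l = j then f (ξ l) else 1) * p (ξ l) := by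
  simp only [Finset.prod_mul_distrib, Finset.prod_ite_eq', Finset.mem_univ, if_true]

lemma mul_mul_prod_eq_prod_ite_mul [DecidableEq ι] (p f g : X → ℝ) (j k : ι) (ξ : ι → X) :
    f (ξ j) * g (ξ k) * ∏ l, p (ξ l) =
      ∏ l, (if l = j then f (ξ l) else 1) * (if l = k then g (ξ l) else 1) * p (ξ l) := by
  simp only [Finset.prod_mul_distrib, Finset.prod_ite_eq', Finset.mem_univ, if_true]

variable [MeasureSpace X] [SigmaFinite (volume : Measure X)] {p f g : X → ℝ} {j k : ι}

lemma integrable_mul_prod (hp : Integrable p) (hf : Integrable fun x => f x * p x) (j : ι) :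
    Integrable fun ξ : ι → X => f (ξ j) * ∏ l, p (ξ l) := by
  classical
  simp only [mul_prod_eq_prod_ite_mul]
  refine Integrable.fintype_prod (μ := fun _ : ι => (volume : Measure X))
    (f := fun l x => (if l = j then f x else 1) * p x) fun l => ?_
  rcases eq_or_ne l j with rfl | hj
  · simpa using hf
  · simpa [hj] using hp

lemma integral_mul_prod (hp1 : ∫ x, p x = 1) (f : X → ℝ) (j : ι) :
    ∫ ξ : ι → X, f (ξ j) * ∏ l, p (ξ l) = ∫ x, f x * p x := by
  classical
  simp only [mul_prod_eq_prod_ite_mul]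
  have hfactor (l : ι) : ∫ x, (if l = j then f x else 1) * p x =
      if l = j then ∫ x, f x * p x else 1 := by
    split_ifs <;> simp [hp1]
  rw [integral_fintype_prod_volume_eq_prod (E := fun _ => X)
    (fun l x => (if l = j then f x else 1) * p x)]
  simp only [hfactor, Finset.prod_ite_eq', Finset.mem_univ, if_true]

lemma integrable_mul_mul_prod (hp : Integrable p) (hf : Integrable fun x => f x * p x)
    (hg : Integrable fun x => g x * p x) (hjk : j ≠ k) :
    Integrable fun ξ : ι → X => f (ξ j) * g (ξ k) * ∏ l, p (ξ l) := by
  classical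
  simp only [mul_mul_prod_eq_prod_ite_mul]
  refine Integrable.fintype_prod (μ := fun _ : ι => (volume : Measure X))
    (f := fun l x => (if l = j then f x else 1) * (if l = k then g x else 1) * p x) fun l => ?_
  rcases eq_or_ne l j with rfl | hj
  · simpa [hjk] using hf
  · rcases eq_or_ne l k with rfl | hk
    · simpa [hj] using hg
    · simpa [hj, hk] using hp

lemma integral_mul_mul_prod (hp1 : ∫ x, p x = 1) (f g : X → ℝ) (hjk : j ≠ k) :
    ∫ ξ : ι → X, f (ξ j) * g (ξ k) * ∏ l, p (ξ l) =
      (∫ x, f x * p x) * ∫ x, g x * p x := by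
  classical
  simp only [mul_mul_prod_eq_prod_ite_mul]
  have hfactor (l : ι) :
      ∫ x, (if l = j then f x else 1) * (if l = k then g x else 1) * p x =
        (if l = j then ∫ x, f x * p x else 1) * (if l = k then ∫ x, g x * p x else 1) := by
    rcases eq_or_ne l j with rfl | hj
    · simp [hjk]
    · simp only [hj, if_false, one_mul]
      split_ifs <;> simp [hp1]
  rw [integral_fintype_prod_volume_eq_prod (E := fun _ => X)
    (fun l x => (if l = j then f x else 1) * (if l = k then g x else 1) * p x)]
  simp only [hfactor, Finset.prod_mul_distrib, Finset.prod_ite_eq', Finset.mem_univ, if_true]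

end IndependentFactors

section IndependentVectors

variable {d : ℕ} {ι : Type*} [Fintype ι] {p : E d → ℝ} {j k : ι}

lemma bil_eq_sum_inner_mul_inner (M : Mat d) (x y : E d) :
    bil M x y = ∑ a, inner ℝ (EuclideanSpace.basisFun (Fin d) ℝ a) x *
      inner ℝ (app Mᵀ (EuclideanSpace.basisFun (Fin d) ℝ a)) y := by
  simp only [inner_app_transpose, bil]
  rw [← (EuclideanSpace.basisFun (Fin d) ℝ).sum_inner_mul_inner x]
  simp only [real_inner_comm x]

lemma integrable_bil_mul_prod (hp : Integrable p) (hp2 : Integrable fun x => ‖x‖ ^ 2 * p x)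
    (M : Mat d) (z : E d) (hjk : j ≠ k) :
    Integrable fun ξ : ι → E d => bil M (ξ j - z) (ξ k - z) * ∏ l, p (ξ l) := by
  simp only [bil_eq_sum_inner_mul_inner, Finset.sum_mul]
  exact integrable_finsetSum _ fun a _ => integrable_mul_mul_prod hp
    (integrable_inner_sub_mul hp hp2 _ z) (integrable_inner_sub_mul hp hp2 _ z) hjk

lemma integral_bil_mul_prod (hp : Integrable p) (hp1 : ∫ x, p x = 1)
    (hp2 : Integrable fun x => ‖x‖ ^ 2 * p x) (M : Mat d) (z : E d) (hjk : j ≠ k) :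
    ∫ ξ : ι → E d, bil M (ξ j - z) (ξ k - z) * ∏ l, p (ξ l) =
      bil M ((∫ x, p x • x) - z) ((∫ x, p x • x) - z) := by
  simp only [bil_eq_sum_inner_mul_inner, Finset.sum_mul]
  rw [integral_finsetSum _ fun a _ => integrable_mul_mul_prod hp
    (integrable_inner_sub_mul hp hp2 _ z) (integrable_inner_sub_mul hp hp2 _ z) hjk]
  refine Finset.sum_congr rfl fun a _ => ?_
  rw [integral_mul_mul_prod hp1 (fun x => inner ℝ _ (x - z)) (fun x => inner ℝ _ (x - z)) hjk,
    integral_inner_sub_mul hp hp1 hp2, integral_inner_sub_mul hp hp1 hp2]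

lemma integrable_sum_inner_mul_prod (hp : Integrable p)
    (hp2 : Integrable fun x => ‖x‖ ^ 2 * p x) (w z : E d) :
    Integrable fun ξ : ι → E d => (∑ j, inner ℝ w (ξ j - z)) * ∏ l, p (ξ l) := by
  simp only [Finset.sum_mul]
  exact integrable_finsetSum _ fun j _ =>
    integrable_mul_prod hp (integrable_inner_sub_mul hp hp2 w z) j

lemma integral_sum_inner_mul_prod (hp : Integrable p) (hp1 : ∫ x, p x = 1)
    (hp2 : Integrable fun x => ‖x‖ ^ 2 * p x) (w z : E d) :
    ∫ ξ : ι → E d, (∑ j, inner ℝ w (ξ j - z)) * ∏ l, p (ξ l) =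
      Fintype.card ι * inner ℝ w ((∫ x, p x • x) - z) := by
  simp only [Finset.sum_mul]
  rw [integral_finsetSum _ fun j _ =>
    integrable_mul_prod hp (integrable_inner_sub_mul hp hp2 w z) j]
  simp only [integral_mul_prod hp1 (fun x => inner ℝ w (x - z)),
    integral_inner_sub_mul hp hp1 hp2, Finset.sum_const, Finset.card_univ, nsmul_eq_mul]

variable [DecidableEq ι]

lemma integrable_bil_ite_mul_prod (hp : Integrable p) (hp2 : Integrable fun x => ‖x‖ ^ 2 * p x)
    (C D : Mat d) (z : E d) (j k : ι) : Integrable fun ξ : ι → E d =>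
      bil (if j = k then C else D) (ξ j - z) (ξ k - z) * ∏ l, p (ξ l) := by
  rcases eq_or_ne j k with rfl | hjk
  · simpa only [if_true] using integrable_mul_prod hp (integrable_bil_sub_mul hp hp2 C z) j
  · simpa only [hjk, if_false] using integrable_bil_mul_prod hp hp2 D z hjk

lemma integral_bil_ite_mul_prod (hp : Integrable p) (hp1 : ∫ x, p x = 1)
    (hp2 : Integrable fun x => ‖x‖ ^ 2 * p x) (C D : Mat d) (z : E d) (j k : ι) :
    ∫ ξ : ι → E d, bil (if j = k then C else D) (ξ j - z) (ξ k - z) * ∏ l, p (ξ l) =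
      if j = k then ∫ x, bil C (x - z) (x - z) * p x
        else bil D ((∫ x, p x • x) - z) ((∫ x, p x • x) - z) := by
  rcases eq_or_ne j k with rfl | hjk
  · simpa only [if_true] using integral_mul_prod hp1 (fun x => bil C (x - z) (x - z)) j
  · simpa only [hjk, if_false] using integral_bil_mul_prod hp hp1 hp2 D z hjk

lemma sum_sum_ite_eq (c e : ℝ) : (∑ j : ι, ∑ k : ι, if j = k then c else e) =
    Fintype.card ι * c + Fintype.card ι * (Fintype.card ι - 1) * e := by
  have hsplit (j k : ι) : (if j = k then c else e) = (if j = k then c - e else 0) + e := by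
    split_ifs <;> ring
  simp only [hsplit, Finset.sum_add_distrib, Finset.sum_ite_eq, Finset.mem_univ, if_true,
    Finset.sum_const, Finset.card_univ, nsmul_eq_mul]
  ring

lemma integrable_sum_bil_mul_prod (hp : Integrable p) (hp2 : Integrable fun x => ‖x‖ ^ 2 * p x)
    (C D : Mat d) (z : E d) : Integrable fun ξ : ι → E d =>
      (∑ j, ∑ k, bil (if j = k then C else D) (ξ j - z) (ξ k - z)) * ∏ l, p (ξ l) := by
  simp only [Finset.sum_mul]
  exact integrable_finsetSum _ fun j _ => integrable_finsetSum _ fun k _ =>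
    integrable_bil_ite_mul_prod hp hp2 C D z j k

lemma integral_sum_bil_mul_prod (hp : Integrable p) (hp1 : ∫ x, p x = 1)
    (hp2 : Integrable fun x => ‖x‖ ^ 2 * p x) (C D : Mat d) (z : E d) :
    ∫ ξ : ι → E d,
        (∑ j, ∑ k, bil (if j = k then C else D) (ξ j - z) (ξ k - z)) * ∏ l, p (ξ l) =
      Fintype.card ι * (∫ x, bil C (x - z) (x - z) * p x) + Fintype.card ι *
        (Fintype.card ι - 1) * bil D ((∫ x, p x • x) - z) ((∫ x, p x • x) - z) := by
  have hint := integrable_bil_ite_mul_prod (ι := ι) hp hp2 C D z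
  simp only [Finset.sum_mul]
  rw [integral_finsetSum _ fun j _ => integrable_finsetSum _ fun k _ => hint j k,
    ← sum_sum_ite_eq]
  refine Finset.sum_congr rfl fun j _ => ?_
  rw [integral_finsetSum _ fun k _ => hint j k]
  exact Finset.sum_congr rfl fun k _ => integral_bil_ite_mul_prod hp hp1 hp2 C D z j k

end IndependentVectors

/-! ### Games with many players -/

section Game

variable {d N : ℕ} {G : LQGame d N} {Q B S : Mat d} {C D : Fin N → Mat d} {H Δ₀ μ : E d}
  {r k ℓ : ℝ} {v m : Fin N → E d → ℝ}

lemma card_ne (i : Fin N) : (Fintype.card {j : Fin N // j ≠ i} : ℝ) = N - 1 := by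
  rw [Fintype.card_subtype_compl, Fintype.card_subtype_eq, Fintype.card_fin, Nat.cast_pred i.pos]

lemma LQGame.cost_profile (h1 : G.H1) (h2 : G.H2 Q B C D H Δ₀) (i : Fin N) (x : E d)
    (ξ : {j : Fin N // j ≠ i} → E d) :
    G.cost i (LQGame.profile i x ξ) = bil Q (x - H) (x - H)
      + ∑ j, inner ℝ (app Bᵀ (x - H)) (ξ j - Δ₀)
      + ∑ j, ∑ k, bil (if j = k then C i else D i) (ξ j - Δ₀) (ξ k - Δ₀) := by
  have hown : LQGame.profile i x ξ i = x := by simp [LQGame.profile]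
  have hother (j : {j : Fin N // j ≠ i}) : LQGame.profile i x ξ j = ξ j := by
    simp [LQGame.profile, j.2]
  have hcross (j : {j : Fin N // j ≠ i}) : G.Q i i j = (1 / 2 : ℝ) • B := h2.Q_cross i j j.2
  have hcross' (j : {j : Fin N // j ≠ i}) : G.Q i j i = (1 / 2 : ℝ) • Bᵀ := by
    rw [← h1.Q_symm i i j, hcross, transpose_smul]
  have hblock (j k : {j : Fin N // j ≠ i}) : G.Q i j k = if j = k then C i else D i := by
    split_ifs with h
    · rw [← h, h2.Q_diag i j j.2]
    · exact h2.Q_other i j k j.2 k.2 fun hjk => h (Subtype.ext hjk)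
  have href (j : {j : Fin N // j ≠ i}) : G.ref i j = Δ₀ := h2.ref_other i j j.2
  have hpair (j : {j : Fin N // j ≠ i}) : bil ((1 / 2 : ℝ) • B) (x - H) (ξ j - Δ₀)
      + bil ((1 / 2 : ℝ) • Bᵀ) (ξ j - Δ₀) (x - H) = inner ℝ (app Bᵀ (x - H)) (ξ j - Δ₀) := by
    simp only [bil, app_smul_left, inner_smul_right]
    rw [← inner_app_transpose B, real_inner_comm (ξ j - Δ₀) (app Bᵀ (x - H))]
    ring
  simp only [LQGame.cost, Fintype.sum_eq_add_sum_subtype_ne _ i, hown, hother, h2.Q_own,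
    h2.ref_own, hcross, hcross', hblock, href]
  rw [Finset.sum_add_distrib, ← add_assoc, add_assoc (bil Q (x - H) (x - H)),
    ← Finset.sum_add_distrib, Finset.sum_congr rfl fun j _ => hpair j]

lemma LQGame.averagedCost_gaussianDensity (h1 : G.H1) (h2 : G.H2 Q B C D H Δ₀) (hS : S.PosDef)
    (hm : ∀ j, m j = gaussianDensity μ S) (i : Fin N) :
    G.averagedCost m i = quadCost Q (app (((N : ℝ) - 1) • B) (μ - Δ₀)) H
      (mfConst (((N : ℝ) - 1) • C i) ((((N : ℝ) - 1) * ((N : ℝ) - 2)) • D i) Δ₀ S μ) := by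
  funext x
  have hp := integrable_gaussianDensity hS μ
  have hp1 := integral_gaussianDensity hS μ
  have hp2 := integrable_norm_sq_mul_gaussianDensity hS μ
  have hint : Integrable fun ξ : {j : Fin N // j ≠ i} → E d => ∏ l, gaussianDensity μ S (ξ l) :=
    Integrable.fintype_prod (f := fun _ => gaussianDensity μ S) fun _ => hp
  have hconst := hint.const_mul (bil Q (x - H) (x - H))
  have hinner := integrable_sum_inner_mul_prod (ι := {j : Fin N // j ≠ i}) hp hp2
    (app Bᵀ (x - H)) Δ₀
  have hbil := integrable_sum_bil_mul_prod (ι := {j : Fin N // j ≠ i}) hp hp2 (C i) (D i) Δ₀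
  have htwo : (N : ℝ) - 1 - 1 = N - 2 := by ring
  simp only [LQGame.averagedCost, LQGame.cost_profile h1 h2, hm, add_mul]
  refine (integral_add (hconst.add hinner) hbil).trans ?_
  simp only [Pi.add_apply]
  rw [integral_add hconst hinner, integral_const_mul,
    integral_fintype_prod_volume_eq_pow, hp1, one_pow, mul_one,
    integral_sum_inner_mul_prod hp hp1 hp2, integral_sum_bil_mul_prod hp hp1 hp2, card_ne,
    integral_smul_gaussianDensity hS, inner_app_transpose, real_inner_comm, htwo]
  simp only [quadCost, mfConst, bil, app_smul_left, inner_smul_left, inner_smul_right,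
    conj_trivial, mul_assoc, integral_const_mul]

theorem LQGame.isSolution_and_isQGProfile_iff (hN : 1 ≤ N) (h1 : G.H1)
    (h2 : G.H2 Q B C D H Δ₀) (hr : r ≠ 0) (hk : 0 < k) (hℓ : 0 < ℓ) (hA : G.A.IsSymm)
    (hPd : (riccatiMatrix G.A r ℓ Q).PosDef) (hS : S.PosDef)
    (hP : S * S + ℓ • S = riccatiMatrix G.A r ℓ Q) :
    (G.IsSolution r k ℓ v m ∧ IsQGProfile v m) ↔
      ∃ μ, app (r • riccatiMatrix G.A r ℓ Q + ((N : ℝ) - 1) • B) μ =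
          (2 : ℝ) • app Q H + app (((N : ℝ) - 1) • B) Δ₀ ∧
        ∀ i, v i = mfValue G.A r k ℓ Q (((N : ℝ) - 1) • B) (((N : ℝ) - 1) • C i)
            ((((N : ℝ) - 1) * ((N : ℝ) - 2)) • D i) S H Δ₀ μ ∧
          m i = gaussianDensity μ (k⁻¹ • S) := by
  have hkS : (k⁻¹ • S).PosDef := hS.smul (inv_pos.2 hk)
  have hQ := isSymm_of_posDef h2.Q_posDef
  simp only [app_smul_add_eq_iff, LQGame.IsSolution]
  constructor
  · rintro ⟨hsol, L, S₀, μ, ρ, c, -, hS₀, hvm⟩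
    obtain ⟨a, ha⟩ := exists_app_eq hPd.isUnit
      (r⁻¹ • ((2 : ℝ) • app Q H - app (((N : ℝ) - 1) • B) (μ - Δ₀)))
    rw [eq_inv_smul_iff₀ hr] at ha
    have hm (i : Fin N) : m i = gaussianDensity a (k⁻¹ • S) := by
      have hi := hsol i
      rw [averagedCost_gaussianDensity h1 h2 hS₀ (fun j => (hvm j).2)] at hi
      exact ((solvesHJBKFP_quadCost_iff hr hk hℓ hA hQ hS hP ha).1 hi).2
    obtain rfl : μ = a :=
      eq_of_gaussianDensity_eq hS₀ hkS ((hvm ⟨0, hN⟩).2.symm.trans (hm ⟨0, hN⟩))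
    refine ⟨μ, ha, fun i => ?_⟩
    have hi := hsol i
    rw [averagedCost_gaussianDensity h1 h2 hkS hm] at hi
    exact (solvesHJBKFP_quadCost_iff hr hk hℓ hA hQ hS hP ha).1 hi
  · rintro ⟨μ, hμ, hvm⟩
    refine ⟨fun i => ?_, r • (S + G.A), k⁻¹ • S, μ, _, _, ((isSymm_of_posDef hS).add hA).smul r,
      hkS, hvm⟩
    rw [averagedCost_gaussianDensity h1 h2 hkS fun j => (hvm j).2]
    exact (solvesHJBKFP_quadCost_iff hr hk hℓ hA hQ hS hP hμ).2 (hvm i)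

end Game

/-! ### Continuous dependence on the coefficients -/

section Coefficients

variable {d : ℕ} {ι : Type*} {F : Filter ι} {M : ι → Mat d} {M₀ : Mat d} {x y : ι → E d}
  {x₀ y₀ : E d}

lemma continuous_toEuclideanCLM :
    Continuous fun M : Mat d => Matrix.toEuclideanCLM (n := Fin d) (𝕜 := ℝ) M :=
  (Matrix.toEuclideanCLM (n := Fin d)
    (𝕜 := ℝ)).toAlgEquiv.toLinearMap.continuous_of_finiteDimensional

lemma tendsto_app (hM : Tendsto M F (𝓝 M₀)) (hx : Tendsto x F (𝓝 x₀)) :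
    Tendsto (fun n => app (M n) (x n)) F (𝓝 (app M₀ x₀)) :=
  ((continuous_toEuclideanCLM.fst'.clm_apply continuous_snd).tendsto (M₀, x₀)).comp
    (hM.prodMk_nhds hx)

lemma tendsto_bil (hM : Tendsto M F (𝓝 M₀)) (hx : Tendsto x F (𝓝 x₀))
    (hy : Tendsto y F (𝓝 y₀)) :
    Tendsto (fun n => bil (M n) (x n) (y n)) F (𝓝 (bil M₀ x₀ y₀)) :=
  hx.inner (tendsto_app hM hy)

lemma eventually_norm_app_sub_le (hM : Tendsto M F (𝓝 M₀)) {ε : ℝ} (hε : 0 < ε) :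
    ∀ᶠ n in F, ∀ x, ‖app (M n) x - app M₀ x‖ ≤ ε * ‖x‖ := by
  have hlim := (continuous_toEuclideanCLM.tendsto M₀).comp hM
  filter_upwards [Metric.tendsto_nhds.1 hlim ε hε] with n hn x
  rw [Function.comp_apply, dist_eq_norm] at hn
  exact (ContinuousLinearMap.le_opNorm (Matrix.toEuclideanCLM (n := Fin d) (𝕜 := ℝ) (M n) -
    Matrix.toEuclideanCLM (n := Fin d) (𝕜 := ℝ) M₀) x).trans
    (mul_le_mul_of_nonneg_right hn.le (norm_nonneg x))

lemma exists_eventually_norm_app_le (hM : Tendsto M F (𝓝 M₀)) :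
    ∃ K : ℝ, 0 ≤ K ∧ ∀ᶠ n in F, ∀ x, ‖app (M n) x‖ ≤ K * ‖x‖ := by
  have hlim := ((continuous_toEuclideanCLM.tendsto M₀).comp hM).norm
  refine ⟨‖Matrix.toEuclideanCLM (n := Fin d) (𝕜 := ℝ) M₀‖ + 1, by positivity, ?_⟩
  filter_upwards [hlim.eventually_le_const (lt_add_one _)] with n hn x
  exact (Matrix.toEuclideanCLM (n := Fin d) (𝕜 := ℝ) (M n)).le_of_opNorm_le hn x

lemma exists_eventually_mul_norm_sq_le_bil (hM : Tendsto M F (𝓝 M₀)) (h₀ : M₀.PosDef) :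
    ∃ ε : ℝ, 0 < ε ∧ ∀ᶠ n in F, ∀ x, ε * ‖x‖ ^ 2 ≤ bil (M n) x x := by
  obtain ⟨ε, hε, hcoercive⟩ := exists_pos_forall_mul_norm_sq_le_bil h₀
  refine ⟨ε / 2, half_pos hε, ?_⟩
  filter_upwards [eventually_norm_app_sub_le hM (half_pos hε)] with n hn x
  have hdiff : |bil (M n) x x - bil M₀ x x| ≤ ‖x‖ * (ε / 2 * ‖x‖) := by
    rw [bil, bil, ← inner_sub_right]
    exact (abs_real_inner_le_norm _ _).trans (mul_le_mul_of_nonneg_left (hn x) (norm_nonneg x))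
  linarith [hcoercive x, (abs_le.1 hdiff).1]

lemma eventually_posDef (hM : Tendsto M F (𝓝 M₀)) (h₀ : M₀.PosDef)
    (hs : ∀ᶠ n in F, (M n).IsSymm) : ∀ᶠ n in F, (M n).PosDef := by
  obtain ⟨ε, hε, hcoercive⟩ := exists_eventually_mul_norm_sq_le_bil hM h₀
  filter_upwards [hcoercive, hs] with n hn hsn
  refine posDef_of_bil_pos hsn fun x hx => lt_of_lt_of_le ?_ (hn x)
  have := norm_pos_iff.2 hx
  positivity

lemma exists_tendsto_app_eq (hM : Tendsto M F (𝓝 M₀)) (h₀ : IsUnit M₀)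
    (hy : Tendsto y F (𝓝 y₀)) (hx₀ : app M₀ x₀ = y₀) :
    ∃ x : ι → E d, Tendsto x F (𝓝 x₀) ∧ ∀ᶠ n in F, ∀ z, app (M n) z = y n ↔ z = x n := by
  simp only [Matrix.isUnit_iff_isUnit_det] at h₀
  have hdet := (continuous_id.matrix_det.tendsto M₀).comp hM
  have hinv : Tendsto (fun n => (M n)⁻¹) F (𝓝 M₀⁻¹) := by
    simp only [Matrix.inv_def, Ring.inverse_eq_inv']
    exact (hdet.inv₀ h₀.ne_zero).smul ((continuous_id.matrix_adjugate.tendsto M₀).comp hM)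
  have hx₀' : app M₀⁻¹ y₀ = x₀ := by
    rw [← hx₀, ← app_mul, Matrix.nonsing_inv_mul _ h₀, app_one]
  refine ⟨fun n => app (M n)⁻¹ (y n), hx₀' ▸ tendsto_app hinv hy, ?_⟩
  filter_upwards [hdet.eventually_ne h₀.ne_zero] with n hn z
  have hunit : IsUnit (M n).det := hn.isUnit
  constructor
  · rintro hz
    rw [← hz, ← app_mul, Matrix.nonsing_inv_mul _ hunit, app_one]
  · rintro rfl
    rw [← app_mul, Matrix.mul_nonsing_inv _ hunit, app_one]

lemma tendsto_riccatiMatrix (A : Mat d) (r ℓ : ℝ) (hM : Tendsto M F (𝓝 M₀)) :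
    Tendsto (fun n => riccatiMatrix A r ℓ (M n)) F (𝓝 (riccatiMatrix A r ℓ M₀)) :=
  tendsto_const_nhds.add (hM.const_smul _)

lemma tendsto_of_tendsto_sum_sq_sub
    (h : Tendsto (fun n => ∑ i, ∑ j, (M n i j - M₀ i j) ^ 2) F (𝓝 0)) : Tendsto M F (𝓝 M₀) := by
  refine tendsto_pi_nhds.2 fun i => tendsto_pi_nhds.2 fun j => ?_
  have hle (n : ι) : (M n i j - M₀ i j) ^ 2 ≤ ∑ i, ∑ j, (M n i j - M₀ i j) ^ 2 :=
    (Finset.single_le_sum (fun j _ => sq_nonneg (M n i j - M₀ i j)) (Finset.mem_univ j)).trans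
      (Finset.single_le_sum (f := fun i => ∑ j, (M n i j - M₀ i j) ^ 2)
        (fun i _ => Finset.sum_nonneg fun j _ => sq_nonneg _) (Finset.mem_univ i))
  have habs := (squeeze_zero (fun n => sq_nonneg _) hle h).sqrt
  simp only [Real.sqrt_sq_eq_abs, Real.sqrt_zero] at habs
  exact tendsto_iff_dist_tendsto_zero.2 habs

lemma tendsto_sum_sq_sub (hM : Tendsto M F (𝓝 M₀)) :
    Tendsto (fun n => ∑ i, ∑ j, (M n i j - M₀ i j) ^ 2) F (𝓝 0) := by
  have hentry (i j : Fin d) : Tendsto (fun n => (M n i j - M₀ i j) ^ 2) F (𝓝 0) := by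
    simpa using (((tendsto_pi_nhds.1 (tendsto_pi_nhds.1 hM i)) j).sub_const (M₀ i j)).pow 2
  simpa using tendsto_finsetSum Finset.univ fun i _ =>
    tendsto_finsetSum Finset.univ fun j _ => hentry i j

lemma tendsto_of_mul_self_add_smul {S : ι → Mat d} {S₀ : Mat d} {ℓ : ℝ} (hℓ : 0 < ℓ)
    (hM : Tendsto M F (𝓝 M₀)) (h₀ : S₀.PosDef) (hSM₀ : S₀ * S₀ + ℓ • S₀ = M₀)
    (hS : ∀ᶠ n in F, (S n).PosDef ∧ S n * S n + ℓ • S n = M n) : Tendsto S F (𝓝 S₀) := by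
  refine tendsto_of_tendsto_sum_sq_sub ?_
  have hlim := (tendsto_sum_sq_sub hM).div_const (ℓ ^ 2)
  rw [zero_div] at hlim
  refine tendsto_of_tendsto_of_tendsto_of_le_of_le' tendsto_const_nhds hlim
    (Eventually.of_forall fun n =>
      Finset.sum_nonneg fun i _ => Finset.sum_nonneg fun j _ => sq_nonneg _) ?_
  filter_upwards [hS] with n hn
  rw [le_div_iff₀' (pow_pos hℓ 2)]
  exact sq_mul_sum_sq_sub_le hℓ.le h₀ hn.1 hSM₀ hn.2

lemma exists_tendsto_mul_self_add_smul_eq [F.NeBot] {S₀ : Mat d} {ℓ : ℝ} (hℓ : 0 < ℓ)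
    (hM : Tendsto M F (𝓝 M₀)) (hMd : ∀ᶠ n in F, (M n).PosDef) (h₀ : S₀.PosDef)
    (hSM₀ : S₀ * S₀ + ℓ • S₀ = M₀) :
    ∃ S : ι → Mat d, Tendsto S F (𝓝 S₀) ∧
      ∀ᶠ n in F, (S n).PosDef ∧ S n * S n + ℓ • S n = M n := by
  obtain ⟨S, hS⟩ := (hMd.mono fun n hn => exists_posDef_mul_self_add_smul_eq hn ℓ).choice
  exact ⟨S, tendsto_of_mul_self_add_smul hℓ hM h₀ hSM₀ hS, hS⟩

lemma tendsto_valueConst (A : Mat d) (r k ℓ : ℝ) (H : E d) {Q S : ι → Mat d} {Q₀ S₀ : Mat d}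
    {a w : ι → E d} {a₀ w₀ : E d} {κ : ι → ℝ} {κ₀ : ℝ} (hQ : Tendsto Q F (𝓝 Q₀))
    (hS : Tendsto S F (𝓝 S₀)) (ha : Tendsto a F (𝓝 a₀)) (hw : Tendsto w F (𝓝 w₀))
    (hκ : Tendsto κ F (𝓝 κ₀)) :
    Tendsto (fun n => valueConst A r k ℓ (Q n) (S n) (a n) (w n) H (κ n)) F
      (𝓝 (valueConst A r k ℓ Q₀ S₀ a₀ w₀ H κ₀)) := by
  have htrace : Tendsto (fun n => (S n + A).trace) F (𝓝 (S₀ + A).trace) :=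
    ((continuous_id.matrix_trace).tendsto _).comp (hS.add_const A)
  exact ((((hκ.add (tendsto_bil hQ tendsto_const_nhds tendsto_const_nhds)).sub
    (hw.inner tendsto_const_nhds)).add (htrace.const_mul _)).sub
    (((tendsto_app hS ha).norm.pow 2).const_mul _)).div_const _

end Coefficients

section GaussianFamilies

variable {d : ℕ} {ι : Type*} {F : Filter ι} {S : ι → Mat d} {S₀ : Mat d} {μ : ι → E d} {μ₀ : E d}

lemma tendsto_sqrt_det_div (hS : Tendsto S F (𝓝 S₀)) (c : ℝ) :
    Tendsto (fun n => √((S n).det / c)) F (𝓝 √(S₀.det / c)) :=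
  (((continuous_id.matrix_det.tendsto S₀).comp hS).div_const c).sqrt

lemma tendsto_gaussianDensity (hS : Tendsto S F (𝓝 S₀)) (hμ : Tendsto μ F (𝓝 μ₀)) (x : E d) :
    Tendsto (fun n => gaussianDensity (μ n) (S n) x) F (𝓝 (gaussianDensity μ₀ S₀ x)) :=
  (tendsto_sqrt_det_div hS _).mul (((tendsto_bil hS (hμ.const_sub x)
    (hμ.const_sub x)).div_const 2).neg.rexp)

lemma exists_eventually_gaussianDensity_le (hS : Tendsto S F (𝓝 S₀)) (h₀ : S₀.PosDef)
    (hμ : Tendsto μ F (𝓝 μ₀)) : ∃ K b : ℝ, 0 < b ∧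
      ∀ᶠ n in F, ∀ x, gaussianDensity (μ n) (S n) x ≤ K * Real.exp (-b * ‖x‖ ^ 2) := by
  obtain ⟨ε, hε, hcoercive⟩ := exists_eventually_mul_norm_sq_le_bil hS h₀
  refine ⟨(√(S₀.det / (2 * Real.pi) ^ d) + 1) * Real.exp (ε / 2 * (‖μ₀‖ + 1) ^ 2), ε / 4,
    by positivity, ?_⟩
  filter_upwards [hcoercive, (tendsto_sqrt_det_div hS _).eventually_le_const (lt_add_one _),
    hμ.norm.eventually_le_const (lt_add_one _)] with n hcn hsn hμn x
  rw [mul_assoc]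
  exact mul_le_mul hsn (exp_neg_bil_le hε.le hcn hμn x) (by positivity) (by positivity)

lemma tendsto_integral_bil_mul_gaussianDensity [F.IsCountablyGenerated] {C : ι → Mat d}
    {C₀ : Mat d} (hC : Tendsto C F (𝓝 C₀)) (hS : Tendsto S F (𝓝 S₀)) (h₀ : S₀.PosDef)
    (hμ : Tendsto μ F (𝓝 μ₀)) (z : E d) :
    Tendsto (fun n => ∫ x, bil (C n) (x - z) (x - z) * gaussianDensity (μ n) (S n) x) F
      (𝓝 (∫ x, bil C₀ (x - z) (x - z) * gaussianDensity μ₀ S₀ x)) := by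
  obtain ⟨K, b, hb, hdensity⟩ := exists_eventually_gaussianDensity_le hS h₀ hμ
  obtain ⟨T, hT, happ⟩ := exists_eventually_norm_app_le hC
  refine tendsto_integral_filter_of_dominated_convergence
    (fun x => T * (2 * ‖x‖ ^ 2 + 2 * ‖z‖ ^ 2) * (K * Real.exp (-b * ‖x‖ ^ 2))) ?_ ?_ ?_ ?_
  · refine Eventually.of_forall fun n => Continuous.aestronglyMeasurable ?_
    exact (contDiff_bil_sub (C n) z (n := 0)).continuous.mul (continuous_gaussianDensity _ _)
  · filter_upwards [hdensity, happ] with n hdn han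
    refine Eventually.of_forall fun x => ?_
    have hsq : ‖x - z‖ ^ 2 ≤ 2 * ‖x‖ ^ 2 + 2 * ‖z‖ ^ 2 := by
      nlinarith [norm_sub_le x z, norm_nonneg (x - z), sq_nonneg (‖x‖ - ‖z‖)]
    have hbil : |bil (C n) (x - z) (x - z)| ≤ T * (2 * ‖x‖ ^ 2 + 2 * ‖z‖ ^ 2) :=
      calc |bil (C n) (x - z) (x - z)| ≤ ‖x - z‖ * ‖app (C n) (x - z)‖ :=
            abs_real_inner_le_norm _ _
        _ ≤ ‖x - z‖ * (T * ‖x - z‖) := by gcongr; exact han _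
        _ = T * ‖x - z‖ ^ 2 := by ring
        _ ≤ T * (2 * ‖x‖ ^ 2 + 2 * ‖z‖ ^ 2) := by gcongr
    have hnonneg : 0 ≤ gaussianDensity (μ n) (S n) x := by unfold gaussianDensity; positivity
    rw [norm_mul, Real.norm_eq_abs, Real.norm_of_nonneg hnonneg]
    exact mul_le_mul hbil (hdn x) hnonneg (by positivity)
  · refine (((integrable_norm_sq_mul_exp hb).const_mul (2 * T * K)).add
      ((integrable_exp_neg_mul_norm_sq hb).const_mul (2 * T * K * ‖z‖ ^ 2))).congr
      (Eventually.of_forall fun x => ?_)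
    simp only [Pi.add_apply]
    ring
  · exact Eventually.of_forall fun x =>
      (tendsto_bil hC tendsto_const_nhds tendsto_const_nhds).mul (tendsto_gaussianDensity hS hμ x)

lemma tendsto_mfConst [F.IsCountablyGenerated] {C D : ι → Mat d} {C₀ D₀ : Mat d}
    (hC : Tendsto C F (𝓝 C₀)) (hD : Tendsto D F (𝓝 D₀)) (hS : Tendsto S F (𝓝 S₀))
    (h₀ : S₀.PosDef) (hμ : Tendsto μ F (𝓝 μ₀)) (z : E d) :
    Tendsto (fun n => mfConst (C n) (D n) z (S n) (μ n)) F (𝓝 (mfConst C₀ D₀ z S₀ μ₀)) :=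
  (tendsto_integral_bil_mul_gaussianDensity hC hS h₀ hμ z).add
    (tendsto_bil hD (hμ.sub_const z) (hμ.sub_const z))

end GaussianFamilies

/-! ### Convergence of the derivatives -/

lemma tendstoUniformly_of_tendstoLocallyUniformly {ι V W : Type*} [NormedAddCommGroup V]
    [ProperSpace V] [NormedAddCommGroup W] {F : Filter ι} {g : ι → V → W} {g₀ : V → W}
    (hg : TendstoLocallyUniformly g g₀ F)
    (htail : ∀ δ > 0, ∃ R, ∀ᶠ n in F, ∀ x, R < ‖x‖ → ‖g n x‖ < δ)
    (htail₀ : ∀ δ > 0, ∃ R, ∀ x, R < ‖x‖ → ‖g₀ x‖ < δ) : TendstoUniformly g g₀ F := by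
  rw [Metric.tendstoUniformly_iff]
  intro δ hδ
  obtain ⟨R, hR⟩ := htail (δ / 2) (half_pos hδ)
  obtain ⟨R₀, hR₀⟩ := htail₀ (δ / 2) (half_pos hδ)
  have hball := Metric.tendstoUniformlyOn_iff.1 (tendstoLocallyUniformly_iff_forall_isCompact.1 hg
    _ (isCompact_closedBall (0 : V) (max R R₀))) δ hδ
  filter_upwards [hR, hball] with n hRn hn x
  rcases le_or_gt ‖x‖ (max R R₀) with hx | hx
  · exact hn x (mem_closedBall_zero_iff.2 hx)
  · rw [max_lt_iff] at hx
    rw [dist_eq_norm]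
    linarith [norm_sub_le (g₀ x) (g n x), hRn x hx.1, hR₀ x hx.2]

section ParametricFamilies

variable {ι P V W : Type*} [NormedAddCommGroup P] [NormedSpace ℝ P] [NormedAddCommGroup V]
  [NormedSpace ℝ V] [NormedAddCommGroup W] [NormedSpace ℝ W] {F : Filter ι} {f : P × V → W}

lemma iteratedFDeriv_comp_prodMk {j : ℕ} (hf : ContDiff ℝ j f) (p : P) (x : V) :
    iteratedFDeriv ℝ j (fun x => f (p, x)) x =
      (iteratedFDeriv ℝ j f (p, x)).compContinuousLinearMap
        fun _ => ContinuousLinearMap.inr ℝ P V := by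
  have hcomp : (fun x => f (p, x)) =
      (fun y => f ((p, 0) + y)) ∘ ContinuousLinearMap.inr ℝ P V := by
    funext x
    simp
  have hshift : ContDiff ℝ j fun y => f ((p, 0) + y) := hf.comp (contDiff_const.add contDiff_id)
  rw [hcomp, ContinuousLinearMap.iteratedFDeriv_comp_right _ hshift x le_rfl,
    iteratedFDeriv_comp_add_left]
  simp

/-- Joint continuity of the derivatives makes them a continuous function of the parameter for the
compact-open topology. -/
lemma tendstoLocallyUniformly_iteratedFDeriv [LocallyCompactSpace V] {j : ℕ}
    (hf : ContDiff ℝ j f) {p : ι → P} {p₀ : P} (hp : Tendsto p F (𝓝 p₀)) :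
    TendstoLocallyUniformly (fun n => iteratedFDeriv ℝ j fun x => f (p n, x))
      (iteratedFDeriv ℝ j fun x => f (p₀, x)) F := by
  have hcont : Continuous fun z : P × V => iteratedFDeriv ℝ j (fun x => f (z.1, x)) z.2 := by
    simp only [iteratedFDeriv_comp_prodMk hf]
    exact (ContinuousMultilinearMap.compContinuousLinearMapL (𝕜 := ℝ) (F := W)
      fun _ : Fin j => ContinuousLinearMap.inr ℝ P V).continuous.comp
      (hf.continuous_iteratedFDeriv le_rfl)
  exact ContinuousMap.tendsto_iff_tendstoLocallyUniformly.1
    (((ContinuousMap.curry ⟨_, hcont⟩).continuous.tendsto p₀).comp hp)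

end ParametricFamilies

section Quadratics

variable {d : ℕ} {L : Mat d}

lemma fderiv_quadratic (hL : L.IsSymm) (ρ : E d) (c : ℝ) :
    fderiv ℝ (quadratic L ρ c) = fun x =>
      (innerSL ℝ : E d →L[ℝ] E d →L[ℝ] ℝ).comp (Matrix.toEuclideanCLM (n := Fin d) (𝕜 := ℝ) L) x
        + innerSL ℝ ρ := by
  funext x
  refine (hasGradientAt_quadratic hL ρ c x).hasFDerivAt.fderiv.trans ?_
  ext y
  simp only [InnerProductSpace.toDual_apply_apply, inner_add_left]
  rfl

lemma fderiv_fderiv_quadratic (hL : L.IsSymm) (ρ : E d) (c : ℝ) :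
    fderiv ℝ (fderiv ℝ (quadratic L ρ c)) = fun _ =>
      (innerSL ℝ : E d →L[ℝ] E d →L[ℝ] ℝ).comp
        (Matrix.toEuclideanCLM (n := Fin d) (𝕜 := ℝ) L) := by
  funext x
  rw [fderiv_quadratic hL]
  exact ((ContinuousLinearMap.hasFDerivAt _).add_const _).fderiv

lemma iteratedFDeriv_two_quadratic_eq (hL : L.IsSymm) (ρ : E d) (c : ℝ) (x y : E d) :
    iteratedFDeriv ℝ 2 (quadratic L ρ c) x = iteratedFDeriv ℝ 2 (quadratic L ρ c) y := by
  ext u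
  rw [iteratedFDeriv_two_apply, iteratedFDeriv_two_apply, fderiv_fderiv_quadratic hL]

lemma norm_iteratedFDeriv_quadratic_le (hL : L.IsSymm) {ρ : E d} (c : ℝ) {K : ℝ}
    (hLK : ∀ x, ‖app L x‖ ≤ K * ‖x‖) (hρ : ‖ρ‖ ≤ K) {i : ℕ} (hi : i ≠ 0) (x : E d) :
    ‖iteratedFDeriv ℝ i (quadratic L ρ c) x‖ ≤ (1 + K + K * ‖x‖) ^ i := by
  have hK : 0 ≤ K := (norm_nonneg _).trans hρ
  have hKx : 0 ≤ K * ‖x‖ := mul_nonneg hK (norm_nonneg x)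
  have hone : 1 ≤ 1 + K + K * ‖x‖ := by linarith
  refine le_trans ?_ (le_self_pow₀ hone hi)
  match i, hi with
  | 1, _ =>
    rw [← zero_add 1, ← norm_iteratedFDeriv_fderiv, norm_iteratedFDeriv_zero, fderiv_quadratic hL]
    change ‖innerSL ℝ (app L x) + innerSL ℝ ρ‖ ≤ _
    rw [← map_add, innerSL_apply_norm]
    linarith [norm_add_le (app L x) ρ, hLK x]
  | 2, _ =>
    rw [← one_add_one_eq_two, ← norm_iteratedFDeriv_fderiv, ← zero_add 1,
      ← norm_iteratedFDeriv_fderiv, norm_iteratedFDeriv_zero, fderiv_fderiv_quadratic hL]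
    refine (ContinuousLinearMap.opNorm_le_bound _ hK fun y => ?_).trans (by linarith)
    rw [ContinuousLinearMap.comp_apply, innerSL_apply_norm]
    exact hLK y
  | i + 3, _ =>
    rw [← norm_iteratedFDeriv_fderiv, ← norm_iteratedFDeriv_fderiv, fderiv_fderiv_quadratic hL,
      iteratedFDeriv_succ_const, Pi.zero_apply, norm_zero]
    linarith

variable {ι : Type*} {F : Filter ι} {M : ι → Mat d} {ρ : ι → E d} {ρ₀ : E d} {c : ι → ℝ} {c₀ : ℝ}

lemma tendstoLocallyUniformly_iteratedFDeriv_quadratic (hM : Tendsto M F (𝓝 L))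
    (hρ : Tendsto ρ F (𝓝 ρ₀)) (hc : Tendsto c F (𝓝 c₀)) (j : ℕ) :
    TendstoLocallyUniformly (fun n => iteratedFDeriv ℝ j (quadratic (M n) (ρ n) (c n)))
      (iteratedFDeriv ℝ j (quadratic L ρ₀ c₀)) F := by
  have hf : ContDiff ℝ j fun z : ((E d →L[ℝ] E d) × E d × ℝ) × E d =>
      inner ℝ z.2 (z.1.1 z.2) / 2 + inner ℝ z.1.2.1 z.2 + z.1.2.2 := by
    refine .add (.add (.div_const (.inner ℝ contDiff_snd (.clm_apply ?_ contDiff_snd)) 2)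
      (.inner ℝ ?_ contDiff_snd)) ?_ <;> fun_prop
  have hp := ((continuous_toEuclideanCLM.tendsto L).comp hM).prodMk_nhds (hρ.prodMk_nhds hc)
  have hlim := tendstoLocallyUniformly_iteratedFDeriv hf hp
  simp only [Function.comp_apply] at hlim
  exact hlim

/-- The second derivatives are constant, so that they converge uniformly once they converge at the
origin. -/
lemma tendstoUniformly_iteratedFDeriv_two_quadratic (hM : Tendsto M F (𝓝 L))
    (hρ : Tendsto ρ F (𝓝 ρ₀)) (hc : Tendsto c F (𝓝 c₀)) (hMs : ∀ᶠ n in F, (M n).IsSymm)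
    (hL : L.IsSymm) :
    TendstoUniformly (fun n => iteratedFDeriv ℝ 2 (quadratic (M n) (ρ n) (c n)))
      (iteratedFDeriv ℝ 2 (quadratic L ρ₀ c₀)) F := by
  rw [Metric.tendstoUniformly_iff]
  intro ε hε
  obtain ⟨t, ht, h⟩ := Metric.tendstoLocallyUniformly_iff.1
    (tendstoLocallyUniformly_iteratedFDeriv_quadratic hM hρ hc 2) ε hε 0
  filter_upwards [h, hMs] with n hn hMn x
  rw [iteratedFDeriv_two_quadratic_eq hMn _ _ x 0, iteratedFDeriv_two_quadratic_eq hL _ _ x 0]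
  exact hn 0 (mem_of_mem_nhds ht)

end Quadratics

section Gaussians

variable {d : ℕ} {ι : Type*} {F : Filter ι} {S : ι → Mat d} {μ : ι → E d} {μ₀ : E d} {T : Mat d}

lemma tendstoLocallyUniformly_iteratedFDeriv_gaussianDensity (hS : Tendsto S F (𝓝 T))
    (hμ : Tendsto μ F (𝓝 μ₀)) (j : ℕ) :
    TendstoLocallyUniformly (fun n => iteratedFDeriv ℝ j (gaussianDensity (μ n) (S n)))
      (iteratedFDeriv ℝ j (gaussianDensity μ₀ T)) F := by
  have hf : ContDiff ℝ j fun z : ((E d →L[ℝ] E d) × E d × ℝ) × E d =>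
      z.1.2.2 * Real.exp (-(inner ℝ (z.2 - z.1.2.1) (z.1.1 (z.2 - z.1.2.1)) / 2)) := by
    refine .mul (by fun_prop) (.exp (.neg (.div_const (.inner ℝ ?_ (.clm_apply ?_ ?_)) 2))) <;>
      fun_prop
  exact tendstoLocallyUniformly_iteratedFDeriv hf
    (((continuous_toEuclideanCLM.tendsto T).comp hS).prodMk_nhds
      (hμ.prodMk_nhds (tendsto_sqrt_det_div hS _)))

lemma neg_bil_sub_div_two (hT : T.IsSymm) (ν x : E d) :
    -(bil T (x - ν) (x - ν) / 2) = quadratic (-T) (app T ν) (-(bil T ν ν / 2)) x := by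
  have hneg : app (-T) x = -app T x := by
    rw [← neg_one_smul ℝ T, app_smul_left, neg_one_smul]
  simp only [quadratic, bil, hneg, app_sub_right, inner_sub_left, inner_sub_right,
    inner_neg_right, inner_app_of_isSymm hT, ← real_inner_comm x (app T ν)]
  ring

lemma norm_iteratedFDeriv_gaussianDensity_le (hT : T.IsSymm) {ε : ℝ} (hε : 0 ≤ ε)
    (hcoercive : ∀ x : E d, ε * ‖x‖ ^ 2 ≤ bil T x x) {ν : E d} {K : ℝ}
    (hdet : √(T.det / (2 * Real.pi) ^ d) ≤ K) (hTK : ∀ x, ‖app T x‖ ≤ K * ‖x‖) (hν : ‖ν‖ ≤ K)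
    (hTν : ‖app T ν‖ ≤ K) (j : ℕ) (x : E d) :
    ‖iteratedFDeriv ℝ j (gaussianDensity ν T) x‖ ≤ K * (j.factorial *
      (Real.exp (ε / 2 * K ^ 2) * Real.exp (-(ε / 4) * ‖x‖ ^ 2)) * (1 + K + K * ‖x‖) ^ j) := by
  set q := quadratic (-T) (app T ν) (-(bil T ν ν / 2))
  have hq (y : E d) : -(bil T (y - ν) (y - ν) / 2) = q y := neg_bil_sub_div_two hT ν y
  have hdensity : gaussianDensity ν T = √(T.det / (2 * Real.pi) ^ d) • (Real.exp ∘ q) := by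
    funext y
    simp only [gaussianDensity, hq, Pi.smul_apply, Function.comp_apply, smul_eq_mul]
  have hqK {i : ℕ} (hi : 1 ≤ i) : ‖iteratedFDeriv ℝ i q x‖ ≤ (1 + K + K * ‖x‖) ^ i := by
    refine norm_iteratedFDeriv_quadratic_le hT.neg _ (fun y => ?_) hTν (by lia) x
    rw [← neg_one_smul ℝ T, app_smul_left, neg_one_smul, norm_neg]
    exact hTK y
  have hqc : ContDiff ℝ j q := contDiff_quadratic _ _ _
  rw [hdensity, iteratedFDeriv_const_smul_apply (Real.contDiff_exp.comp hqc).contDiffAt, norm_smul,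
    Real.norm_of_nonneg (Real.sqrt_nonneg _)]
  refine mul_le_mul hdet ?_ (norm_nonneg _) ((Real.sqrt_nonneg _).trans hdet)
  refine norm_iteratedFDeriv_comp_le Real.contDiff_exp hqc le_rfl x (fun i _ => ?_)
    fun i hi _ => hqK hi
  rw [norm_iteratedFDeriv_eq_norm_iteratedDeriv, iteratedDeriv_eq_iterate, Real.iter_deriv_exp,
    Real.norm_eq_abs, Real.abs_exp, ← hq]
  exact exp_neg_bil_le hε hcoercive hν x

lemma tendsto_pow_mul_exp_neg_mul_sq {c : ℝ} (hc : 0 < c) {a b : ℝ} (ha : 0 ≤ a) (hb : 0 ≤ b)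
    (j : ℕ) : Tendsto (fun t : ℝ => (a + b * t) ^ j * Real.exp (-c * t ^ 2)) atTop (𝓝 0) := by
  have hsq (t : ℝ) : -c * t ^ 2 ≤ 1 / (4 * c) - t := by
    have hcompl : 1 / (4 * c) - t + c * t ^ 2 = (2 * c * t - 1) ^ 2 / (4 * c) := by
      field_simp
      ring
    linarith [show 0 ≤ (2 * c * t - 1) ^ 2 / (4 * c) by positivity]
  have hlim := (Polynomial.tendsto_div_exp_atTop
    ((Polynomial.C a + Polynomial.C b * Polynomial.X) ^ j)).mul_const (Real.exp (1 / (4 * c)))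
  simp only [zero_mul, Polynomial.eval_pow, Polynomial.eval_add, Polynomial.eval_mul,
    Polynomial.eval_C, Polynomial.eval_X] at hlim
  refine squeeze_zero' ?_ ?_ hlim
  · filter_upwards [eventually_ge_atTop 0] with t ht
    positivity
  · filter_upwards [eventually_ge_atTop 0] with t ht
    rw [div_mul_eq_mul_div, mul_div_assoc, ← Real.exp_sub]
    gcongr
    exact hsq t

lemma exists_eventually_norm_iteratedFDeriv_gaussianDensity_lt (hS : Tendsto S F (𝓝 T))
    (hμ : Tendsto μ F (𝓝 μ₀)) (hT : T.PosDef) (hSs : ∀ᶠ n in F, (S n).IsSymm) (j : ℕ) {δ : ℝ}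
    (hδ : 0 < δ) : ∃ R, ∀ᶠ n in F, ∀ x, R < ‖x‖ →
      ‖iteratedFDeriv ℝ j (gaussianDensity (μ n) (S n)) x‖ < δ := by
  obtain ⟨ε, hε, hcoercive⟩ := exists_eventually_mul_norm_sq_le_bil hS hT
  obtain ⟨K₁, hK₁, happ⟩ := exists_eventually_norm_app_le hS
  have hsize := (((tendsto_sqrt_det_div hS ((2 * Real.pi) ^ d)).add hμ.norm).add
    (tendsto_app hS hμ).norm).eventually_le_const (lt_add_one _)
  set K := K₁ + (√(T.det / (2 * Real.pi) ^ d) + ‖μ₀‖ + ‖app T μ₀‖ + 1)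
  have hK₁K : K₁ ≤ K := le_add_of_nonneg_right (by positivity)
  have hK : 0 ≤ K := hK₁.trans hK₁K
  have hdecay := (tendsto_pow_mul_exp_neg_mul_sq (c := ε / 4) (by positivity)
    (add_nonneg zero_le_one hK) hK j).const_mul (K * j.factorial * Real.exp (ε / 2 * K ^ 2))
  rw [mul_zero] at hdecay
  obtain ⟨R, hR⟩ := eventually_atTop.1 (hdecay.eventually_lt_const hδ)
  refine ⟨R, ?_⟩
  filter_upwards [hcoercive, happ, hsize, hSs] with n hcn han hsn hSn x hx
  have hdet := Real.sqrt_nonneg ((S n).det / (2 * Real.pi) ^ d)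
  have hmean := norm_nonneg (μ n)
  have hslope := norm_nonneg (app (S n) (μ n))
  have hbound := norm_iteratedFDeriv_gaussianDensity_le (ν := μ n) (K := K) hSn hε.le hcn
    (by linarith) (fun y => (han y).trans (mul_le_mul_of_nonneg_right hK₁K (norm_nonneg y)))
    (by linarith) (by linarith) j x
  refine hbound.trans_lt ((hR ‖x‖ hx.le).trans_eq' ?_)
  ring

lemma tendstoUniformly_iteratedFDeriv_gaussianDensity (hS : Tendsto S F (𝓝 T))
    (hμ : Tendsto μ F (𝓝 μ₀)) (hT : T.PosDef) (hSs : ∀ᶠ n in F, (S n).IsSymm) (j : ℕ) :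
    TendstoUniformly (fun n => iteratedFDeriv ℝ j (gaussianDensity (μ n) (S n)))
      (iteratedFDeriv ℝ j (gaussianDensity μ₀ T)) F := by
  refine tendstoUniformly_of_tendstoLocallyUniformly
    (tendstoLocallyUniformly_iteratedFDeriv_gaussianDensity hS hμ j)
    (fun δ hδ => exists_eventually_norm_iteratedFDeriv_gaussianDensity_lt hS hμ hT hSs j hδ)
    fun δ hδ => ?_
  obtain ⟨R, hR⟩ := exists_eventually_norm_iteratedFDeriv_gaussianDensity_lt
    (F := (⊤ : Filter Unit)) tendsto_const_nhds tendsto_const_nhds hT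
    (Eventually.of_forall fun _ => isSymm_of_posDef hT) j hδ
  exact ⟨R, eventually_top.1 hR ()⟩

end Gaussians

section ModesOfConvergence

variable {d : ℕ}

lemma convergesValue_quadratic {L : ℕ → Mat d} {L₀ : Mat d} {ρ : ℕ → E d} {ρ₀ : E d} {c : ℕ → ℝ}
    {c₀ : ℝ} (hL : Tendsto L atTop (𝓝 L₀)) (hρ : Tendsto ρ atTop (𝓝 ρ₀))
    (hc : Tendsto c atTop (𝓝 c₀)) (hLs : ∀ᶠ n in atTop, (L n).IsSymm) (hL₀ : L₀.IsSymm) :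
    ConvergesValue (fun n => quadratic (L n) (ρ n) (c n)) (quadratic L₀ ρ₀ c₀) :=
  ⟨fun j _ => tendstoLocallyUniformly_iteratedFDeriv_quadratic hL hρ hc j,
    tendstoUniformly_iteratedFDeriv_two_quadratic hL hρ hc hLs hL₀⟩

lemma convergesDensity_gaussianDensity {S : ℕ → Mat d} {S₀ : Mat d} {μ : ℕ → E d} {μ₀ : E d}
    (hS : Tendsto S atTop (𝓝 S₀)) (hμ : Tendsto μ atTop (𝓝 μ₀)) (h₀ : S₀.PosDef)
    (hSs : ∀ᶠ n in atTop, (S n).IsSymm) :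
    ConvergesDensity (fun n => gaussianDensity (μ n) (S n)) (gaussianDensity μ₀ S₀) :=
  fun _ j _ => tendstoUniformly_iteratedFDeriv_gaussianDensity hS hμ h₀ hSs j

lemma ConvergesValue.congr {w w' : ℕ → E d → ℝ} {v : E d → ℝ} (h : ConvergesValue w v)
    (hw : ∀ᶠ n in atTop, w n = w' n) : ConvergesValue w' v := by
  refine ⟨fun j hj u hu x => ?_, fun u hu => ?_⟩
  · obtain ⟨t, ht, htu⟩ := h.1 j hj u hu x
    refine ⟨t, ht, ?_⟩
    filter_upwards [htu, hw] with n hn hwn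
    rwa [← hwn]
  · filter_upwards [h.2 u hu, hw] with n hn hwn
    rwa [← hwn]

lemma ConvergesDensity.congr {p p' : ℕ → E d → ℝ} {m : E d → ℝ} (h : ConvergesDensity p m)
    (hp : ∀ᶠ n in atTop, p n = p' n) : ConvergesDensity p' m := by
  intro n j hj u hu
  filter_upwards [h n j hj u hu, hp] with N hN hpN
  rwa [← hpN]

lemma convergesValue_mfValue {A Q₀ B₀ C₀ D₀ S₀ : Mat d} {Q B C D S : ℕ → Mat d} {μ : ℕ → E d}
    {μ₀ : E d} {k : ℝ} (r ℓ : ℝ) (hA : A.IsSymm) (hk : 0 < k) (hQ : Tendsto Q atTop (𝓝 Q₀))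
    (hB : Tendsto B atTop (𝓝 B₀)) (hC : Tendsto C atTop (𝓝 C₀)) (hD : Tendsto D atTop (𝓝 D₀))
    (hS : Tendsto S atTop (𝓝 S₀)) (hS₀ : S₀.PosDef) (hSs : ∀ᶠ n in atTop, (S n).IsSymm)
    (hμ : Tendsto μ atTop (𝓝 μ₀)) (H Δ₀ : E d) :
    ConvergesValue (fun n => mfValue A r k ℓ (Q n) (B n) (C n) (D n) (S n) H Δ₀ (μ n))
      (mfValue A r k ℓ Q₀ B₀ C₀ D₀ S₀ H Δ₀ μ₀) :=
  convergesValue_quadratic ((hS.add_const A).const_smul r) ((tendsto_app hS hμ).const_smul r).neg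
    (tendsto_valueConst A r k ℓ H hQ hS hμ (tendsto_app hB (hμ.sub_const Δ₀))
      (tendsto_mfConst hC hD (hS.const_smul k⁻¹) (hS₀.smul (inv_pos.2 hk)) hμ Δ₀))
    (hSs.mono fun _ h => (h.add hA).smul r) (((isSymm_of_posDef hS₀).add hA).smul r)

end ModesOfConvergence

/-! ### Large numbers of players -/

/-- A sequence of games with nearly identical players and a common matrix `A`, whose interactions
are of the order of magnitude that makes the averaged costs of the players converge to the mean
field cost with matrices `Qh`, `Bh`, `Ch`, `Dh`. -/
structure IsMeanFieldSequence {d : ℕ} (A Qh Bh Ch Dh : Mat d) (H Δ₀ : E d)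
    (G : (N : ℕ) → LQGame d N) (Q B : ℕ → Mat d) (C D : ℕ → ℕ → Mat d) : Prop where
  A_eq : ∀ N, 1 ≤ N → (G N).A = A
  h1 : ∀ N, 1 ≤ N → (G N).H1
  h2 : ∀ N, 1 ≤ N → (G N).H2 (Q N) (B N) (fun i => C N i) (fun i => D N i) H Δ₀
  tendsto_Q : Tendsto Q atTop (𝓝 Qh)
  tendsto_B : Tendsto (fun N : ℕ => ((N : ℝ) - 1) • B N) atTop (𝓝 Bh)
  tendsto_C : ∀ i, Tendsto (fun N : ℕ => ((N : ℝ) - 1) • C N i) atTop (𝓝 Ch)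
  tendsto_D : ∀ i, Tendsto (fun N : ℕ => ((N : ℝ) - 1) ^ 2 • D N i) atTop (𝓝 Dh)

section ManyPlayers

variable {d : ℕ} {A Qh Bh Ch Dh : Mat d} {H Δ₀ : E d} {r k ℓ : ℝ} {G : (N : ℕ) → LQGame d N}
  {Q B : ℕ → Mat d} {C D : ℕ → ℕ → Mat d} {v m : E d → ℝ}

lemma tendsto_mul_smul_of_tendsto_sq_smul {D : ℕ → Mat d} {D₀ : Mat d}
    (hD : Tendsto (fun N : ℕ => ((N : ℝ) - 1) ^ 2 • D N) atTop (𝓝 D₀)) :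
    Tendsto (fun N : ℕ => (((N : ℝ) - 1) * ((N : ℝ) - 2)) • D N) atTop (𝓝 D₀) := by
  have hsub : Tendsto (fun N : ℕ => (N : ℝ) - 1) atTop atTop :=
    tendsto_atTop_add_const_right _ _ tendsto_natCast_atTop_atTop
  have hratio := ((tendsto_inv_atTop_zero.comp hsub).const_sub (1 : ℝ)).smul hD
  rw [sub_zero, one_smul] at hratio
  refine hratio.congr' ?_
  filter_upwards [eventually_gt_atTop 1] with N hN
  have hN' : (N : ℝ) - 1 ≠ 0 := sub_ne_zero.2 (by exact_mod_cast hN.ne')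
  rw [Function.comp_apply, smul_smul]
  congr 1
  field_simp
  ring

lemma IsMeanFieldSequence.exists_tendsto_and_isSolution_iff
    (hG : IsMeanFieldSequence A Qh Bh Ch Dh H Δ₀ G Q B C D) (hr : r ≠ 0) (hk : 0 < k)
    (hℓ : 0 < ℓ) (hA : A.IsSymm) (hPd₀ : (riccatiMatrix A r ℓ Qh).PosDef) {S₀ : Mat d}
    (hS₀ : S₀.PosDef) (hP₀ : S₀ * S₀ + ℓ • S₀ = riccatiMatrix A r ℓ Qh)
    (hM : IsUnit (r • riccatiMatrix A r ℓ Qh + Bh)) {μ₀ : E d}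
    (hμ₀ : app (r • riccatiMatrix A r ℓ Qh + Bh) μ₀ = (2 : ℝ) • app Qh H + app Bh Δ₀) :
    ∃ (S : ℕ → Mat d) (μ : ℕ → E d), Tendsto S atTop (𝓝 S₀) ∧ Tendsto μ atTop (𝓝 μ₀) ∧
      (∀ᶠ N in atTop, (S N).IsSymm) ∧
      ∀ᶠ N : ℕ in atTop, ∀ v m : Fin N → E d → ℝ,
        ((G N).IsSolution r k ℓ v m ∧ IsQGProfile v m) ↔
          ∀ i, v i = mfValue A r k ℓ (Q N) (((N : ℝ) - 1) • B N) (((N : ℝ) - 1) • C N i)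
              ((((N : ℝ) - 1) * ((N : ℝ) - 2)) • D N i) (S N) H Δ₀ (μ N) ∧
            m i = gaussianDensity (μ N) (k⁻¹ • S N) := by
  have hP := tendsto_riccatiMatrix A r ℓ hG.tendsto_Q
  have hPd : ∀ᶠ N in atTop, (riccatiMatrix A r ℓ (Q N)).PosDef := by
    refine eventually_posDef hP hPd₀ ?_
    filter_upwards [eventually_ge_atTop 1] with N hN
    exact isSymm_riccatiMatrix hA (isSymm_of_posDef (hG.h2 N hN).Q_posDef) r ℓ
  obtain ⟨S, hS, hSP⟩ := exists_tendsto_mul_self_add_smul_eq hℓ hP hPd hS₀ hP₀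
  obtain ⟨μ, hμ, hμ_iff⟩ := exists_tendsto_app_eq ((hP.const_smul r).add hG.tendsto_B) hM
    (((tendsto_app hG.tendsto_Q tendsto_const_nhds).const_smul (2 : ℝ)).add
      (tendsto_app hG.tendsto_B tendsto_const_nhds)) hμ₀
  refine ⟨S, μ, hS, hμ, hSP.mono fun N h => isSymm_of_posDef h.1, ?_⟩
  filter_upwards [hPd, hSP, hμ_iff, eventually_ge_atTop 1] with N hPdN hSN hμN hN v m
  obtain rfl := hG.A_eq N hN
  rw [LQGame.isSolution_and_isQGProfile_iff hN (hG.h1 N hN) (hG.h2 N hN) hr hk hℓ hA hPdN hSN.1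
    hSN.2]
  simp only [hμN, exists_eq_left]

lemma IsMeanFieldSequence.exists_isSolution_iff_and_converges
    (hG : IsMeanFieldSequence A Qh Bh Ch Dh H Δ₀ G Q B C D) (hr : r ≠ 0) (hk : 0 < k)
    (hℓ : 0 < ℓ) (hA : A.IsSymm) (hQ : Qh.IsSymm) (hB : Bh.IsSymm)
    (hPd : (riccatiMatrix A r ℓ Qh).PosDef) (hM : IsUnit (limitMatrix A r ℓ Qh Bh))
    (hvm : IsMFSolution A r k ℓ Qh Bh Ch Dh H Δ₀ v m) :
    ∃ (V : ℕ → ℕ → E d → ℝ) (p : ℕ → E d → ℝ),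
      (∀ᶠ N : ℕ in atTop, ∀ v m : Fin N → E d → ℝ,
        ((G N).IsSolution r k ℓ v m ∧ IsQGProfile v m) ↔ ∀ i, v i = V N i ∧ m i = p N) ∧
      (∀ i, ConvergesValue (fun N => V N i) v) ∧ ConvergesDensity p m := by
  obtain ⟨S₀, hS₀, hP₀⟩ := exists_posDef_mul_self_add_smul_eq hPd ℓ
  obtain ⟨μ₀, hμ₀, rfl, rfl⟩ := (isMFSolution_iff hr hk hℓ hA hQ hB hPd hS₀ hP₀).1 hvm
  obtain ⟨S, μ, hS, hμ, hSs, hiff⟩ := hG.exists_tendsto_and_isSolution_iff hr hk hℓ hA hPd hS₀ hP₀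
    ((isUnit_limitMatrix_iff A hr ℓ Qh Bh).1 hM) hμ₀
  exact ⟨_, _, hiff,
    fun i => convergesValue_mfValue r ℓ hA hk hG.tendsto_Q hG.tendsto_B (hG.tendsto_C i)
      (tendsto_mul_smul_of_tendsto_sq_smul (hG.tendsto_D i)) hS hS₀ hSs hμ H Δ₀,
    convergesDensity_gaussianDensity (hS.const_smul k⁻¹) hμ (hS₀.smul (inv_pos.2 hk))
      (hSs.mono fun _ h => h.smul _)⟩

theorem IsMeanFieldSequence.eventually_existsUnique_and_converges
    (hG : IsMeanFieldSequence A Qh Bh Ch Dh H Δ₀ G Q B C D) (hr : r ≠ 0) (hk : 0 < k)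
    (hℓ : 0 < ℓ) (hA : A.IsSymm) (hQ : Qh.IsSymm) (hB : Bh.IsSymm)
    (hPd : (riccatiMatrix A r ℓ Qh).PosDef) (hM : IsUnit (limitMatrix A r ℓ Qh Bh))
    (hvm : IsMFSolution A r k ℓ Qh Bh Ch Dh H Δ₀ v m) :
    (∀ᶠ N in atTop, ∃! p : (Fin N → E d → ℝ) × (Fin N → E d → ℝ),
      (G N).IsSolution r k ℓ p.1 p.2 ∧ IsQGProfile p.1 p.2) ∧
    ∀ vN mN : ℕ → ℕ → E d → ℝ,
      (∀ᶠ N in atTop, (G N).IsSolution r k ℓ (fun i => vN N i) (fun i => mN N i) ∧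
        IsQGProfile (N := N) (fun i => vN N i) (fun i => mN N i)) →
      ∀ i : ℕ, ConvergesValue (fun N => vN N i) v ∧ ConvergesDensity (fun N => mN N i) m := by
  obtain ⟨V, p, hiff, hV, hp⟩ :=
    hG.exists_isSolution_iff_and_converges hr hk hℓ hA hQ hB hPd hM hvm
  refine ⟨?_, fun vN mN hsol i => ?_⟩
  · filter_upwards [hiff] with N hN
    refine ⟨(fun i => V N i, fun _ => p N), (hN _ _).2 fun i => ⟨rfl, rfl⟩, fun q hq => ?_⟩
    have hVp := (hN q.1 q.2).1 hq
    exact Prod.ext (funext fun i => (hVp i).1) (funext fun i => (hVp i).2)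
  · have heq : ∀ᶠ N in atTop, vN N i = V N i ∧ mN N i = p N := by
      filter_upwards [hiff, hsol, eventually_gt_atTop i] with N hN hsolN hi
      exact (hN _ _).1 hsolN ⟨i, hi⟩
    exact ⟨(hV i).congr (heq.mono fun _ h => h.1.symm), hp.congr (heq.mono fun _ h => h.2.symm)⟩

end ManyPlayers

end LQMFG

end

open LQMFG in
theorem mainTheorem2_general {d : ℕ} {r k ℓ : ℝ} (hr : r ≠ 0) (hk : 0 < k) (hℓ : 0 < ℓ)
    {A Qh Bh : Mat d} (hA : A.IsSymm) (hQ : Qh.IsSymm) (hB : Bh.IsSymm)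
    (hPd : (riccatiMatrix A r ℓ Qh).PosDef) (Ch Dh : Mat d) (H Δ₀ : E d) :
    ((∃! p : (E d → ℝ) × (E d → ℝ),
        IsMFSolution A r k ℓ Qh Bh Ch Dh H Δ₀ p.1 p.2 ∧ IsQG p.1 p.2) ↔
      IsUnit (limitMatrix A r ℓ Qh Bh)) ∧
    (IsUnit (limitMatrix A r ℓ Qh Bh) →
      ∃ v m : E d → ℝ, IsMFSolution A r k ℓ Qh Bh Ch Dh H Δ₀ v m ∧ IsQG v m ∧
        (∀ v' m' : E d → ℝ, IsMFSolution A r k ℓ Qh Bh Ch Dh H Δ₀ v' m' → v' = v ∧ m' = m) ∧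
        ∀ (G : (N : ℕ) → LQGame d N) (Q B : ℕ → Mat d) (C D : ℕ → ℕ → Mat d),
          IsMeanFieldSequence A Qh Bh Ch Dh H Δ₀ G Q B C D →
          (∀ᶠ N in atTop, ∃! p : (Fin N → E d → ℝ) × (Fin N → E d → ℝ),
            (G N).IsSolution r k ℓ p.1 p.2 ∧ IsQGProfile p.1 p.2) ∧
          ∀ vN mN : ℕ → ℕ → E d → ℝ,
            (∀ᶠ N in atTop, (G N).IsSolution r k ℓ (fun i => vN N i) (fun i => mN N i) ∧
              IsQGProfile (N := N) (fun i => vN N i) (fun i => mN N i)) →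
            ∀ i : ℕ, ConvergesValue (fun N => vN N i) v ∧
              ConvergesDensity (fun N => mN N i) m) := by
  refine ⟨existsUnique_qg_iff hr hk hℓ hA hQ hB hPd, fun hM => ?_⟩
  obtain ⟨v, m, hvm, hqg, huniq⟩ :=
    exists_qg_unique_of_isUnit hr hk hℓ hA hQ hB hPd hM Ch Dh H Δ₀
  exact ⟨v, m, hvm, hqg, huniq, fun G Q B C D hG =>
    hG.eventually_existsUnique_and_converges hr hk hℓ hA hQ hB hPd hM hvm⟩

theorem mainTheorem2 (d : ℕ) (r k : ℝ) (hr : 0 < r) (hk : 0 < k)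
    (A : LQMFG.Mat d) (hA : A.IsSymm)
    (Qh Bh Ch Dh : LQMFG.Mat d) (hQ : Qh.PosDef) (hB : Bh.IsSymm)
    (H Δ₀ : LQMFG.E d) :
    ∃ ℓh : ℝ, 0 < ℓh ∧
      -- (a) solutions of the mean field system
      (∀ ℓ : ℝ, 0 < ℓ → ℓ < ℓh →
        ((∃! p : (LQMFG.E d → ℝ) × (LQMFG.E d → ℝ),
            LQMFG.IsMFSolution A r k ℓ Qh Bh Ch Dh H Δ₀ p.1 p.2 ∧ LQMFG.IsQG p.1 p.2) ↔
          IsUnit (LQMFG.limitMatrix A r ℓ Qh Bh))) ∧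
      -- (b) uniqueness among all solutions with the same value at the origin
      (∀ ℓ : ℝ, 0 < ℓ → ℓ < ℓh → Bh.PosSemidef →
        ∃ v m : LQMFG.E d → ℝ,
          LQMFG.IsMFSolution A r k ℓ Qh Bh Ch Dh H Δ₀ v m ∧ LQMFG.IsQG v m ∧
          ∀ v' m' : LQMFG.E d → ℝ,
            LQMFG.IsMFSolution A r k ℓ Qh Bh Ch Dh H Δ₀ v' m' → v' 0 = v 0 →
              v' = v ∧ m' = m) ∧
      -- (c) convergence as the number of players tends to infinity
      (∀ ℓ : ℝ, 0 < ℓ → ℓ < ℓh →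
        ∀ (σ : LQMFG.Mat d) (G : (N : ℕ) → LQMFG.LQGame d N)
          (Q B : ℕ → LQMFG.Mat d) (C D : ℕ → ℕ → LQMFG.Mat d),
          (∀ N, 1 ≤ N → (G N).A = A ∧ (G N).σ = σ ∧ (G N).H1 ∧
            (G N).H2 (Q N) (B N) (fun i => C N i) (fun i => D N i) H Δ₀ ∧ (G N).H3 r k) →
          Tendsto Q atTop (𝓝 Qh) →
          Tendsto (fun N : ℕ => ((N : ℝ) - 1) • B N) atTop (𝓝 Bh) →
          (∀ i, Tendsto (fun N : ℕ => ((N : ℝ) - 1) • C N i) atTop (𝓝 Ch)) →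
          (∀ i, Tendsto (fun N : ℕ => ((N : ℝ) - 1) ^ 2 • D N i) atTop (𝓝 Dh)) →
          (∃! p : (LQMFG.E d → ℝ) × (LQMFG.E d → ℝ),
            LQMFG.IsMFSolution A r k ℓ Qh Bh Ch Dh H Δ₀ p.1 p.2 ∧ LQMFG.IsQG p.1 p.2) →
          (∀ᶠ N in atTop,
            ∃! p : (Fin N → LQMFG.E d → ℝ) × (Fin N → LQMFG.E d → ℝ),
              (G N).IsSolution r k ℓ p.1 p.2 ∧ LQMFG.IsQGProfile p.1 p.2) ∧
          ∃ v m : LQMFG.E d → ℝ,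
            LQMFG.IsMFSolution A r k ℓ Qh Bh Ch Dh H Δ₀ v m ∧ LQMFG.IsQG v m ∧
            -- `vN N i`, `mN N i` matter for the players `i < N` only
            ∀ vN mN : ℕ → ℕ → LQMFG.E d → ℝ,
              (∀ᶠ N in atTop,
                (G N).IsSolution r k ℓ (fun i => vN N i) (fun i => mN N i) ∧
                LQMFG.IsQGProfile (N := N) (fun i => vN N i) (fun i => mN N i)) →
              ∀ i : ℕ, LQMFG.ConvergesValue (fun N => vN N i) v ∧
                LQMFG.ConvergesDensity (fun N => mN N i) m) := by
  obtain ⟨ℓh, hℓh, hPd⟩ := LQMFG.exists_riccatiMatrix_posDef hA hQ hr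
  have key {ℓ : ℝ} (hℓ : 0 < ℓ) (hlt : ℓ < ℓh) := mainTheorem2_general hr.ne' hk hℓ hA
    (LQMFG.isSymm_of_posDef hQ) hB (hPd ℓ hℓ hlt) Ch Dh H Δ₀
  refine ⟨ℓh, hℓh, fun ℓ hℓ hlt => (key hℓ hlt).1, fun ℓ hℓ hlt hBp => ?_, ?_⟩
  · obtain ⟨v, m, hvm, hqg, huniq, -⟩ :=
      (key hℓ hlt).2 (LQMFG.isUnit_limitMatrix_of_posSemidef hr (hPd ℓ hℓ hlt) hBp)
    exact ⟨v, m, hvm, hqg, fun v' m' h _ => huniq v' m' h⟩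
  · intro ℓ hℓ hlt σ G Q B C D hG hQN hBN hCN hDN hunique
    obtain ⟨v, m, hvm, hqg, -, hgames⟩ := (key hℓ hlt).2 ((key hℓ hlt).1.1 hunique)
    obtain ⟨hexists, hconv⟩ := hgames G Q B C D
      ⟨fun N hN => (hG N hN).1, fun N hN => (hG N hN).2.2.1, fun N hN => (hG N hN).2.2.2.1,
        hQN, hBN, hCN, hDN⟩
    exact ⟨hexists, v, m, hvm, hqg, hconv⟩
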